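/- Theorem 4.1. Let $\lambda_1>0$, $\omega<0$ and $Z\in\mathbb R$ with $\omega+\frac{Z^2}{4}<0$, and suppose that either $\lambda_2>0$, or $\lambda_2<0$ and $-\omega<-\frac{3\lambda_1^2}{16\lambda_2}$. Put $\alpha=\lambda_1/4$, $\beta=\lambda_2/3$, let $R:\mathbb R\to(-1,1)$ be the bijection $$R(s)=\frac{\sqrt{\alpha^2-\beta\omega}\,\sinh(2\sqrt{-\omega}\,s)}{\alpha+\sqrt{\alpha^2-\beta\omega}\,\cosh(2\sqrt{-\omega}\,s)},$$ and let $$\phi_{\omega,Z}(x)=\left[\frac{\alpha}{-\omega}+\frac{\sqrt{\alpha^2-\beta\omega}}{-\omega}\cosh\left(2\sqrt{-\omega}\left(|x|+R^{-1}\left(\tfrac{Z}{2\sqrt{-\omega}}\right)\right)\right)\right]^{-1/2},\qquad x\in\mathbb R .$$ Let $\mathcal L_{2,Z}$ be the operator in $L^2(\mathbb R)=L^2(\mathbb R;\mathbb C)$ with domain $$D_Z=\{g\in H^1(\mathbb R)\cap H^2(\mathbb R\setminus\{0\}) : g'(0+)-g'(0-)=-Zg(0)\},$$ given by $\mathcal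 L_{2,Z}g=-g''-\omega g-\lambda_1\phi_{\omega,Z}^2g-\lambda_2\phi_{\omega,Z}^4g$, where $g''$ is taken on $\mathbb R\setminus\{0\}$. Then $\mathcal L_{2,Z}$ is densely defined and self-adjoint, and: 1. $0$ is a simple eigenvalue of $\mathcal L_{2,Z}$ (that is, $\dim\ker\mathcal L_{2,Z}=1$), with eigenfunction $\phi_{\omega,Z}\in D_Z$, and $\phi_{\omega,Z}(x)>0$ for all $x\in\mathbb R$. 2. The rest of the spectrum is positive and bounded away from zero: there is $\delta>0$ with $\sigma(\mathcal L_{2,Z})\setminus\{0\}\subset[\delta,\infty)$. 3. $\sigma_{ess}(\mathcal L_{2,Z})=[-\omega,\infty)$, where $\sigma_{ess}$ is the set of points of the spectrum that are not isolated eigenvalues of finite multiplicity. -/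

import Mathlib

open MeasureTheory Set Filter Topology

namespace DeltaNLS

noncomputable section

/-! ### The profile -/

/-- `√(α² - βω)` with `α = l₁ / 4` and `β = l₂ / 3`. -/
def amp (l₁ l₂ ω : ℝ) : ℝ := Real.sqrt ((l₁ / 4) ^ 2 - l₂ / 3 * ω)

/-- The function `R`; for the admissible parameters a bijection of `ℝ` onto `(-1, 1)`. -/
def R (l₁ l₂ ω : ℝ) (s : ℝ) : ℝ :=
  amp l₁ l₂ ω * Real.sinh (2 * Real.sqrt (-ω) * s) /
    (l₁ / 4 + amp l₁ l₂ ω * Real.cosh (2 * Real.sqrt (-ω) * s))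

/-- The shift `R⁻¹(Z / (2√(-ω)))`. -/
def shift (l₁ l₂ ω Z : ℝ) : ℝ :=
  Function.invFun (R l₁ l₂ ω) (Z / (2 * Real.sqrt (-ω)))

/-- The profile `φ_{ω,Z}`. -/
def profile (l₁ l₂ ω Z : ℝ) (x : ℝ) : ℝ :=
  (l₁ / 4 / (-ω) + amp l₁ l₂ ω / (-ω) *
    Real.cosh (2 * Real.sqrt (-ω) * (|x| + shift l₁ l₂ ω Z))) ^ (-(1 / 2) : ℝ)

/-! ### The Hilbert space, weak derivatives and one-sided values -/

/-- The complex Hilbert space `L²(ℝ)`. -/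
abbrev H : Type := Lp ℂ 2 (volume : Measure ℝ)

/-- `g` is the weak derivative of `f` on the open set `U`; both are square integrable. As `U` will
be `ℝ` or `ℝ ∖ {0}`, the spaces `L²(U)` and `L²(ℝ)` coincide. -/
def HasWeakDeriv (U : Set ℝ) (f g : H) : Prop :=
  ∀ η : ℝ → ℝ, ContDiff ℝ ((⊤ : ℕ∞) : WithTop ℕ∞) η → HasCompactSupport η → tsupport η ⊆ U →
    ∫ x, deriv η x • f x = - ∫ x, η x • g x

/-- `f` has a representative on `s` which is continuous on `s` and tends to `a` as `x → 0` within
`s`. With `s = ℝ` this says `f(0) = a`, with `s = (0, ∞)` it says `f(0+) = a`, and with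
`s = (-∞, 0)` it says `f(0-) = a`. -/
def HasTrace (s : Set ℝ) (f : H) (a : ℂ) : Prop :=
  ∃ g : ℝ → ℂ, f =ᵐ[volume.restrict s] g ∧ ContinuousOn g s ∧ Tendsto g (𝓝[s] 0) (𝓝 a)

theorem integrable_smul_H {η : ℝ → ℝ} (h : Continuous η) (hc : HasCompactSupport η) (f : H) :
    Integrable (fun x => η x • f x) :=
  ((Lp.memLp f).locallyIntegrable (by norm_num)).integrable_smul_left_of_hasCompactSupport h hc

theorem HasWeakDeriv.add {U : Set ℝ} {f g f' g' : H} (h : HasWeakDeriv U f g)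
    (h' : HasWeakDeriv U f' g') : HasWeakDeriv U (f + f') (g + g') := by
  intro η h1 h2 h3
  have hd : Continuous (deriv η) := h1.continuous_deriv (by simp)
  have e1 : ∫ x, deriv η x • (f + f' : H) x = ∫ x, (deriv η x • f x + deriv η x • f' x) := by
    refine integral_congr_ae ?_
    filter_upwards [Lp.coeFn_add f f'] with x hx
    rw [hx, Pi.add_apply, smul_add]
  have e2 : ∫ x, η x • (g + g' : H) x = ∫ x, (η x • g x + η x • g' x) := by
    refine integral_congr_ae ?_
    filter_upwards [Lp.coeFn_add g g'] with x hx
    rw [hx, Pi.add_apply, smul_add]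
  rw [e1, e2, integral_add (integrable_smul_H hd h2.deriv f) (integrable_smul_H hd h2.deriv f'),
    integral_add (integrable_smul_H h1.continuous h2 g) (integrable_smul_H h1.continuous h2 g'),
    h η h1 h2 h3, h' η h1 h2 h3]
  ring

theorem HasWeakDeriv.smul {U : Set ℝ} {f g : H} (h : HasWeakDeriv U f g) (c : ℂ) :
    HasWeakDeriv U (c • f) (c • g) := by
  intro η h1 h2 h3
  have e1 : ∫ x, deriv η x • (c • f : H) x = ∫ x, c • (deriv η x • f x) := by
    refine integral_congr_ae ?_
    filter_upwards [Lp.coeFn_smul c f] with x hx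
    rw [hx, Pi.smul_apply, smul_comm]
  have e2 : ∫ x, η x • (c • g : H) x = ∫ x, c • (η x • g x) := by
    refine integral_congr_ae ?_
    filter_upwards [Lp.coeFn_smul c g] with x hx
    rw [hx, Pi.smul_apply, smul_comm]
  rw [e1, e2, integral_smul, integral_smul, h η h1 h2 h3, smul_neg]

theorem HasWeakDeriv.zero (U : Set ℝ) : HasWeakDeriv U 0 0 := by
  intro η _ _ _
  have e : (fun x => (0 : H) x) =ᵐ[volume] (fun _ => (0 : ℂ)) := Lp.coeFn_zero ℂ 2 volume
  have e1 : ∫ x, deriv η x • (0 : H) x = 0 := by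
    rw [← integral_zero ℝ ℂ]
    refine integral_congr_ae ?_
    filter_upwards [e] with x hx
    rw [hx, smul_zero]
  have e2 : ∫ x, η x • (0 : H) x = 0 := by
    rw [← integral_zero ℝ ℂ]
    refine integral_congr_ae ?_
    filter_upwards [e] with x hx
    rw [hx, smul_zero]
  rw [e1, e2, neg_zero]

/-- The weak derivative of zero vanishes, so weak derivatives are unique. -/
theorem HasWeakDeriv.eq_zero {U : Set ℝ} (hU : IsOpen U) (hn : volume Uᶜ = 0) {g : H}
    (h : HasWeakDeriv U 0 g) : g = 0 := by
  have key : ∀ᵐ x, x ∈ U → g x = 0 := by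
    refine hU.ae_eq_zero_of_integral_contDiff_smul_eq_zero
      (((Lp.memLp g).locallyIntegrable (by norm_num)).locallyIntegrableOn U) ?_
    intro η h1 h2 h3
    have := h η h1 h2 h3
    have e1 : ∫ x, deriv η x • (0 : H) x = 0 := by
      rw [← integral_zero ℝ ℂ]
      refine integral_congr_ae ?_
      filter_upwards [Lp.coeFn_zero ℂ 2 (volume : Measure ℝ)] with x hx
      rw [hx, Pi.zero_apply, smul_zero]
    rw [e1] at this
    exact neg_eq_zero.mp this.symm
  have hU' : ∀ᵐ x, x ∈ U := by
    rw [ae_iff]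
    exact hn
  refine Lp.ext ?_
  filter_upwards [key, hU', Lp.coeFn_zero ℂ 2 (volume : Measure ℝ)] with x h1 h2 h3
  rw [h1 h2, h3, Pi.zero_apply]

theorem HasTrace.add {s : Set ℝ} {f f' : H} {a a' : ℂ} (h : HasTrace s f a)
    (h' : HasTrace s f' a') : HasTrace s (f + f') (a + a') := by
  obtain ⟨g, h1, h2, h3⟩ := h
  obtain ⟨g', h1', h2', h3'⟩ := h'
  refine ⟨g + g', ?_, h2.add h2', h3.add h3'⟩
  filter_upwards [h1, h1', ae_restrict_of_ae (Lp.coeFn_add f f')] with x e1 e2 e3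
  rw [e3, Pi.add_apply, Pi.add_apply, e1, e2]

theorem HasTrace.smul {s : Set ℝ} {f : H} {a : ℂ} (h : HasTrace s f a) (c : ℂ) :
    HasTrace s (c • f) (c * a) := by
  obtain ⟨g, h1, h2, h3⟩ := h
  refine ⟨fun x => c * g x, ?_, continuousOn_const.mul h2, h3.const_mul c⟩
  filter_upwards [h1, ae_restrict_of_ae (Lp.coeFn_smul c f)] with x e1 e3
  rw [e3, Pi.smul_apply, e1, smul_eq_mul]

theorem HasTrace.zero (s : Set ℝ) : HasTrace s 0 0 :=
  ⟨fun _ => 0, ae_restrict_of_ae (Lp.coeFn_zero ℂ 2 volume), continuousOn_const,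
    tendsto_const_nhds⟩

/-! ### The operators -/

/-- The jump condition `u'(0+) - u'(0-) = -Z u(0)`, for `v = u'`. -/
def JumpCondition (Z : ℝ) (u v : H) : Prop :=
  ∃ c r l : ℂ, HasTrace univ u c ∧ HasTrace (Ioi 0) v r ∧ HasTrace (Iio 0) v l ∧
    r - l = -(Z : ℂ) * c

/-- The domain
`D_Z = {u ∈ H¹(ℝ) ∩ H²(ℝ ∖ {0}) : u'(0+) - u'(0-) = -Z u(0)}`. -/
def domainZ (Z : ℝ) : Set H :=
  {u | ∃ v w : H, HasWeakDeriv univ u v ∧ HasWeakDeriv {0}ᶜ v w ∧ JumpCondition Z u v}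

/-- The graph of `-d²/dx²` on `D_Z`: the pairs `(u, -u'')` with `u ∈ D_Z`, where `u''` is taken
on `ℝ ∖ {0}`. -/
def graphZ (Z : ℝ) : Submodule ℂ (H × H) where
  carrier := {p | ∃ v w : H, HasWeakDeriv univ p.1 v ∧ HasWeakDeriv {0}ᶜ v w ∧
    JumpCondition Z p.1 v ∧ p.2 = -w}
  zero_mem' := ⟨0, 0, HasWeakDeriv.zero _, HasWeakDeriv.zero _,
    ⟨0, 0, 0, HasTrace.zero _, HasTrace.zero _, HasTrace.zero _, by simp⟩, by simp⟩
  add_mem' := by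
    rintro p q ⟨v, w, h1, h2, ⟨c, r, l, hc, hr, hl, h3⟩, h4⟩
      ⟨v', w', h1', h2', ⟨c', r', l', hc', hr', hl', h3'⟩, h4'⟩
    refine ⟨v + v', w + w', h1.add h1', h2.add h2',
      ⟨c + c', r + r', l + l', hc.add hc', hr.add hr', hl.add hl', ?_⟩, ?_⟩
    · linear_combination h3 + h3'
    · rw [Prod.snd_add, h4, h4', neg_add]
  smul_mem' := by
    rintro k p ⟨v, w, h1, h2, ⟨c, r, l, hc, hr, hl, h3⟩, h4⟩
    refine ⟨k • v, k • w, h1.smul k, h2.smul k,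
      ⟨k * c, k * r, k * l, hc.smul k, hr.smul k, hl.smul k, ?_⟩, ?_⟩
    · linear_combination k * h3
    · rw [Prod.smul_snd, h4, smul_neg]

theorem graphZ_single_valued (Z : ℝ) (p : H × H) (hp : p ∈ graphZ Z) (h0 : p.1 = 0) :
    p.2 = 0 := by
  obtain ⟨v, w, h1, h2, _, h4⟩ := hp
  rw [h0] at h1
  have hv : v = 0 := h1.eq_zero isOpen_univ (by simp)
  rw [hv] at h2
  have hw : w = 0 := h2.eq_zero isOpen_compl_singleton (by simp)
  rw [h4, hw, neg_zero]

/-- The operator `A_Z = -d²/dx² - Z δ(x)`, i.e. `-d²/dx²` on the domain `D_Z`. -/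
def pointInteraction (Z : ℝ) : H →ₗ.[ℂ] H := (graphZ Z).toLinearPMap

theorem pointInteraction_graph (Z : ℝ) : (pointInteraction Z).graph = graphZ Z :=
  Submodule.toLinearPMap_graph_eq _ (graphZ_single_valued Z)

theorem pointInteraction_domain (Z : ℝ) :
    ((pointInteraction Z).domain : Set H) = domainZ Z := by
  ext u
  rw [SetLike.mem_coe, LinearPMap.mem_domain_iff, pointInteraction_graph]
  constructor
  · rintro ⟨y, v, w, h1, h2, h3, _⟩
    exact ⟨v, w, h1, h2, h3⟩
  · rintro ⟨v, w, h1, h2, h3⟩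
    exact ⟨-w, v, w, h1, h2, h3, rfl⟩

theorem ae_mul_add (V : ℝ → ℝ) (u v : H) :
    (fun x => (V x : ℂ) * (u + v : H) x) =ᵐ[volume]
      (fun x => (V x : ℂ) * u x) + (fun x => (V x : ℂ) * v x) := by
  filter_upwards [Lp.coeFn_add u v] with x hx
  simp only [hx, Pi.add_apply, mul_add]

theorem ae_mul_smul (V : ℝ → ℝ) (c : ℂ) (u : H) :
    (fun x => (V x : ℂ) * (c • u : H) x) =ᵐ[volume] c • (fun x => (V x : ℂ) * u x) := by
  filter_upwards [Lp.coeFn_smul c u] with x hx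
  simp only [hx, Pi.smul_apply, smul_eq_mul]
  ring

/-- The operator of multiplication by a real function `V`, on its maximal domain
`{u ∈ L²(ℝ) : V u ∈ L²(ℝ)}`. -/
def mulOp (V : ℝ → ℝ) : H →ₗ.[ℂ] H where
  domain :=
    { carrier := {u | MemLp (fun x => (V x : ℂ) * u x) 2 volume}
      zero_mem' := by
        refine (MemLp.zero (ε := ℂ)).ae_eq ?_
        filter_upwards [Lp.coeFn_zero ℂ 2 (volume : Measure ℝ)] with x hx
        rw [hx, Pi.zero_apply, mul_zero]
      add_mem' := fun {u v} hu hv => (MemLp.add hu hv).ae_eq (ae_mul_add V u v).symm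
      smul_mem' := fun c u hu => (MemLp.const_smul hu c).ae_eq (ae_mul_smul V c u).symm }
  toFun :=
    { toFun := fun u => MemLp.toLp (fun x => (V x : ℂ) * (u : H) x) u.2
      map_add' := fun u v => by
        rw [← MemLp.toLp_add]
        exact MemLp.toLp_congr _ _ (ae_mul_add V u v)
      map_smul' := fun c u => by
        rw [RingHom.id_apply, ← MemLp.toLp_const_smul]
        exact MemLp.toLp_congr _ _ (ae_mul_smul V c u) }

/-- `L_{2,Z} = -d²/dx² - ω - l₁ φ² - l₂ φ⁴`. The domain of a sum is the intersection of the
domains; here the potential is bounded, so this is `D_Z`. -/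
def L2Z (l₁ l₂ ω Z : ℝ) : H →ₗ.[ℂ] H :=
  pointInteraction Z +
    mulOp (fun x => -ω - l₁ * profile l₁ l₂ ω Z x ^ 2 - l₂ * profile l₁ l₂ ω Z x ^ 4)

/-! ### Spectral notions for unbounded operators -/

/-- `ker (T - z)`, the vectors `u` in the domain of `T` with `T u = z u`. -/
def eigenspace (T : H →ₗ.[ℂ] H) (z : ℂ) : Submodule ℂ H :=
  T.graph.comap (LinearMap.prod LinearMap.id (z • LinearMap.id))

theorem mem_eigenspace (T : H →ₗ.[ℂ] H) (z : ℂ) (u : H) :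
    u ∈ eigenspace T z ↔ ∃ h : u ∈ T.domain, T ⟨u, h⟩ = z • u := by
  simp [eigenspace, LinearPMap.mem_graph_iff]

/-- The resolvent set: `T - z` is a bijection of the domain of `T` onto the whole space, with
bounded inverse `S`. -/
def resolventSet (T : H →ₗ.[ℂ] H) : Set ℂ :=
  {z | ∃ S : H →L[ℂ] H,
    (∀ f : H, ∃ h : S f ∈ T.domain, T ⟨S f, h⟩ - z • S f = f) ∧
    ∀ u : T.domain, S (T u - z • (u : H)) = u}

/-- The spectrum. -/
def spec (T : H →ₗ.[ℂ] H) : Set ℂ := (resolventSet T)ᶜ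

/-- The discrete spectrum of a self-adjoint operator: the isolated points of the spectrum that are
eigenvalues of finite multiplicity. -/
def discreteSpec (T : H →ₗ.[ℂ] H) : Set ℂ :=
  {z | z ∈ spec T ∧ (∃ ε > 0, ∀ y ∈ spec T, dist y z < ε → y = z) ∧
    eigenspace T z ≠ ⊥ ∧ FiniteDimensional ℂ (eigenspace T z)}

/-- The essential spectrum of a self-adjoint operator: the complement in the spectrum of the
discrete spectrum. -/
def essSpec (T : H →ₗ.[ℂ] H) : Set ℂ := spec T \ discreteSpec T

end

end DeltaNLS

/-! Write κ = √(-ω), let φ be the profile, V = -ω - λ₁φ² - λ₂φ⁴, and h = φ'/φ on each half-line. The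
equation φ'' = Vφ is the Riccati equation h' = V - h², so T = `L2Z` factors as B*B with B = d/dx -
h. The point interaction is built into the factorisation: h jumps by -Z at 0, so the jump condition
on u says exactly that u' - hu is continuous across 0. Hence T is nonnegative, and its kernel is
that of B, the line through φ.

To make this quantitative, the proof avoids the unbounded B and uses its right inverse G v = φ ∫₀ˣ
v/φ. Between 0 and x one has φ(x)/φ(y) ≤ C exp(-κ(|x| - |y|)), so G is bounded by the Schur test.
Integrating the two first-order equations shows that Tu = f holds exactly when f ⊥ φ and u = GG*f +
cφ (`IsProfile.hasReducedInverse`). Density of the domain, self-adjointness, simplicity of 0 and the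
spectral gap then follow abstractly: a nonzero z in the spectrum of T has 1/z in the spectrum of K,
the compression of GG* to the complement of φ, and K is bounded and nonnegative.

For t ≥ κ², plane waves exp(ikx) with k² = t - κ², cut off far from the origin where V is almost κ²,
are approximate eigenfunctions (`IsProfile.mem_spec`). For 0 < t < κ², the constant C above improves
to 1 + ε once |y| is large. Thus G* is an operator of norm at most (1 + ε)/κ plus one that turns
weakly null sequences into null ones, and K - 1/t has no weakly null approximate kernel sequence of
unit vectors (`IsProfile.weaklyProper`). By a semi-Fredholm argument (`WeaklyProper.isUnit_sub`),
such a t, if it is in the spectrum, is an isolated eigenvalue of finite multiplicity. -/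

namespace DeltaNLS

open scoped InnerProductSpace

/-! ### Bounded self-adjoint operators that are proper along weakly null sequences -/

section Hilbert

variable {E : Type*} [NormedAddCommGroup E] [InnerProductSpace ℂ E] [CompleteSpace E]

/-- Sequential Banach–Alaoglu, carried over to the space by the Riesz isomorphism. -/
theorem exists_weak_limit [TopologicalSpace.SeparableSpace E] (u : ℕ → E) (hu : ∀ n, ‖u n‖ ≤ 1) :
    ∃ (x : E) (s : ℕ → ℕ), StrictMono s ∧
      ∀ w, Tendsto (fun n => ⟪u (s n), w⟫_ℂ) atTop (𝓝 ⟪x, w⟫_ℂ) := by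
  have hc := WeakDual.isSeqCompact_closedBall ℂ E 0 1
  have hm : ∀ n, StrongDual.toWeakDual (InnerProductSpace.toDual ℂ E (u n)) ∈
      WeakDual.toStrongDual ⁻¹' Metric.closedBall (0 : StrongDual ℂ E) 1 := by
    intro n
    simpa using hu n
  obtain ⟨a, -, s, hs, ha⟩ := hc hm
  refine ⟨(InnerProductSpace.toDual ℂ E).symm (WeakDual.toStrongDual a), s, hs, fun w => ?_⟩
  have h1 := (WeakDual.eval_continuous (𝕜 := ℂ) (E := E) w).tendsto a |>.comp ha
  rw [InnerProductSpace.toDual_symm_apply]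
  exact h1

/-- Weakly null approximate null sequences of `A` converge to zero in norm. -/
def WeaklyProper (A : E →L[ℂ] E) : Prop :=
  ∀ u : ℕ → E, (∀ n, ‖u n‖ ≤ 1) → (∀ w, Tendsto (fun n => ⟪u n, w⟫_ℂ) atTop (𝓝 0)) →
    Tendsto (fun n => A (u n)) atTop (𝓝 0) → Tendsto u atTop (𝓝 0)

/-- An infinite-dimensional kernel would contain a bounded sequence with mutual distances at least
1. Consecutive differences along a weakly convergent subsequence are weakly null and annihilated by
`A`, but do not tend to zero. -/
theorem WeaklyProper.finiteDimensional_ker [TopologicalSpace.SeparableSpace E] {A : E →L[ℂ] E}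
    (hA : WeaklyProper A) : FiniteDimensional ℂ (LinearMap.ker (A : E →ₗ[ℂ] E)) := by
  by_contra hfin
  obtain ⟨R, f, hR, hf, hd⟩ := exists_seq_norm_le_one_le_norm_sub (𝕜 := ℂ) hfin
  have hR0 : 0 < R := by linarith
  obtain ⟨x, s, hs, hx⟩ := exists_weak_limit (fun n => (((R⁻¹ : ℝ) : ℂ) • (f n : E))) (by
    intro n
    rw [norm_smul, Complex.norm_real, Real.norm_of_nonneg (by positivity)]
    have := hf n
    rw [Submodule.coe_norm] at this
    rw [inv_mul_le_iff₀ hR0]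
    linarith)
  set g : ℕ → E := fun n => ((R⁻¹ : ℝ) : ℂ) • (f n : E) with hg
  have hgn : ∀ n, ‖g n‖ ≤ 1 := by
    intro n
    rw [hg, norm_smul, Complex.norm_real, Real.norm_of_nonneg (by positivity)]
    have := hf n
    rw [Submodule.coe_norm] at this
    rw [inv_mul_le_iff₀ hR0]
    linarith
  have hAg : ∀ n, A (g n) = 0 := by
    intro n
    have : A (f n : E) = 0 := (f n).2
    rw [hg]
    simp [this]
  -- The factor 1/2 keeps differences of vectors of the unit ball in the unit ball.
  have key := hA (fun n => (2⁻¹ : ℂ) • (g (s (n + 1)) - g (s n))) (by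
    intro n
    rw [norm_smul]
    have h1 := norm_sub_le (g (s (n+1))) (g (s n))
    have h2 := hgn (s (n+1))
    have h3 := hgn (s n)
    norm_num
    linarith) (by
    intro w
    have h1 := ((hx w).comp (tendsto_add_atTop_nat 1)).sub (hx w)
    have h2 := h1.const_mul (starRingEnd ℂ (2⁻¹ : ℂ))
    rw [sub_self, mul_zero] at h2
    refine h2.congr fun n => ?_
    exact ((inner_smul_left _ _ _).trans (congrArg _ (inner_sub_left _ _ _))).symm) (by
    simp [hAg])
  have h2 := key.norm
  rw [norm_zero] at h2
  have h3 : ∀ n, 2⁻¹ * R⁻¹ ≤ ‖(2⁻¹ : ℂ) • (g (s (n + 1)) - g (s n))‖ := by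
    intro n
    rw [hg]
    simp only
    rw [← smul_sub, norm_smul, norm_smul, Complex.norm_real, Real.norm_of_nonneg (by positivity)]
    have h4 := hd (hs (Nat.lt_succ_self n)).ne'
    have h4' : 1 ≤ ‖(f (s (n + 1)) : E) - f (s n)‖ := by
      simpa using h4
    norm_num
    have : 0 < R⁻¹ := by positivity
    nlinarith
  have h5 := ge_of_tendsto' h2 h3
  have : 0 < 2⁻¹ * R⁻¹ := by positivity
  linarith

/-- Otherwise unit vectors orthogonal to the kernel have images tending to zero. By self-adjointness
their weak limit lies in the kernel, and it is also orthogonal to it, hence zero; properness then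
contradicts the norm being 1. -/
theorem WeaklyProper.bounded_below [TopologicalSpace.SeparableSpace E] {A : E →L[ℂ] E}
    (hA : WeaklyProper A) (hsa : IsSelfAdjoint A) :
    ∃ c : ℝ, 0 < c ∧ ∀ x ∈ (LinearMap.ker (A : E →ₗ[ℂ] E))ᗮ, c * ‖x‖ ≤ ‖A x‖ := by
  by_contra! hcon
  have h0 : ∀ n : ℕ, ∃ x ∈ (LinearMap.ker (A : E →ₗ[ℂ] E))ᗮ, ‖x‖ = 1 ∧ ‖A x‖ < 1 / ((n : ℝ) + 1) := by
    intro n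
    obtain ⟨x, hx, hx'⟩ := hcon (1 / ((n : ℝ) + 1)) (by positivity)
    have hx0 : 0 < ‖x‖ := by
      rcases (norm_nonneg x).eq_or_lt with h | h
      · rw [← h, mul_zero] at hx'
        exact absurd hx' (not_lt.mpr (norm_nonneg _))
      · exact h
    refine ⟨((‖x‖⁻¹ : ℝ) : ℂ) • x, Submodule.smul_mem _ _ hx, ?_, ?_⟩
    · rw [norm_smul, Complex.norm_real, Real.norm_of_nonneg (by positivity),
        inv_mul_cancel₀ hx0.ne']
    · rw [map_smul, norm_smul, Complex.norm_real, Real.norm_of_nonneg (by positivity),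
        inv_mul_lt_iff₀ hx0]
      linarith
  choose u hu hu1 hAu using h0
  have hAu0 : Tendsto (fun n => A (u n)) atTop (𝓝 0) :=
    squeeze_zero_norm (fun n => (hAu n).le) tendsto_one_div_add_atTop_nhds_zero_nat
  obtain ⟨x, s, hs, hx⟩ := exists_weak_limit u (fun n => (hu1 n).le)
  have hAx : A x = 0 := by
    refine ext_inner_right ℂ fun w => ?_
    have h1 : Tendsto (fun n => ⟪A (u (s n)), w⟫_ℂ) atTop (𝓝 ⟪(0 : E), w⟫_ℂ) :=
      (hAu0.comp hs.tendsto_atTop).inner tendsto_const_nhds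
    have h2 : Tendsto (fun n => ⟪A (u (s n)), w⟫_ℂ) atTop (𝓝 ⟪A x, w⟫_ℂ) := by
      have h3 := hx (A w)
      have h4 : ∀ y, ⟪y, A w⟫_ℂ = ⟪A y, w⟫_ℂ := fun y => (hsa.isSymmetric y w).symm
      simpa only [h4] using h3
    exact tendsto_nhds_unique h2 h1
  have hxN : x ∈ (LinearMap.ker (A : E →ₗ[ℂ] E))ᗮ := by
    rw [Submodule.mem_orthogonal']
    intro w hw
    have h1 : ∀ n, ⟪u (s n), w⟫_ℂ = 0 := fun n =>
      (Submodule.mem_orthogonal' _ _).mp (hu (s n)) w hw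
    have h2 := hx w
    simp only [h1] at h2
    exact (tendsto_nhds_unique h2 tendsto_const_nhds)
  have hx0 : x = 0 := by
    have := (Submodule.mem_orthogonal' _ _).mp hxN x hAx
    exact inner_self_eq_zero.mp this
  have h6 := hA (u ∘ s) (fun n => (hu1 _).le) (by simpa [hx0] using hx)
    (hAu0.comp hs.tendsto_atTop)
  have h7 := h6.norm
  simp [hu1] at h7

/-- The lower bound gives injectivity and closed range; the orthogonal complement of the range is
the kernel of `A` itself, hence zero. -/
theorem isUnit_of_bounded_below {A : E →L[ℂ] E} (hsa : IsSelfAdjoint A) {c : ℝ} (hc : 0 < c)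
    (h : ∀ x, c * ‖x‖ ≤ ‖A x‖) : IsUnit A := by
  rw [ContinuousLinearMap.isUnit_iff_bijective]
  have hanti : AntilipschitzWith (Real.toNNReal c⁻¹) A := by
    refine A.antilipschitz_of_bound fun x => ?_
    rw [Real.coe_toNNReal _ (by positivity), ← div_eq_inv_mul, le_div_iff₀ hc, mul_comm]
    exact h x
  refine ⟨hanti.injective, ?_⟩
  have hcl : IsClosed (LinearMap.range (A : E →ₗ[ℂ] E) : Set E) := by
    exact hanti.isClosed_range A.uniformContinuous
  have htop : LinearMap.range (A : E →ₗ[ℂ] E) = ⊤ := by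
    rw [← hcl.submodule_topologicalClosure_eq, Submodule.topologicalClosure_eq_top_iff,
      Submodule.eq_bot_iff]
    intro y hy
    rw [Submodule.mem_orthogonal] at hy
    have h1 : A y = 0 := by
      refine ext_inner_left ℂ fun w => ?_
      rw [inner_zero_right]
      have := hy (A w) ⟨w, rfl⟩
      rw [← this]
      exact (hsa.isSymmetric w y).symm
    exact hanti.injective (by rw [h1, map_zero])
  exact LinearMap.range_eq_top.mp htop

/-- Both the kernel of `A` and its complement are invariant under `A - t`, which acts as `-t` on the
first and is bounded below by `c - |t|` on the second. The two bounds combine by Pythagoras. -/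
theorem WeaklyProper.isUnit_sub [TopologicalSpace.SeparableSpace E] {A : E →L[ℂ] E}
    (hA : WeaklyProper A) (hsa : IsSelfAdjoint A) :
    ∃ c : ℝ, 0 < c ∧ ∀ t : ℝ, |t| < c → (t ≠ 0 ∨ LinearMap.ker (A : E →ₗ[ℂ] E) = ⊥) →
      IsUnit (A - (t : ℂ) • (1 : E →L[ℂ] E)) := by
  obtain ⟨c, hc, hb⟩ := hA.bounded_below hsa
  refine ⟨c, hc, fun t ht ht0 => ?_⟩
  have hsa' : IsSelfAdjoint (A - (t : ℂ) • (1 : E →L[ℂ] E)) := by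
    refine hsa.sub ?_
    rw [isSelfAdjoint_iff, star_smul, star_one]
    simp
  have hsub : ∀ x ∈ (LinearMap.ker (A : E →ₗ[ℂ] E))ᗮ,
      (c - |t|) * ‖x‖ ≤ ‖(A - (t : ℂ) • (1 : E →L[ℂ] E)) x‖ := by
    intro x hx
    have h1 := hb x hx
    have h2 : ‖A x‖ - ‖(t : ℂ) • x‖ ≤ ‖A x - (t : ℂ) • x‖ := norm_sub_norm_le _ _
    rw [norm_smul, Complex.norm_real, Real.norm_eq_abs] at h2
    simp only [_root_.sub_apply, _root_.smul_apply, one_apply_eq_self]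
    linarith
  by_cases hker : LinearMap.ker (A : E →ₗ[ℂ] E) = ⊥
  · rw [hker, Submodule.bot_orthogonal_eq_top] at hsub
    exact isUnit_of_bounded_below hsa' (sub_pos.mpr ht) fun x => hsub x trivial
  · have ht1 : t ≠ 0 := ht0.resolve_right hker
    set N := LinearMap.ker (A : E →ₗ[ℂ] E) with hN
    have hcl : IsClosed (N : Set E) := by
      have := A.isClosed_ker
      simpa [hN] using this
    have : CompleteSpace N := hcl.completeSpace_coe
    have hm : 0 < min |t| (c - |t|) := lt_min (abs_pos.mpr ht1) (sub_pos.mpr ht)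
    refine isUnit_of_bounded_below hsa' hm fun x => ?_
    obtain ⟨y, hy, z, hz, rfl⟩ := N.exists_add_mem_mem_orthogonal x
    have hAy : A y = 0 := hy
    have h1 : (A - (t : ℂ) • (1 : E →L[ℂ] E)) (y + z) =
        -((t : ℂ) • y) + (A - (t : ℂ) • (1 : E →L[ℂ] E)) z := by
      simp [hAy]
      abel
    have h2 : (A - (t : ℂ) • (1 : E →L[ℂ] E)) z ∈ Nᗮ := by
      rw [Submodule.mem_orthogonal]
      intro w hw
      have hAw : A w = 0 := hw
      have e1 : ⟪w, A z⟫_ℂ = 0 := by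
        have := hsa.isSymmetric w z
        simp only [ContinuousLinearMap.coe_coe] at this
        rw [← this, hAw, inner_zero_left]
      have e2 : ⟪w, z⟫_ℂ = 0 := (Submodule.mem_orthogonal _ _).mp hz w hw
      rw [_root_.sub_apply, _root_.smul_apply, one_apply_eq_self, inner_sub_right, inner_smul_right,
        e1, e2, mul_zero, sub_zero]
    have h3 : ⟪-((t : ℂ) • y), (A - (t : ℂ) • (1 : E →L[ℂ] E)) z⟫_ℂ = 0 := by
      rw [inner_neg_left, inner_smul_left, (Submodule.mem_orthogonal _ _).mp h2 y hy, mul_zero,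
        neg_zero]
    have h4 := norm_add_sq_eq_norm_sq_add_norm_sq_of_inner_eq_zero _ _ h3
    have h5 := norm_add_sq_eq_norm_sq_add_norm_sq_of_inner_eq_zero y z
      ((Submodule.mem_orthogonal _ _).mp hz y hy)
    rw [h1]
    refine le_of_sq_le_sq ?_ (norm_nonneg _)
    rw [norm_neg, norm_smul, Complex.norm_real, Real.norm_eq_abs] at h4
    have h6 := hsub z hz
    have h7 : min |t| (c - |t|) * ‖y‖ ≤ |t| * ‖y‖ := mul_le_mul_of_nonneg_right (min_le_left _ _) (norm_nonneg _)
    have h8 : min |t| (c - |t|) * ‖z‖ ≤ ‖(A - (t : ℂ) • (1 : E →L[ℂ] E)) z‖ :=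
      le_trans (mul_le_mul_of_nonneg_right (min_le_right _ _) (norm_nonneg _)) h6
    have h9 := mul_self_le_mul_self (by positivity) h7
    have h10 := mul_self_le_mul_self (by positivity) h8
    have h11 : min |t| (c - |t|) * ‖y + z‖ * (min |t| (c - |t|) * ‖y + z‖) =
        min |t| (c - |t|) * min |t| (c - |t|) * (‖y‖ * ‖y‖ + ‖z‖ * ‖z‖) := by
      rw [← h5]
      ring
    rw [sq, sq, h4, h11]
    linarith

end Hilbert

end DeltaNLS

/-! ### Spectral theory of an operator with reduced inverse `G G*` -/

namespace DeltaNLS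

open scoped InnerProductSpace

/-- The graph of `T` is that of the inverse of `G G*` on the orthogonal complement of `φ`, extended
by zero to the span of `φ`. -/
def HasReducedInverse (T : H →ₗ.[ℂ] H) (G : H →L[ℂ] H) (φ : H) : Prop :=
  ∀ u f : H, (u, f) ∈ T.graph ↔ ⟪φ, f⟫_ℂ = 0 ∧ ∃ c : ℂ, u = G (star G f) + c • φ

theorem inner_star_apply (G : H →L[ℂ] H) (x y : H) : ⟪star G x, y⟫_ℂ = ⟪x, G y⟫_ℂ := by
  rw [ContinuousLinearMap.star_eq_adjoint, ContinuousLinearMap.adjoint_inner_left]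

theorem inner_apply_star (G : H →L[ℂ] H) (x y : H) : ⟪G x, y⟫_ℂ = ⟪x, star G y⟫_ℂ := by
  rw [ContinuousLinearMap.star_eq_adjoint, ContinuousLinearMap.adjoint_inner_right]

section

variable {T : H →ₗ.[ℂ] H} {G : H →L[ℂ] H} {φ : H}

theorem HasReducedInverse.mem_graph_self (hT : HasReducedInverse T G φ) : (φ, (0 : H)) ∈ T.graph :=
  (hT φ 0).mpr ⟨inner_zero_right _, 1, by simp⟩

/-- A vector `w` orthogonal to the domain is orthogonal to `φ`, so `G G* w` lies in the domain and
pairs with `w` to `‖G* w‖² = 0`. Then `(0, w)` is in the graph, so `w = 0`. -/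
theorem HasReducedInverse.dense (hT : HasReducedInverse T G φ) :
    Dense (T.domain : Set H) := by
  rw [Submodule.dense_iff_topologicalClosure_eq_top, Submodule.topologicalClosure_eq_top_iff,
    Submodule.eq_bot_iff]
  intro w hw
  rw [Submodule.mem_orthogonal] at hw
  have h1 : ⟪φ, w⟫_ℂ = 0 :=
    hw φ (LinearPMap.mem_domain_iff.mpr ⟨0, hT.mem_graph_self⟩)
  have h2 : (G (star G w), w) ∈ T.graph := (hT _ _).mpr ⟨h1, 0, by simp⟩
  have h3 := hw _ (LinearPMap.mem_domain_iff.mpr ⟨_, h2⟩)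
  rw [inner_apply_star, inner_self_eq_zero] at h3
  rw [h3, map_zero] at h2
  exact LinearPMap.graph_fst_eq_zero_snd T h2 rfl

theorem exists_eq_smul_of_inner_eq_zero (hφ : φ ≠ 0) {d : H}
    (h : ∀ b : H, ⟪φ, b⟫_ℂ = 0 → ⟪b, d⟫_ℂ = 0) : ∃ c : ℂ, d = c • φ := by
  have hφ' : ⟪φ, φ⟫_ℂ ≠ 0 := inner_self_ne_zero.mpr hφ
  set c : ℂ := ⟪φ, d⟫_ℂ / ⟪φ, φ⟫_ℂ with hc
  have h1 : ⟪φ, d - c • φ⟫_ℂ = 0 := by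
    rw [inner_sub_right, inner_smul_right, hc]
    field_simp
    ring
  have h2 : ⟪d - c • φ, d - c • φ⟫_ℂ = 0 := by
    rw [inner_sub_right, h _ h1, inner_smul_right, inner_eq_zero_symm.mp h1]
    simp
  exact ⟨c, sub_eq_zero.mp (inner_self_eq_zero.mp h2)⟩

/-- A pair `(w, g)` in the adjoint graph is tested against `(φ, 0)`, giving `g ⊥ φ`, and against `(G
G* b, b)` with `b ⊥ φ`, giving that `w - G G* g` is a multiple of `φ`. -/
theorem HasReducedInverse.isSelfAdjoint (hT : HasReducedInverse T G φ) (hφ : φ ≠ 0) :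
    IsSelfAdjoint T := by
  rw [LinearPMap.isSelfAdjoint_def]
  refine LinearPMap.eq_of_eq_graph ?_
  rw [LinearPMap.adjoint_graph_eq_graph_adjoint hT.dense]
  ext ⟨w, g⟩
  rw [Submodule.mem_adjoint_iff, hT]
  constructor
  · intro h
    have hg : ⟪φ, g⟫_ℂ = 0 := by
      have := h φ 0 hT.mem_graph_self
      simpa using this
    refine ⟨hg, ?_⟩
    obtain ⟨c, hc⟩ := exists_eq_smul_of_inner_eq_zero (d := w - G (star G g)) hφ fun b hb => by
      have h1 := h (G (star G b)) b ((hT _ _).mpr ⟨hb, 0, by simp⟩)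
      simp only at h1
      rw [inner_sub_right, ← h1, inner_apply_star, inner_star_apply]
    exact ⟨c, by rw [← hc]; abel⟩
  · rintro ⟨hg, c, hc⟩ a b hab
    obtain ⟨hb, d, hd⟩ := (hT _ _).mp hab
    simp only at hc ⊢
    rw [hc, hd, inner_add_right, inner_add_left, inner_smul_right, inner_smul_left, hg,
      inner_eq_zero_symm.mp hb, inner_apply_star, inner_star_apply]
    simp

theorem HasReducedInverse.eigenspace_zero (hT : HasReducedInverse T G φ) :
    eigenspace T 0 = Submodule.span ℂ {φ} := by
  ext u
  have h : u ∈ eigenspace T 0 ↔ (u, (0 : H)) ∈ T.graph := by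
    simp [eigenspace]
  rw [h, hT, Submodule.mem_span_singleton]
  simp [eq_comm]

/-- `G G*` compressed to the orthogonal complement of `φ`. -/
noncomputable def reducedResolvent (G : H →L[ℂ] H) (φ : H) : H →L[ℂ] H :=
  (ℂ ∙ φ)ᗮ.starProjection * (G * star G) * (ℂ ∙ φ)ᗮ.starProjection

/-- The form `X* X` yields both self-adjointness and nonnegativity of the spectrum. -/
theorem reducedResolvent_eq_mul_star (G : H →L[ℂ] H) (φ : H) :
    reducedResolvent G φ =
      star (star ((ℂ ∙ φ)ᗮ.starProjection * G)) * star ((ℂ ∙ φ)ᗮ.starProjection * G) := by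
  have h : star ((ℂ ∙ φ)ᗮ.starProjection : H →L[ℂ] H) = (ℂ ∙ φ)ᗮ.starProjection :=
    (isSelfAdjoint_starProjection _)
  rw [star_star, star_mul, h, reducedResolvent]
  simp only [mul_assoc]

theorem reducedResolvent_isSelfAdjoint (G : H →L[ℂ] H) (φ : H) :
    IsSelfAdjoint (reducedResolvent G φ) := by
  rw [reducedResolvent_eq_mul_star]
  exact IsSelfAdjoint.star_mul_self _

theorem mem_spectrum_reducedResolvent {z : ℂ} (hz : z ∈ spectrum ℂ (reducedResolvent G φ)) :
    ∃ μ : ℝ, 0 ≤ μ ∧ μ ≤ ‖reducedResolvent G φ‖ ∧ z = μ := by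
  have h1 := (reducedResolvent_isSelfAdjoint G φ).mem_spectrum_eq_re hz
  refine ⟨z.re, ?_, ?_, h1⟩
  · have h2 : z.re ∈ spectrum ℝ (reducedResolvent G φ) := by
      rw [h1] at hz
      exact (spectrum.algebraMap_mem_iff ℂ).mp hz
    rw [reducedResolvent_eq_mul_star] at h2
    exact spectrum_star_mul_self_nonneg _ h2
  · rcases subsingleton_or_nontrivial H with h | h
    · have : Subsingleton (H →L[ℂ] H) := inferInstance
      rw [spectrum.of_subsingleton] at hz
      exact hz.elim
    · exact (Complex.re_le_norm z).trans (spectrum.norm_le_norm_of_mem hz)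

theorem starProjection_of_inner_eq_zero {f : H} (h : ⟪φ, f⟫_ℂ = 0) :
    (ℂ ∙ φ)ᗮ.starProjection f = f :=
  Submodule.starProjection_eq_self_iff.mpr (Submodule.mem_orthogonal_singleton_iff_inner_right.mpr h)

theorem inner_starProjection (f : H) : ⟪φ, (ℂ ∙ φ)ᗮ.starProjection f⟫_ℂ = 0 :=
  Submodule.mem_orthogonal_singleton_iff_inner_right.mp (Submodule.starProjection_apply_mem _ _)

theorem exists_starProjection_eq (f : H) : ∃ c : ℂ, f = (ℂ ∙ φ)ᗮ.starProjection f + c • φ := by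
  have h := Submodule.starProjection_apply_mem (ℂ ∙ φ) f
  obtain ⟨c, hc⟩ := Submodule.mem_span_singleton.mp h
  refine ⟨c, ?_⟩
  rw [hc, Submodule.starProjection_orthogonal]
  simp

theorem inner_reducedResolvent (f : H) : ⟪φ, reducedResolvent G φ f⟫_ℂ = 0 :=
  inner_starProjection _

theorem starProjection_self : (ℂ ∙ φ)ᗮ.starProjection φ = 0 := by
  rw [Submodule.starProjection_orthogonal]
  have : (ℂ ∙ φ).starProjection φ = φ :=
    Submodule.starProjection_eq_self_iff.mpr (Submodule.mem_span_singleton_self φ)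
  simp [this]

/-- Projecting `G G* f` off `φ` changes it by a multiple of `φ`, which the free constant absorbs. -/
theorem HasReducedInverse.mem_graph_iff (hT : HasReducedInverse T G φ) (u f : H) :
    (u, f) ∈ T.graph ↔ ⟪φ, f⟫_ℂ = 0 ∧ ∃ c : ℂ, u = reducedResolvent G φ f + c • φ := by
  rw [hT]
  refine and_congr_right fun hf => ?_
  obtain ⟨d, hd⟩ := exists_starProjection_eq (φ := φ) (G (star G f))
  have h1 : reducedResolvent G φ f = (ℂ ∙ φ)ᗮ.starProjection (G (star G f)) := by
    simp [reducedResolvent, starProjection_of_inner_eq_zero hf]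
  constructor
  · rintro ⟨c, hc⟩
    refine ⟨d + c, ?_⟩
    rw [h1, hc, add_smul, ← add_assoc, ← hd]
  · rintro ⟨c, hc⟩
    refine ⟨c - d, ?_⟩
    rw [hc, h1, sub_smul]
    nth_rewrite 2 [hd]
    abel

/-- On the complement of `φ` the operator `T` inverts `K`, so `T - z` has inverse `K (1 - z K)⁻¹`;
on the span of `φ` it is multiplication by `-z`. -/
theorem HasReducedInverse.mem_resolventSet (hT : HasReducedInverse T G φ) {z : ℂ}
    (hz : z ≠ 0) (h : z⁻¹ ∉ spectrum ℂ (reducedResolvent G φ)) : z ∈ resolventSet T := by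
  set K := reducedResolvent G φ with hK
  rw [spectrum.notMem_iff] at h
  have hu : IsUnit (1 - z • K) := by
    have e : 1 - z • K = z • (algebraMap ℂ (H →L[ℂ] H) z⁻¹ - K) := by
      rw [Algebra.algebraMap_eq_smul_one, smul_sub, smul_smul, mul_inv_cancel₀ hz, one_smul]
    rw [e]
    exact h.smul (Units.mk0 z hz)
  obtain ⟨⟨A, B, hAB, hBA⟩, hA⟩ := hu
  simp only at hA
  subst hA
  set Q : H →L[ℂ] H := (ℂ ∙ φ)ᗮ.starProjection with hQ
  have hAB' : ∀ x, B x - z • K (B x) = x := fun x => by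
    have := congrArg (fun L : H →L[ℂ] H => L x) hAB
    simpa using this
  have hBA' : ∀ x, B (x - z • K x) = x := fun x => by
    have := congrArg (fun L : H →L[ℂ] H => L x) hBA
    simpa using this
  have hKp : ∀ f, ⟪φ, K f⟫_ℂ = 0 := fun f => inner_reducedResolvent f
  refine ⟨K * B * Q - z⁻¹ • (1 - Q), fun f => ?_, fun u => ?_⟩
  -- This `g` is going to be the value of `T` at the solution.
  · set g := B (Q f) with hg
    have e1 : g = Q f + z • K g := by
      rw [← hAB' (Q f)]
      simp [hg]
    have hgφ : ⟪φ, g⟫_ℂ = 0 := by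
      rw [e1, inner_add_right, inner_smul_right, hKp, mul_zero, add_zero]
      exact inner_starProjection f
    obtain ⟨c, hc⟩ := exists_starProjection_eq (φ := φ) f
    have e2 : (K * B * Q - z⁻¹ • (1 - Q)) f = K g + (-(z⁻¹ * c)) • φ := by
      have : f - Q f = c • φ := by
        nth_rewrite 1 [hc]
        simp [hQ]
      simp only [_root_.sub_apply, _root_.smul_apply, one_apply_eq_self, this,
        mul_apply_eq_comp]
      rw [hg, neg_smul, smul_smul, sub_eq_add_neg]
    have hmem : ((K * B * Q - z⁻¹ • (1 - Q)) f, g) ∈ T.graph :=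
      (hT.mem_graph_iff _ _).mpr ⟨hgφ, _, e2⟩
    obtain ⟨y, hy1, hy2⟩ := LinearPMap.mem_graph_iff _ |>.mp hmem
    simp only at hy1 hy2
    refine ⟨hy1 ▸ y.2, ?_⟩
    have e3 : T ⟨(K * B * Q - z⁻¹ • (1 - Q)) f, hy1 ▸ y.2⟩ = g := by
      rw [← hy2]
      congr 1
      exact Subtype.ext hy1.symm
    rw [e3, e2, smul_add, smul_smul]
    have e4 : z * -(z⁻¹ * c) = -c := by field_simp
    rw [e4, neg_smul]
    calc g - (z • K g + -(c • φ)) = (g - z • K g) + c • φ := by abel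
      _ = Q f + c • φ := by rw [sub_eq_of_eq_add e1]
      _ = f := hc.symm
  · have hmem : ((u : H), T u) ∈ T.graph := LinearPMap.mem_graph T u
    obtain ⟨h0, c, hc⟩ := (hT.mem_graph_iff _ _).mp hmem
    set g := T u with hg
    have e1 : Q (g - z • (u : H)) = g - z • K g := by
      rw [hc, smul_add, map_sub, map_add, map_smul, map_smul, map_smul]
      rw [show Q φ = 0 from starProjection_self, show Q g = g from starProjection_of_inner_eq_zero h0,
        show Q (K g) = K g from starProjection_of_inner_eq_zero (hKp g)]
      simp
    have e2 : (K * B * Q - z⁻¹ • (1 - Q)) (g - z • (u : H)) =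
        K (B (Q (g - z • (u : H)))) - z⁻¹ • ((g - z • (u : H)) - Q (g - z • (u : H))) := by
      simp
    rw [e2, e1, hBA', hc]
    have e3 : g - z • (K g + c • φ) - (g - z • K g) = z • ((-c) • φ) := by
      rw [smul_add, neg_smul, smul_neg]
      abel
    rw [e3, smul_smul, inv_mul_cancel₀ hz, one_smul, neg_smul]
    abel

/-- The map `z ↦ z⁻¹` sends the nonzero spectrum into that of `K`, a subset of `[0, ‖K‖]`. Adding 1
to the norm avoids having to know that `K` is nonzero. -/
theorem HasReducedInverse.spec_subset (hT : HasReducedInverse T G φ) :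
    ∃ δ : ℝ, 0 < δ ∧ spec T \ {0} ⊆ Complex.ofReal '' Set.Ici δ := by
  refine ⟨(‖reducedResolvent G φ‖ + 1)⁻¹, by positivity, ?_⟩
  rintro z ⟨hz, hz0⟩
  have hz0' : z ≠ 0 := hz0
  have h1 : z⁻¹ ∈ spectrum ℂ (reducedResolvent G φ) := by
    by_contra h
    exact hz (hT.mem_resolventSet hz0' h)
  obtain ⟨μ, h2, h3, h4⟩ := mem_spectrum_reducedResolvent h1
  have hμ : 0 < μ := by
    refine h2.lt_of_ne fun h => ?_
    rw [← h] at h4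
    simp [hz0'] at h4
  refine ⟨μ⁻¹, ?_, ?_⟩
  · rw [Set.mem_Ici]
    gcongr
    linarith
  · rw [Complex.ofReal_inv, ← h4, inv_inv]

theorem HasReducedInverse.zero_mem_discreteSpec (hT : HasReducedInverse T G φ) (hφ : φ ≠ 0) :
    (0 : ℂ) ∈ discreteSpec T := by
  obtain ⟨δ, hδ, hsub⟩ := hT.spec_subset
  have hmem : φ ∈ eigenspace T 0 := by
    rw [hT.eigenspace_zero]
    exact Submodule.mem_span_singleton_self φ
  refine ⟨?_, ⟨δ, hδ, fun y hy hd => ?_⟩, ?_, ?_⟩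
  · rintro ⟨S, -, hS⟩
    obtain ⟨h, hφ0⟩ := (mem_eigenspace T 0 φ).mp hmem
    have := hS ⟨φ, h⟩
    rw [hφ0] at this
    simp only [zero_smul, sub_zero, map_zero] at this
    exact hφ this.symm
  · by_contra hy0
    obtain ⟨t, ht, rfl⟩ := hsub ⟨hy, hy0⟩
    rw [Set.mem_Ici] at ht
    rw [dist_zero_right, Complex.norm_real, Real.norm_of_nonneg (hδ.le.trans ht)] at hd
    linarith
  · rw [Submodule.ne_bot_iff]
    exact ⟨φ, hmem, hφ⟩
  · rw [hT.eigenspace_zero]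
    infer_instance

/-- For `z ≠ 0` an eigenvector is orthogonal to `φ`, since the range of `T` is; this kills the
multiple of `φ`. -/
theorem HasReducedInverse.eigenspace_eq (hT : HasReducedInverse T G φ) {z : ℂ} (hz : z ≠ 0)
    (u : H) : u ∈ eigenspace T z ↔ reducedResolvent G φ u = z⁻¹ • u := by
  have h : u ∈ eigenspace T z ↔ (u, z • u) ∈ T.graph := by
    simp [eigenspace]
  rw [h, hT.mem_graph_iff, inner_smul_right, mul_eq_zero, or_iff_right hz]
  constructor
  · rintro ⟨h1, c, hc⟩
    have h2 : ⟪φ, c • φ⟫_ℂ = 0 := by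
      have := congrArg (fun x => ⟪φ, x⟫_ℂ) hc
      simp only [inner_add_right] at this
      rw [h1, inner_reducedResolvent, zero_add] at this
      exact this.symm
    have h3 : c • φ = 0 := by
      refine inner_self_eq_zero (𝕜 := ℂ) |>.mp ?_
      rw [inner_smul_left, h2, mul_zero]
    rw [h3, add_zero, map_smul] at hc
    nth_rewrite 2 [hc]
    rw [smul_smul, inv_mul_cancel₀ hz, one_smul]
  · intro h1
    have h2 : u = z • reducedResolvent G φ u := by
      rw [h1, smul_smul, mul_inv_cancel₀ hz, one_smul]
    refine ⟨?_, 0, ?_⟩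
    · rw [h2, inner_smul_right, inner_reducedResolvent, mul_zero]
    · rw [map_smul, ← h2, zero_smul, add_zero]

instance : TopologicalSpace.SeparableSpace H := by
  have : Fact ((2 : ENNReal) ≠ ⊤) := ⟨by norm_num⟩
  infer_instance

/-- Inversion turns the spectrum near `t` into that of `K` near `t⁻¹`, where
`WeaklyProper.isUnit_sub` applies. It excludes all other nearby points, and `t` too if the kernel is
trivial; so `t` is an eigenvalue. -/
theorem HasReducedInverse.mem_discreteSpec (hT : HasReducedInverse T G φ) {t : ℝ}
    (ht : 0 < t) (hs : (t : ℂ) ∈ spec T)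
    (hW : WeaklyProper (reducedResolvent G φ - ((t⁻¹ : ℝ) : ℂ) • (1 : H →L[ℂ] H))) :
    (t : ℂ) ∈ discreteSpec T := by
  have ht' : (t : ℂ) ≠ 0 := by exact_mod_cast ht.ne'
  set K := reducedResolvent G φ with hK
  have hsa : IsSelfAdjoint (K - ((t⁻¹ : ℝ) : ℂ) • (1 : H →L[ℂ] H)) := by
    refine (reducedResolvent_isSelfAdjoint G φ).sub ?_
    rw [isSelfAdjoint_iff, star_smul, star_one]
    simp
  obtain ⟨c, hc, hunit⟩ := hW.isUnit_sub hsa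
  have hspec : ∀ s : ℝ, s ≠ 0 → |s⁻¹ - t⁻¹| < c →
      (s ≠ t ∨ LinearMap.ker ((K - ((t⁻¹ : ℝ) : ℂ) • (1 : H →L[ℂ] H) : H →L[ℂ] H) : H →ₗ[ℂ] H) = ⊥) →
      (s : ℂ) ∈ resolventSet T := by
    intro s hs0 hs1 hs2
    refine hT.mem_resolventSet (by exact_mod_cast hs0) ?_
    rw [spectrum.notMem_iff]
    have h1 := hunit (s⁻¹ - t⁻¹) hs1 (by
      refine hs2.imp_left fun h h' => h ?_
      exact inv_injective (sub_eq_zero.mp h'))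
    have e : algebraMap ℂ (H →L[ℂ] H) (s : ℂ)⁻¹ - K = -(K - ((t⁻¹ : ℝ) : ℂ) • (1 : H →L[ℂ] H) -
        ((s⁻¹ - t⁻¹ : ℝ) : ℂ) • (1 : H →L[ℂ] H)) := by
      rw [Algebra.algebraMap_eq_smul_one]
      push_cast
      rw [sub_smul]
      abel
    rw [e]
    exact h1.neg
  have hker : ∀ u, u ∈ eigenspace T t ↔
      u ∈ LinearMap.ker ((K - ((t⁻¹ : ℝ) : ℂ) • (1 : H →L[ℂ] H) : H →L[ℂ] H) : H →ₗ[ℂ] H) := by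
    intro u
    rw [hT.eigenspace_eq ht', LinearMap.mem_ker, ContinuousLinearMap.coe_coe, _root_.sub_apply,
      _root_.smul_apply, one_apply_eq_self, sub_eq_zero, Complex.ofReal_inv]
  have hker' : eigenspace T t =
      LinearMap.ker ((K - ((t⁻¹ : ℝ) : ℂ) • (1 : H →L[ℂ] H) : H →L[ℂ] H) : H →ₗ[ℂ] H) :=
    Submodule.ext hker
  refine ⟨hs, ?_, ?_, ?_⟩
  · have hcont : ContinuousAt (fun s : ℝ => |s⁻¹ - t⁻¹|) t :=
      ((continuousAt_inv₀ ht.ne').sub continuousAt_const).abs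
    have hev : ∀ᶠ s in 𝓝 t, |s⁻¹ - t⁻¹| < c ∧ s ≠ 0 := by
      refine (hcont.eventually_lt continuousAt_const (by simpa using hc)).and ?_
      exact isOpen_ne.mem_nhds ht.ne'
    obtain ⟨ε, hε, hball⟩ := Metric.eventually_nhds_iff.mp hev
    obtain ⟨δ, hδ, hsub⟩ := hT.spec_subset
    -- The radius `t` excludes the point 0, so that all competing spectral points are real by
    -- `spec_subset`.
    refine ⟨min ε t, lt_min hε ht, fun y hy hd => ?_⟩
    have hy0 : y ≠ 0 := by
      rintro rfl
      have := hd.trans_le (min_le_right _ _)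
      rw [dist_zero_left, Complex.norm_real, Real.norm_of_nonneg ht.le] at this
      exact lt_irrefl _ this
    obtain ⟨s, -, rfl⟩ := hsub ⟨hy, hy0⟩
    by_contra hne
    have hne' : s ≠ t := fun h => hne (by rw [h])
    rw [Complex.dist_eq, ← Complex.ofReal_sub, Complex.norm_real] at hd
    obtain ⟨h1, h2⟩ := hball (y := s) (hd.trans_le (min_le_left _ _))
    exact hy (hspec s h2 h1 (Or.inl hne'))
  · intro hbot
    rw [hker'] at hbot
    exact hs (hspec t ht.ne' (by simpa using hc) (Or.inr hbot))
  · rw [hker']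
    exact hW.finiteDimensional_ker

end

end DeltaNLS

/-! ### The Schur test and integral operators on `L²` -/

namespace DeltaNLS

open scoped InnerProductSpace ENNReal NNReal

theorem enorm_ofReal (r : ℝ) : ‖(r : ℂ)‖ₑ = ‖r‖ₑ := by
  rw [← ofReal_norm, Complex.norm_real, ofReal_norm]

/-- A real kernel on the line satisfying the two bounds of the Schur test. -/
structure IsSchurKernel (k : ℝ → ℝ → ℝ) (A : ℝ≥0) : Prop where
  measurable : Measurable (Function.uncurry k)
  left : ∀ x, ∫⁻ y, ‖k x y‖ₑ ≤ A
  right : ∀ y, ∫⁻ x, ‖k x y‖ₑ ≤ A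

theorem IsSchurKernel.swap {k : ℝ → ℝ → ℝ} {A : ℝ≥0} (h : IsSchurKernel k A) :
    IsSchurKernel (fun x y => k y x) A where
  measurable := h.measurable.comp measurable_swap
  left := h.right
  right := h.left

/-- Cauchy–Schwarz after splitting the weight into two square roots. -/
theorem lintegral_mul_sq_le {w g : ℝ → ℝ≥0∞} (hw : Measurable w) (hg : Measurable g) :
    (∫⁻ y, w y * g y) ^ 2 ≤ (∫⁻ y, w y) * ∫⁻ y, w y * g y ^ 2 := by
  have h := ENNReal.lintegral_mul_le_Lp_mul_Lq (volume : Measure ℝ)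
    (Real.HolderConjugate.two_two) (f := fun y => w y ^ (1 / 2 : ℝ))
    (g := fun y => w y ^ (1 / 2 : ℝ) * g y) (hw.pow_const _).aemeasurable
    ((hw.pow_const _).mul hg).aemeasurable
  have e0 : ∀ a : ℝ≥0∞, a ^ (1 / 2 : ℝ) * a ^ (1 / 2 : ℝ) = a := by
    intro a
    rw [← ENNReal.rpow_add_of_nonneg _ _ (by norm_num) (by norm_num)]
    norm_num
  have e1 : ∀ y, w y ^ (1 / 2 : ℝ) * (w y ^ (1 / 2 : ℝ) * g y) = w y * g y := by
    intro y
    rw [← mul_assoc, e0]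
  have e2 : ∀ y, (w y ^ (1 / 2 : ℝ)) ^ (2 : ℝ) = w y := by
    intro y
    rw [ENNReal.rpow_two, sq, e0]
  have e3 : ∀ y, (w y ^ (1 / 2 : ℝ) * g y) ^ (2 : ℝ) = w y * g y ^ 2 := by
    intro y
    rw [ENNReal.rpow_two, mul_pow, ← ENNReal.rpow_two, e2]
  simp only [Pi.mul_apply, e1, e2, e3] at h
  calc (∫⁻ y, w y * g y) ^ 2
      ≤ ((∫⁻ y, w y) ^ (1 / 2 : ℝ) * (∫⁻ y, w y * g y ^ 2) ^ (1 / 2 : ℝ)) ^ 2 := by gcongr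
    _ = (∫⁻ y, w y) * ∫⁻ y, w y * g y ^ 2 := by
        rw [mul_pow, sq, sq, e0, e0]

/-- Weighted Cauchy–Schwarz in each row, then Tonelli and the column bound. -/
theorem IsSchurKernel.lintegral_sq_le {k : ℝ → ℝ → ℝ} {A : ℝ≥0} (h : IsSchurKernel k A)
    {g : ℝ → ℝ≥0∞} (hg : Measurable g) :
    ∫⁻ x, (∫⁻ y, ‖k x y‖ₑ * g y) ^ 2 ≤ (A : ℝ≥0∞) ^ 2 * ∫⁻ y, g y ^ 2 := by
  have hm : Measurable (Function.uncurry fun x y => ‖k x y‖ₑ * g y ^ 2) :=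
    h.measurable.enorm.mul ((hg.pow_const 2).comp measurable_snd)
  calc ∫⁻ x, (∫⁻ y, ‖k x y‖ₑ * g y) ^ 2
      ≤ ∫⁻ x, A * ∫⁻ y, ‖k x y‖ₑ * g y ^ 2 := by
        refine lintegral_mono fun x => ?_
        refine (lintegral_mul_sq_le (h.measurable.of_uncurry_left.enorm) hg).trans ?_
        gcongr
        exact h.left x
    _ = A * ∫⁻ x, ∫⁻ y, ‖k x y‖ₑ * g y ^ 2 := by
        rw [lintegral_const_mul _ hm.lintegral_prod_right]
    _ = A * ∫⁻ y, ∫⁻ x, ‖k x y‖ₑ * g y ^ 2 := by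
        rw [lintegral_lintegral_swap hm.aemeasurable]
    _ ≤ A * ∫⁻ y, A * g y ^ 2 := by
        gcongr with y
        rw [lintegral_mul_const _ (h.measurable.of_uncurry_right.enorm)]
        gcongr
        exact h.right y
    _ = (A : ℝ≥0∞) ^ 2 * ∫⁻ y, g y ^ 2 := by
        rw [lintegral_const_mul _ (hg.pow_const 2), sq, mul_assoc]

theorem lintegral_enorm_sq (f : H) : ∫⁻ x, ‖f x‖ₑ ^ 2 = ‖f‖ₑ ^ 2 := by
  rw [Lp.enorm_def, eLpNorm_eq_lintegral_rpow_enorm_toReal (by norm_num) (by norm_num)]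
  simp only [ENNReal.toReal_ofNat, ENNReal.rpow_two]
  rw [← ENNReal.rpow_two, ← ENNReal.rpow_mul]
  norm_num

theorem measurable_coe (f : H) : Measurable fun x => f x := (Lp.stronglyMeasurable f).measurable

theorem lintegral_enorm_sq_lt_top (f : H) : ∫⁻ x, ‖f x‖ₑ ^ 2 < ∞ := by
  rw [lintegral_enorm_sq]
  exact ENNReal.pow_lt_top enorm_lt_top

theorem IsSchurKernel.lintegral_sq_le' {k : ℝ → ℝ → ℝ} {A : ℝ≥0} (h : IsSchurKernel k A) (f : H) :
    ∫⁻ x, (∫⁻ y, ‖k x y‖ₑ * ‖f y‖ₑ) ^ 2 ≤ ((A : ℝ≥0∞) * ‖f‖ₑ) ^ 2 := by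
  rw [mul_pow, ← lintegral_enorm_sq f]
  exact h.lintegral_sq_le (measurable_coe f).enorm

theorem IsSchurKernel.measurable_lintegral {k : ℝ → ℝ → ℝ} {A : ℝ≥0} (h : IsSchurKernel k A)
    (f : H) : Measurable fun x => ∫⁻ y, ‖k x y‖ₑ * ‖f y‖ₑ := by
  have hm : Measurable (Function.uncurry fun x y => ‖k x y‖ₑ * ‖f y‖ₑ) :=
    h.measurable.enorm.mul ((measurable_coe f).enorm.comp measurable_snd)
  exact hm.lintegral_prod_right

/-- The row integrals of absolute values are square integrable in `x`, hence finite almost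
everywhere. -/
theorem IsSchurKernel.ae_integrable {k : ℝ → ℝ → ℝ} {A : ℝ≥0} (h : IsSchurKernel k A) (f : H) :
    ∀ᵐ x, Integrable fun y => (k x y : ℂ) * f y := by
  have h1 : ∀ᵐ x, (∫⁻ y, ‖k x y‖ₑ * ‖f y‖ₑ) ^ 2 < ∞ := by
    refine ae_lt_top ((h.measurable_lintegral f).pow_const 2) ?_
    exact ((h.lintegral_sq_le' f).trans_lt
      (ENNReal.pow_lt_top (ENNReal.mul_lt_top (by simp) enorm_lt_top))).ne
  filter_upwards [h1] with x hx
  refine ⟨?_, ?_⟩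
  · have : Measurable fun y => (k x y : ℂ) * f y :=
      (Complex.measurable_ofReal.comp h.measurable.of_uncurry_left).mul (measurable_coe f)
    exact this.aestronglyMeasurable
  · have h2 : ∫⁻ y, ‖k x y‖ₑ * ‖f y‖ₑ < ∞ := by
      by_contra h3
      rw [not_lt, top_le_iff] at h3
      rw [h3] at hx
      simp at hx
    rw [hasFiniteIntegral_iff_enorm]
    convert! h2 using 3 with y
    rw [enorm_mul]
    congr 1
    exact enorm_ofReal _

theorem enorm_integral_kernel_le (k : ℝ → ℝ → ℝ) (f : H) (x : ℝ) :
    ‖∫ y, (k x y : ℂ) * f y‖ₑ ≤ ∫⁻ y, ‖k x y‖ₑ * ‖f y‖ₑ := by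
  refine (enorm_integral_le_lintegral_enorm _).trans (le_of_eq ?_)
  congr 1
  ext y
  rw [enorm_mul]
  congr 1
  exact enorm_ofReal _

theorem memLp_two_of_lintegral {F : ℝ → ℂ} (hF : AEStronglyMeasurable F) {B : ℝ≥0∞} (hB : B < ∞)
    (h : ∫⁻ x, ‖F x‖ₑ ^ 2 ≤ B ^ 2) : MemLp F 2 ∧ eLpNorm F 2 volume ≤ B := by
  have h1 : eLpNorm F 2 volume ≤ B := by
    rw [eLpNorm_eq_lintegral_rpow_enorm_toReal (by norm_num) (by norm_num)]
    simp only [ENNReal.toReal_ofNat, ENNReal.rpow_two]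
    refine (ENNReal.rpow_le_rpow h (by norm_num)).trans (le_of_eq ?_)
    rw [← ENNReal.rpow_two, ← ENNReal.rpow_mul]
    norm_num
  exact ⟨⟨hF, h1.trans_lt hB⟩, h1⟩

theorem IsSchurKernel.memLp {k : ℝ → ℝ → ℝ} {A : ℝ≥0} (h : IsSchurKernel k A) (f : H) :
    MemLp (fun x => ∫ y, (k x y : ℂ) * f y) 2 ∧
      eLpNorm (fun x => ∫ y, (k x y : ℂ) * f y) 2 volume ≤ A * ‖f‖ₑ := by
  refine memLp_two_of_lintegral ?_ (ENNReal.mul_lt_top (by simp) enorm_lt_top) ?_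
  · have hm : StronglyMeasurable (Function.uncurry fun x y => (k x y : ℂ) * f y) :=
      ((Complex.measurable_ofReal.comp h.measurable).mul
        ((measurable_coe f).comp measurable_snd)).stronglyMeasurable
    exact hm.integral_prod_right.aestronglyMeasurable
  · refine le_trans (lintegral_mono fun x => ?_) (h.lintegral_sq_le' f)
    gcongr
    exact enorm_integral_kernel_le k f x

/-- The integral operator of a Schur kernel. -/
noncomputable def kernelOp {k : ℝ → ℝ → ℝ} {A : ℝ≥0} (h : IsSchurKernel k A) : H →L[ℂ] H :=
  LinearMap.mkContinuous
    { toFun := fun f => (h.memLp f).1.toLp _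
      map_add' := fun f g => by
        rw [← MemLp.toLp_add]
        refine MemLp.toLp_congr _ _ ?_
        filter_upwards [h.ae_integrable f, h.ae_integrable g] with x h1 h2
        rw [Pi.add_apply, ← integral_add h1 h2]
        refine integral_congr_ae ?_
        filter_upwards [Lp.coeFn_add f g] with y hy
        rw [hy, Pi.add_apply, mul_add]
      map_smul' := fun c f => by
        rw [RingHom.id_apply, ← MemLp.toLp_const_smul]
        refine MemLp.toLp_congr _ _ ?_
        refine Eventually.of_forall fun x => ?_
        simp only [Pi.smul_apply]
        rw [← integral_smul]
        refine integral_congr_ae ?_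
        filter_upwards [Lp.coeFn_smul c f] with y hy
        rw [hy, Pi.smul_apply, smul_eq_mul, smul_eq_mul]
        ring } A (fun f => by
    change ‖(h.memLp f).1.toLp _‖ ≤ _
    rw [Lp.norm_toLp]
    refine ENNReal.toReal_le_of_le_ofReal (by positivity) ((h.memLp f).2.trans (le_of_eq ?_))
    rw [ENNReal.ofReal_mul (by positivity), ofReal_norm, ENNReal.ofReal_coe_nnreal])

theorem norm_kernelOp_le {k : ℝ → ℝ → ℝ} {A : ℝ≥0} (h : IsSchurKernel k A) : ‖kernelOp h‖ ≤ A :=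
  LinearMap.mkContinuous_norm_le _ A.2 _

theorem kernelOp_ae {k : ℝ → ℝ → ℝ} {A : ℝ≥0} (h : IsSchurKernel k A) (f : H) :
    kernelOp h f =ᵐ[volume] fun x => ∫ y, (k x y : ℂ) * f y :=
  MemLp.coeFn_toLp (h.memLp f).1

/-- Fubini; the double integral converges absolutely by Cauchy–Schwarz and the Schur bound. -/
theorem star_kernelOp {k : ℝ → ℝ → ℝ} {A : ℝ≥0} (h : IsSchurKernel k A) :
    star (kernelOp h) = kernelOp h.swap := by
  rw [ContinuousLinearMap.star_eq_adjoint, eq_comm, ContinuousLinearMap.eq_adjoint_iff]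
  intro g f
  rw [L2.inner_def, L2.inner_def]
  have hint : Integrable (Function.uncurry fun x y => ⟪g x, (k x y : ℂ) * f y⟫_ℂ)
      (volume.prod volume) := by
    have hm : Measurable (Function.uncurry fun x y => ⟪g x, (k x y : ℂ) * f y⟫_ℂ) :=
      ((measurable_coe g).comp measurable_fst).inner ((Complex.measurable_ofReal.comp
        h.measurable).mul ((measurable_coe f).comp measurable_snd))
    refine ⟨hm.aestronglyMeasurable, ?_⟩
    rw [hasFiniteIntegral_iff_enorm, lintegral_prod _ hm.enorm.aemeasurable]
    have e : ∀ x, ∫⁻ y, ‖Function.uncurry (fun x y => ⟪g x, (k x y : ℂ) * f y⟫_ℂ) (x, y)‖ₑ =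
        ‖g x‖ₑ * ∫⁻ y, ‖k x y‖ₑ * ‖f y‖ₑ := by
      intro x
      have hm' : Measurable fun y => ‖k x y‖ₑ * ‖f y‖ₑ :=
        h.measurable.of_uncurry_left.enorm.mul (measurable_coe f).enorm
      rw [← lintegral_const_mul _ hm']
      congr 1
      ext y
      simp only [Function.uncurry]
      rw [RCLike.inner_apply, enorm_mul, enorm_mul, mul_comm]
      congr 1
      · simp [← ofReal_norm]
      · congr 1
        exact enorm_ofReal _
    simp only [e]
    refine lt_of_le_of_lt (ENNReal.lintegral_mul_le_Lp_mul_Lq (volume : Measure ℝ)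
      Real.HolderConjugate.two_two (measurable_coe g).enorm.aemeasurable
      (h.measurable_lintegral f).aemeasurable) ?_
    simp only [ENNReal.rpow_two]
    refine ENNReal.mul_lt_top (ENNReal.rpow_lt_top_of_nonneg (by norm_num)
      (lintegral_enorm_sq_lt_top g).ne) (ENNReal.rpow_lt_top_of_nonneg (by norm_num) ?_)
    exact ((h.lintegral_sq_le' f).trans_lt
      (ENNReal.pow_lt_top (ENNReal.mul_lt_top (by simp) enorm_lt_top))).ne
  have e1 : ∫ x, ⟪g x, kernelOp h f x⟫_ℂ = ∫ x, ∫ y, ⟪g x, (k x y : ℂ) * f y⟫_ℂ := by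
    refine integral_congr_ae ?_
    filter_upwards [kernelOp_ae h f, h.ae_integrable f] with x hx hi
    rw [hx, ← integral_inner hi]
  have e2 : ∫ y, ⟪kernelOp h.swap g y, f y⟫_ℂ = ∫ y, ∫ x, ⟪g x, (k x y : ℂ) * f y⟫_ℂ := by
    refine integral_congr_ae ?_
    filter_upwards [kernelOp_ae h.swap g, h.swap.ae_integrable g] with y hy hi
    rw [hy, ← inner_conj_symm, ← integral_inner hi, ← integral_conj]
    refine integral_congr_ae (Eventually.of_forall fun x => ?_)
    simp only [RCLike.inner_apply, map_mul, Complex.conj_conj, Complex.conj_ofReal]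
    ring
  rw [e1, e2, integral_integral_swap hint]

end DeltaNLS

/-! ### Calculus with Lebesgue primitives -/

namespace DeltaNLS

open scoped ContDiff

/-- On `s` the function `F` is a primitive of `f`, in the sense of the Lebesgue integral. -/
def IsPrim (s : Set ℝ) (F f : ℝ → ℂ) : Prop :=
  ∀ a ∈ s, ∀ b ∈ s, IntervalIntegrable f volume a b ∧ ∫ x in a..b, f x = F b - F a

/-- Real and imaginary parts are treated separately and recombined with the constants `1` and `I`.
-/
theorem absolutelyContinuous_primitive {f : ℝ → ℂ} {a b : ℝ} (hf : IntervalIntegrable f volume a b) :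
    AbsolutelyContinuousOnInterval (fun x => ∫ t in a..x, f t) a b := by
  have hre : IntervalIntegrable (fun x => (f x).re) volume a b :=
    ⟨hf.1.re, hf.2.re⟩
  have him : IntervalIntegrable (fun x => (f x).im) volume a b :=
    ⟨hf.1.im, hf.2.im⟩
  have h1 := hre.absolutelyContinuousOnInterval_intervalIntegral (c := a) left_mem_uIcc
  have h2 := him.absolutelyContinuousOnInterval_intervalIntegral (c := a) left_mem_uIcc
  have hc : ∀ z : ℂ, AbsolutelyContinuousOnInterval (fun _ : ℝ => z) a b := fun z =>
    ((LipschitzWith.const z).lipschitzOnWith (s := uIcc a b)).absolutelyContinuousOnInterval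
  have h3 := (h1.fun_smul (hc 1)).add (h2.fun_smul (hc Complex.I))
  have hmeas : ∀ s : Set ℝ, IntegrableOn f s → ∫ x in s, f x =
      ((∫ x in s, (f x).re : ℝ) : ℂ) + ((∫ x in s, (f x).im : ℝ) : ℂ) * Complex.I := fun s hs =>
    (integral_re_add_im hs).symm
  have h4 : AbsolutelyContinuousOnInterval (fun x => ∫ t in a..x, f t) a b ↔
      AbsolutelyContinuousOnInterval ((fun x => (∫ t in a..x, (f t).re) • (1 : ℂ)) +
        fun x => (∫ t in a..x, (f t).im) • Complex.I) a b := by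
    rw [absolutelyContinuousOnInterval_iff, absolutelyContinuousOnInterval_iff]
    have key : ∀ x ∈ uIcc a b, (∫ t in a..x, f t) = ((fun x => (∫ t in a..x, (f t).re) • (1 : ℂ)) +
        fun x => (∫ t in a..x, (f t).im) • Complex.I) x := by
      intro x hx
      have hfx : IntervalIntegrable f volume a x := hf.mono_set (uIcc_subset_uIcc_left hx)
      simp only [Pi.add_apply, Complex.real_smul, mul_one]
      rw [intervalIntegral, intervalIntegral, intervalIntegral, hmeas _ hfx.1, hmeas _ hfx.2]
      push_cast
      ring
    refine forall₂_congr fun ε _ => exists_congr fun δ => and_congr_right fun _ =>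
      forall₂_congr fun E hE => imp_congr_right fun _ => ?_
    rw [Finset.sum_congr rfl]
    intro i hi
    rw [key _ (hE.1 i hi).1, key _ (hE.1 i hi).2]
  exact h4.mpr h3

namespace IsPrim

variable {s : Set ℝ} {F G f g : ℝ → ℂ}

theorem mono {t : Set ℝ} (h : IsPrim s F f) (hts : t ⊆ s) : IsPrim t F f :=
  fun a ha b hb => h a (hts ha) b (hts hb)

theorem congr (h : IsPrim s F f) (hFG : EqOn F G s) : IsPrim s G f := by
  intro a ha b hb
  rw [← hFG ha, ← hFG hb]
  exact h a ha b hb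

theorem congr_ae [s.OrdConnected] (h : IsPrim s F f) (hfg : ∀ᵐ x, x ∈ s → f x = g x) :
    IsPrim s F g := by
  intro a ha b hb
  obtain ⟨h1, h2⟩ := h a ha b hb
  have hsub : uIcc a b ⊆ s := OrdConnected.uIcc_subset inferInstance ha hb
  refine ⟨h1.congr_ae ((ae_restrict_iff' measurableSet_uIoc).mpr ?_), ?_⟩
  · filter_upwards [hfg] with x hx hxab using hx (hsub (uIoc_subset_uIcc hxab))
  · rw [← h2]
    exact intervalIntegral.integral_congr_ae
      (by filter_upwards [hfg] with x hx hxab using (hx (hsub (uIoc_subset_uIcc hxab))).symm)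

theorem congr_on [s.OrdConnected] (h : IsPrim s F f) (hfg : EqOn f g s) : IsPrim s F g := by
  intro a ha b hb
  obtain ⟨h1, h2⟩ := h a ha b hb
  have hsub : uIcc a b ⊆ s := OrdConnected.uIcc_subset inferInstance ha hb
  refine ⟨h1.congr fun x hx => hfg (hsub (uIoc_subset_uIcc hx)), ?_⟩
  rw [← h2]
  exact intervalIntegral.integral_congr fun x hx => (hfg (hsub hx)).symm

theorem add (h : IsPrim s F f) (h' : IsPrim s G g) :
    IsPrim s (fun x => F x + G x) (fun x => f x + g x) := by
  intro a ha b hb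
  obtain ⟨h1, h2⟩ := h a ha b hb
  obtain ⟨h3, h4⟩ := h' a ha b hb
  refine ⟨h1.add h3, ?_⟩
  rw [intervalIntegral.integral_add h1 h3, h2, h4]
  ring

theorem neg (h : IsPrim s F f) : IsPrim s (fun x => -F x) (fun x => -f x) := by
  intro a ha b hb
  obtain ⟨h1, h2⟩ := h a ha b hb
  refine ⟨h1.neg, ?_⟩
  rw [intervalIntegral.integral_neg, h2]
  ring

theorem const_add (h : IsPrim s F f) (c : ℂ) : IsPrim s (fun x => c + F x) f := by
  intro a ha b hb
  obtain ⟨h1, h2⟩ := h a ha b hb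
  refine ⟨h1, ?_⟩
  rw [h2]
  ring

theorem of_hasDerivAt (h : ∀ x ∈ s, HasDerivAt F (f x) x) (hf : Continuous f) [s.OrdConnected] :
    IsPrim s F f := by
  intro a ha b hb
  have hsub : uIcc a b ⊆ s := OrdConnected.uIcc_subset inferInstance ha hb
  exact ⟨hf.intervalIntegrable _ _, intervalIntegral.integral_eq_sub_of_hasDerivAt
    (fun x hx => h x (hsub hx)) (hf.intervalIntegrable _ _)⟩

theorem primitive (hf : ∀ a b, IntervalIntegrable f volume a b) (c : ℝ) :
    IsPrim univ (fun x => ∫ t in c..x, f t) f := by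
  intro a _ b _
  refine ⟨hf a b, ?_⟩
  rw [intervalIntegral.integral_interval_sub_left (hf c b) (hf c a)]

theorem eq_add (h : IsPrim s F f) {a b : ℝ} (ha : a ∈ s) (hb : b ∈ s) :
    F b = F a + ∫ x in a..b, f x := by
  rw [(h a ha b hb).2]
  ring

theorem continuousOn_uIcc [s.OrdConnected] (h : IsPrim s F f) {a b : ℝ} (ha : a ∈ s) (hb : b ∈ s) :
    ContinuousOn F (uIcc a b) := by
  have hsub : uIcc a b ⊆ s := OrdConnected.uIcc_subset inferInstance ha hb
  have h1 : ContinuousOn (fun x => F a + ∫ t in a..x, f t) (uIcc a b) :=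
    continuousOn_const.add
      (intervalIntegral.continuousOn_primitive_interval' (h a ha b hb).1 left_mem_uIcc)
  exact h1.congr fun x hx => h.eq_add ha (hsub hx)

/-- The product minus the primitive of the expected derivative is absolutely continuous, and its
derivative vanishes almost everywhere by Lebesgue differentiation; so it is constant. -/
theorem mul [s.OrdConnected] (h : IsPrim s F f) (h' : IsPrim s G g) :
    IsPrim s (fun x => F x * G x) (fun x => f x * G x + F x * g x) := by
  intro a ha b hb
  have hsub : uIcc a b ⊆ s := OrdConnected.uIcc_subset inferInstance ha hb
  have hf := (h a ha b hb).1
  have hg := (h' a ha b hb).1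
  have hint : IntervalIntegrable (fun x => f x * G x + F x * g x) volume a b :=
    (hf.mul_continuousOn (h'.continuousOn_uIcc ha hb)).add
      (hg.continuousOn_mul (h.continuousOn_uIcc ha hb))
  refine ⟨hint, ?_⟩
  have hc : ∀ z : ℂ, AbsolutelyContinuousOnInterval (fun _ : ℝ => z) a b := fun z =>
    ((LipschitzWith.const z).lipschitzOnWith (s := uIcc a b)).absolutelyContinuousOnInterval
  have hF := (hc (F a)).add (absolutelyContinuous_primitive hf)
  have hG := (hc (G a)).add (absolutelyContinuous_primitive hg)
  have hD := (hF.smul hG).sub (absolutelyContinuous_primitive hint)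
  obtain ⟨C, hC⟩ := hD.const_of_ae_hasDerivAt_zero (by
    filter_upwards [hf.ae_hasDerivAt_integral, hg.ae_hasDerivAt_integral,
      hint.ae_hasDerivAt_integral] with x h1 h2 h3 hx
    have d1 := (h1 hx a left_mem_uIcc).const_add (F a)
    have d2 := (h2 hx a left_mem_uIcc).const_add (G a)
    have d3 := (d1.mul d2).sub (h3 hx a left_mem_uIcc)
    have e1 := h.eq_add ha (hsub hx)
    have e2 := h'.eq_add ha (hsub hx)
    rw [← e1, ← e2, sub_self] at d3
    exact d3)
  have e1 := (hC a left_mem_uIcc).trans (hC b right_mem_uIcc).symm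
  simp only [Pi.sub_apply, smul_eq_mul, Pi.mul_apply, Pi.add_apply,
    intervalIntegral.integral_same, add_zero, sub_zero] at e1
  rw [← h.eq_add ha hb, ← h'.eq_add ha hb] at e1
  simp only [e1]
  ring

/-- The half-lines share the point 0 and the value `F 0`, so every integral can be routed through 0.
-/
theorem union (h : IsPrim (Iic 0) F f) (h' : IsPrim (Ici 0) F f) : IsPrim univ F f := by
  have h0 : ∀ a, IntervalIntegrable f volume 0 a ∧ ∫ x in 0..a, f x = F a - F 0 := by
    intro a
    rcases le_total a 0 with ha | ha
    · exact h 0 (mem_Iic.mpr le_rfl) a ha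
    · exact h' 0 (mem_Ici.mpr le_rfl) a ha
  intro a _ b _
  refine ⟨(h0 a).1.symm.trans (h0 b).1, ?_⟩
  rw [← intervalIntegral.integral_interval_sub_left (h0 b).1 (h0 a).1, (h0 a).2, (h0 b).2]
  ring

theorem continuous (h : IsPrim univ F f) : Continuous F := by
  have h1 : Continuous (fun x => F 0 + ∫ t in 0..x, f t) :=
    continuous_const.add (intervalIntegral.continuous_primitive
      (fun a b => (h a trivial b trivial).1) 0)
  convert! h1 using 1
  ext x
  exact h.eq_add trivial trivial

/-- An integrable primitive of an integrable function is its tail integral. -/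
theorem eq_neg_integral_Ioi (h : IsPrim univ F f) (hF : Integrable F) (hf : Integrable f) (y : ℝ) :
    F y = -∫ x in Ioi y, f x := by
  have h1 := intervalIntegral_tendsto_integral_Ioi (b := fun i : ℝ => i) y hf.integrableOn tendsto_id
  have h2 : Tendsto F atTop (𝓝 (F y + ∫ x in Ioi y, f x)) := by
    refine (h1.const_add (F y)).congr fun x => ?_
    exact (h.eq_add trivial trivial).symm
  -- A limit at infinity exists because `f` is integrable; it must vanish because `F` is integrable
  -- and every tail has infinite measure.
  have h3 := (hF.integrableAtFilter atTop).eq_zero_of_tendsto (by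
    intro s hs
    obtain ⟨a, ha⟩ := mem_atTop_sets.mp hs
    refine top_unique ?_
    rw [← Real.volume_Ici (a := a)]
    exact measure_mono ha) h2
  exact eq_neg_of_add_eq_zero_left h3

theorem integral_eq_zero (h : IsPrim univ F f) (hF : Integrable F) (hf : Integrable f) :
    ∫ x, f x = 0 := by
  have h1 := intervalIntegral_tendsto_integral_Iic (a := fun i : ℝ => i) 0 hf.integrableOn
    (tendsto_id (x := atBot))
  have h2 : Tendsto F atBot (𝓝 (F 0 - ∫ x in Iic 0, f x)) := by
    refine (h1.const_sub (F 0)).congr fun x => ?_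
    rw [(h x trivial 0 trivial).2]
    ring
  have h3 := (hF.integrableAtFilter atBot).eq_zero_of_tendsto (by
    intro s hs
    obtain ⟨a, ha⟩ := mem_atBot_sets.mp hs
    refine top_unique ?_
    rw [← Real.volume_Iic (a := a)]
    exact measure_mono ha) h2
  have h4 := h.eq_neg_integral_Ioi hF hf 0
  rw [← intervalIntegral.integral_Iic_add_Ioi (b := 0) hf.integrableOn hf.integrableOn]
  rw [sub_eq_zero.mp h3 |>.symm, h4]
  ring

end IsPrim

theorem intervalIntegrable_coe (f : H) (a b : ℝ) : IntervalIntegrable (fun x => f x) volume a b := by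
  have h : LocallyIntegrable (fun x => f x) volume := (Lp.memLp f).locallyIntegrable (by norm_num)
  exact (h.integrableOn_isCompact isCompact_uIcc).intervalIntegrable

/-- Integration by parts against a test function for a function with a jump at zero. -/
theorem integral_deriv_smul_of_isPrim {f F₁ F₂ g : ℝ → ℂ} (h₁ : IsPrim (Ici 0) F₁ g)
    (h₂ : IsPrim (Iic 0) F₂ g) (e₁ : ∀ᵐ x, 0 < x → f x = F₁ x) (e₂ : ∀ᵐ x, x < 0 → f x = F₂ x)
    {η : ℝ → ℝ} (hη : ContDiff ℝ ∞ η) (hc : HasCompactSupport η) :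
    ∫ x, deriv η x • f x = -(∫ x, η x • g x) + η 0 • (F₂ 0 - F₁ 0) := by
  obtain ⟨r, hr⟩ := hc.isCompact.isBounded.subset_closedBall 0
  -- The margin 1 puts the support strictly inside `(-R, R)`, so the boundary terms at `±R` vanish
  -- and only those at 0 remain.
  set R : ℝ := max r 0 + 1 with hR
  have hR0 : 0 < R := by positivity
  have hsupp : ∀ x, x ∈ tsupport η → x ∈ Ioo (-R) R := by
    intro x hx
    have := hr hx
    rw [mem_closedBall_zero_iff, Real.norm_eq_abs] at this
    have h2 : |x| < R := by
      rw [hR]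
      linarith [le_max_left r 0]
    exact abs_lt.mp h2
  have hη0 : ∀ x, x ∉ Ioo (-R) R → η x = 0 := fun x hx => by
    by_contra h
    exact hx (hsupp x (subset_tsupport _ h))
  have hs1 : Function.support (fun x => deriv η x • f x) ⊆ Ioc (-R) R := fun x hx =>
    Ioo_subset_Ioc_self (hsupp x (support_deriv_subset (fun h => hx (by simp [h]))))
  have hs2 : Function.support (fun x => η x • g x) ⊆ Ioc (-R) R := fun x hx =>
    Ioo_subset_Ioc_self (hsupp x (subset_tsupport _ (fun h => hx (by simp [h]))))
  have hd : Continuous (deriv η) := hη.continuous_deriv (by simp)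
  have hprim : ∀ s : Set ℝ, s.OrdConnected → IsPrim s (fun x => (η x : ℂ)) (fun x => ((deriv η x : ℝ) : ℂ)) := by
    intro s hs
    refine IsPrim.of_hasDerivAt (fun x _ => ?_) (Complex.continuous_ofReal.comp hd)
    exact ((hη.differentiable (by simp)) x).hasDerivAt.ofReal_comp
  have p1 := (hprim (Ici 0) inferInstance).mul h₁
  have p2 := (hprim (Iic 0) inferInstance).mul h₂
  obtain ⟨i1, v1⟩ := p1 0 (mem_Ici.mpr le_rfl) R hR0.le
  obtain ⟨i2, v2⟩ := p2 (-R) (by simp [hR0.le]) 0 (mem_Iic.mpr le_rfl)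
  have hg1 : IntervalIntegrable (fun x => η x • g x) volume 0 R := by
    have := ((h₁ 0 (mem_Ici.mpr le_rfl) R hR0.le).1).continuousOn_mul
      (g := fun x => (η x : ℂ)) (Complex.continuous_ofReal.comp hη.continuous).continuousOn
    simpa only [Complex.real_smul] using this
  have hg2 : IntervalIntegrable (fun x => η x • g x) volume (-R) 0 := by
    have := ((h₂ (-R) (by simp [hR0.le]) 0 (mem_Iic.mpr le_rfl)).1).continuousOn_mul
      (g := fun x => (η x : ℂ)) (Complex.continuous_ofReal.comp hη.continuous).continuousOn
    simpa only [Complex.real_smul] using this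
  have c1 : ∀ᵐ x, x ∈ uIoc 0 R → ((deriv η x : ℝ) : ℂ) * F₁ x = deriv η x • f x := by
    filter_upwards [e₁] with x hx hx0
    rw [uIoc_of_le hR0.le] at hx0
    rw [hx hx0.1, Complex.real_smul]
  have c2 : ∀ᵐ x, x ∈ uIoc (-R) 0 → ((deriv η x : ℝ) : ℂ) * F₂ x = deriv η x • f x := by
    filter_upwards [e₂, Measure.ae_ne volume (0 : ℝ)] with x hx hne hx0
    rw [uIoc_of_le (by linarith)] at hx0
    rw [hx (lt_of_le_of_ne hx0.2 hne), Complex.real_smul]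
  have k1 : IntervalIntegrable (fun x => ((deriv η x : ℝ) : ℂ) * F₁ x) volume 0 R := by
    refine (i1.sub hg1).congr fun x _ => ?_
    simp
  have k2 : IntervalIntegrable (fun x => ((deriv η x : ℝ) : ℂ) * F₂ x) volume (-R) 0 := by
    refine (i2.sub hg2).congr fun x _ => ?_
    simp
  have w1 : ∫ x in (0 : ℝ)..R, deriv η x • f x =
      -(η 0 : ℂ) * F₁ 0 - ∫ x in (0 : ℝ)..R, η x • g x := by
    rw [← intervalIntegral.integral_congr_ae c1, eq_sub_iff_add_eq,
      ← intervalIntegral.integral_add k1 hg1]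
    simp only [Complex.real_smul]
    rw [v1]
    simp [hη0 R (by simp)]
  have w2 : ∫ x in (-R)..0, deriv η x • f x =
      (η 0 : ℂ) * F₂ 0 - ∫ x in (-R)..0, η x • g x := by
    rw [← intervalIntegral.integral_congr_ae c2, eq_sub_iff_add_eq,
      ← intervalIntegral.integral_add k2 hg2]
    simp only [Complex.real_smul]
    rw [v2]
    simp [hη0 (-R) (by simp)]
  rw [← intervalIntegral.integral_eq_integral_of_support_subset hs1,
    ← intervalIntegral.integral_eq_integral_of_support_subset hs2,
    ← intervalIntegral.integral_add_adjacent_intervals (b := 0)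
      (k2.congr_ae ((ae_restrict_iff' measurableSet_uIoc).mpr c2))
      (k1.congr_ae ((ae_restrict_iff' measurableSet_uIoc).mpr c1)),
    ← intervalIntegral.integral_add_adjacent_intervals hg2 hg1, w1, w2, Complex.real_smul]
  ring

end DeltaNLS

/-! ### Weak derivatives, traces and the domain in terms of primitives -/

namespace DeltaNLS

open scoped ContDiff

theorem locallyIntegrable_coe (f : H) : LocallyIntegrable (fun x => f x) volume :=
  (Lp.memLp f).locallyIntegrable (by norm_num)

/-- Du Bois-Reymond: a function with vanishing weak derivative on an open interval is constant. -/
theorem ae_const_of_integral_deriv_smul_eq_zero {I : Set ℝ} (hI : IsOpen I) (hc : I.OrdConnected)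
    {d : ℝ → ℂ} (hd : LocallyIntegrable d volume)
    (h : ∀ η : ℝ → ℝ, ContDiff ℝ ∞ η → HasCompactSupport η → tsupport η ⊆ I →
      ∫ x, deriv η x • d x = 0) : ∃ c : ℂ, ∀ᵐ x, x ∈ I → d x = c := by
  rcases I.eq_empty_or_nonempty with rfl | ⟨x₀, hx₀⟩
  · exact ⟨0, by simp⟩
  obtain ⟨r, hr, hball⟩ := Metric.nhds_basis_closedBall.mem_iff.mp (hI.mem_nhds hx₀)
  let b : ContDiffBump x₀ := ⟨r / 2, r, by positivity, by linarith⟩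
  set η₀ : ℝ → ℝ := b.normed volume with hη₀
  have h01 : ContDiff ℝ ∞ η₀ := b.contDiff_normed
  have h02 : HasCompactSupport η₀ := b.hasCompactSupport_normed
  have h03 : tsupport η₀ ⊆ I := by
    rw [hη₀, b.tsupport_normed_eq]
    exact hball
  have h04 : ∫ x, η₀ x = 1 := b.integral_normed
  have hx0 : x₀ ∈ tsupport η₀ := by
    rw [hη₀, b.tsupport_normed_eq]
    exact Metric.mem_closedBall_self hr.le
  have hint : ∀ η : ℝ → ℝ, ContDiff ℝ ∞ η → HasCompactSupport η →
      Integrable (fun x => η x • d x) := fun η h1 h2 =>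
    hd.integrable_smul_left_of_hasCompactSupport h1.continuous h2
  refine ⟨∫ x, η₀ x • d x, ?_⟩
  have key := hI.ae_eq_zero_of_integral_contDiff_smul_eq_zero
    (f := fun x => d x - ∫ x, η₀ x • d x) (μ := volume)
    ((hd.sub (locallyIntegrable_const _)).locallyIntegrableOn I) ?_
  · filter_upwards [key] with x hx hxI
    exact sub_eq_zero.mp (hx hxI)
  intro η h1 h2 h3
  -- Subtracting a multiple of the unit-mass bump gives mean zero, so the primitive of `θ` has
  -- compact support and is itself an admissible test function.
  set θ : ℝ → ℝ := fun x => η x - (∫ y, η y) * η₀ x with hθ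
  have hθc : ContDiff ℝ ∞ θ := h1.sub (contDiff_const.mul h01)
  have hK : IsCompact (tsupport η ∪ tsupport η₀) := h2.isCompact.union h02.isCompact
  have hKI : tsupport η ∪ tsupport η₀ ⊆ I := union_subset h3 h03
  obtain ⟨a, haK, ha⟩ := hK.exists_isLeast ⟨x₀, Or.inr hx0⟩
  obtain ⟨c, hcK, hc'⟩ := hK.exists_isGreatest ⟨x₀, Or.inr hx0⟩
  have hθ0 : ∀ x, x ∉ Icc a c → θ x = 0 := by
    intro x hx
    have hx' : x ∉ tsupport η ∪ tsupport η₀ := fun h => hx ⟨ha h, hc' h⟩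
    rw [mem_union, not_or] at hx'
    simp [hθ, image_eq_zero_of_notMem_tsupport hx'.1, image_eq_zero_of_notMem_tsupport hx'.2]
  have hηi : Integrable η := h1.continuous.integrable_of_hasCompactSupport h2
  have hη₀i : Integrable η₀ := h01.continuous.integrable_of_hasCompactSupport h02
  have hθint : ∫ x, θ x = 0 := by
    rw [hθ, integral_sub hηi (hη₀i.const_mul _), integral_const_mul, h04]
    ring
  -- Starting strictly to the left of `a` lets the half-open interval of integration contain the
  -- whole support of `θ`, endpoint included.
  set ψ : ℝ → ℝ := fun x => ∫ t in (a - 1)..x, θ t with hψ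
  have hψd : ∀ x, HasDerivAt ψ (θ x) x := fun x =>
    intervalIntegral.integral_hasDerivAt_right (hθc.continuous.intervalIntegrable _ _)
      (hθc.continuous.stronglyMeasurableAtFilter _ _) hθc.continuous.continuousAt
  have hψ' : deriv ψ = θ := funext fun x => (hψd x).deriv
  have hψc : ContDiff ℝ ∞ ψ := by
    rw [contDiff_infty_iff_deriv, hψ']
    exact ⟨fun x => (hψd x).differentiableAt, hθc⟩
  have hψs : Function.support ψ ⊆ Icc a c := by
    intro x hx
    by_contra hxac
    refine hx ?_
    rw [mem_Icc, not_and_or, not_le, not_le] at hxac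
    rcases hxac with h' | h'
    · rw [hψ]
      simp only
      rw [intervalIntegral.integral_congr (g := fun _ => (0 : ℝ)), intervalIntegral.integral_zero]
      intro t ht
      refine hθ0 t fun h5 => ?_
      have h6 : t ≤ max (a - 1) x := ht.2
      have h7 : max (a - 1) x < a := max_lt (by linarith) h'
      linarith [h5.1]
    · rw [hψ]
      simp only
      rw [intervalIntegral.integral_eq_integral_of_support_subset, hθint]
      intro t ht
      have h5 : t ∈ Icc a c := by
        by_contra h6
        exact ht (hθ0 t h6)
      exact ⟨by linarith [h5.1], by linarith [h5.2]⟩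
  have hψt : tsupport ψ ⊆ Icc a c := closure_minimal hψs isClosed_Icc
  have hψI : tsupport ψ ⊆ I := hψt.trans (hc.out (hKI haK) (hKI hcK))
  have hψcs : HasCompactSupport ψ := isCompact_Icc.of_isClosed_subset (isClosed_tsupport _) hψt
  have h8 := h ψ hψc hψcs hψI
  rw [hψ'] at h8
  have e : ∀ x, θ x • d x = η x • d x - ((∫ y, η y : ℝ) : ℂ) * (η₀ x • d x) := by
    intro x
    simp only [hθ, Complex.real_smul]
    push_cast
    ring
  simp only [e] at h8
  rw [integral_sub (hint η h1 h2) ((hint η₀ h01 h02).const_mul _), integral_const_mul] at h8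
  have e2 : ∀ x, η x • (d x - ∫ x, η₀ x • d x) =
      η x • d x - ((η x : ℝ) : ℂ) * ∫ x, η₀ x • d x := by
    intro x
    simp only [Complex.real_smul]
    ring
  simp only [e2]
  have hηi' : Integrable (fun x => (η x : ℂ)) := hηi.ofReal
  rw [integral_sub (hint η h1 h2) (hηi'.mul_const _), integral_mul_const, integral_complex_ofReal]
  exact h8

/-- Du Bois-Reymond applied to `f` minus a primitive of `g`. The primitive starts at 0 even when `I`
is an open half-line ending there, so that `c` is then the one-sided value at 0. -/
theorem ae_eq_primitive_of_weakDeriv {I : Set ℝ} (hI : IsOpen I) (hc : I.OrdConnected) {f g : H}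
    {U : Set ℝ} (hIU : I ⊆ U) (h : HasWeakDeriv U f g) :
    ∃ c : ℂ, ∀ᵐ x, x ∈ I → f x = c + ∫ t in 0..x, g t := by
  have hp := IsPrim.primitive (intervalIntegrable_coe g) 0
  have hFl : LocallyIntegrable (fun x => ∫ t in 0..x, g t) volume := hp.continuous.locallyIntegrable
  obtain ⟨c, hc⟩ := ae_const_of_integral_deriv_smul_eq_zero hI hc
    (d := fun x => f x - ∫ t in 0..x, g t) ((locallyIntegrable_coe f).sub hFl) (by
    intro η h1 h2 h3
    have hd : Continuous (deriv η) := h1.continuous_deriv (by simp)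
    have e1 := h η h1 h2 (h3.trans hIU)
    have e2 := integral_deriv_smul_of_isPrim (f := fun x => ∫ t in 0..x, g t)
      (hp.mono (subset_univ _)) (hp.mono (subset_univ _)) (Eventually.of_forall fun _ _ => rfl)
      (Eventually.of_forall fun _ _ => rfl) h1 h2
    simp only [smul_sub]
    rw [integral_sub (integrable_smul_H hd h2.deriv f)
      (hFl.integrable_smul_left_of_hasCompactSupport hd h2.deriv), e1, e2]
    simp)
  refine ⟨c, ?_⟩
  filter_upwards [hc] with x hx hxI
  rw [← hx hxI]
  ring

/-- Two continuous representatives that agree almost everywhere on an open set agree there, so their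
limits at 0 coincide. -/
theorem HasTrace.eq_of_ae_eq {s : Set ℝ} (hs : IsOpen s) (h0 : (𝓝[s] (0 : ℝ)).NeBot) {f : H}
    {a : ℂ} (h : HasTrace s f a) {G : ℝ → ℂ} (hG : Continuous G) (hf : ∀ᵐ x, x ∈ s → f x = G x) :
    a = G 0 := by
  obtain ⟨g, h1, h2, h3⟩ := h
  have h4 : f =ᵐ[volume.restrict s] G := (ae_restrict_iff' hs.measurableSet).mpr hf
  have h5 : EqOn g G s := Measure.eqOn_open_of_ae_eq (h1.symm.trans h4) hs h2 hG.continuousOn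
  have h6 : Tendsto G (𝓝[s] 0) (𝓝 a) :=
    h3.congr' (eventually_nhdsWithin_of_forall fun x hx => h5 hx)
  exact tendsto_nhds_unique h6 (hG.continuousAt.tendsto.mono_left nhdsWithin_le_nhds)

theorem HasTrace.of_ae_eq {s : Set ℝ} (hs : MeasurableSet s) {f : H} {G : ℝ → ℂ} (hG : Continuous G)
    (hf : ∀ᵐ x, x ∈ s → f x = G x) : HasTrace s f (G 0) :=
  ⟨G, (ae_restrict_iff' hs).mpr hf, hG.continuousOn,
    hG.continuousAt.tendsto.mono_left nhdsWithin_le_nhds⟩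

theorem continuous_const_add_primitive (c : ℂ) (g : H) :
    Continuous fun x => c + ∫ t in 0..x, g t :=
  continuous_const.add (IsPrim.primitive (intervalIntegrable_coe g) 0).continuous

/-- The constants are the traces at 0. Conversely, integration by parts leaves a term `η(0)` times a
jump: for `u` the jump is zero, and for `v` the test functions vanish at 0. -/
theorem mem_graphZ_iff (Z : ℝ) (u f : H) : (u, f) ∈ graphZ Z ↔
    ∃ (v w : H) (c r l : ℂ), (∀ᵐ x, u x = c + ∫ t in 0..x, v t) ∧
      (∀ᵐ x, 0 < x → v x = r + ∫ t in 0..x, w t) ∧ (∀ᵐ x, x < 0 → v x = l + ∫ t in 0..x, w t) ∧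
      r - l = -(Z : ℂ) * c ∧ f = -w := by
  constructor
  · rintro ⟨v, w, h1, h2, ⟨c', r', l', hc', hr', hl', hj⟩, hf⟩
    obtain ⟨c, hc⟩ := ae_eq_primitive_of_weakDeriv isOpen_univ inferInstance (subset_univ _) h1
    obtain ⟨r, hr⟩ := ae_eq_primitive_of_weakDeriv (I := Ioi 0) isOpen_Ioi inferInstance
      (fun x hx => (mem_Ioi.mp hx).ne') h2
    obtain ⟨l, hl⟩ := ae_eq_primitive_of_weakDeriv (I := Iio 0) isOpen_Iio inferInstance
      (fun x hx => (mem_Iio.mp hx).ne) h2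
    refine ⟨v, w, c, r, l, hc.mono fun x hx => hx trivial, hr, hl, ?_, hf⟩
    have e1 := hc'.eq_of_ae_eq isOpen_univ (by rw [nhdsWithin_univ]; infer_instance)
      (continuous_const_add_primitive c v) hc
    have e2 := hr'.eq_of_ae_eq isOpen_Ioi inferInstance (continuous_const_add_primitive r w) hr
    have e3 := hl'.eq_of_ae_eq isOpen_Iio inferInstance (continuous_const_add_primitive l w) hl
    simp only [intervalIntegral.integral_same, add_zero] at e1 e2 e3
    rw [← e1, ← e2, ← e3, hj]
  · rintro ⟨v, w, c, r, l, hc, hr, hl, hj, hf⟩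
    have pv := (IsPrim.primitive (intervalIntegrable_coe v) 0).const_add c
    have pr := (IsPrim.primitive (intervalIntegrable_coe w) 0).const_add r
    have pl := (IsPrim.primitive (intervalIntegrable_coe w) 0).const_add l
    refine ⟨v, w, ?_, ?_, ⟨c, r, l, ?_, ?_, ?_, hj⟩, hf⟩
    · intro η h1 h2 _
      rw [integral_deriv_smul_of_isPrim (pv.mono (subset_univ _)) (pv.mono (subset_univ _))
        (hc.mono fun x hx _ => hx) (hc.mono fun x hx _ => hx) h1 h2]
      simp
    · intro η h1 h2 h3
      rw [integral_deriv_smul_of_isPrim (pr.mono (subset_univ _)) (pl.mono (subset_univ _))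
        hr hl h1 h2]
      have : η 0 = 0 := by
        by_contra h
        exact h3 (subset_tsupport _ h) rfl
      rw [this, zero_smul, add_zero]
    · simpa using HasTrace.of_ae_eq MeasurableSet.univ (continuous_const_add_primitive c v)
        (hc.mono fun x hx _ => hx)
    · simpa using HasTrace.of_ae_eq measurableSet_Ioi (continuous_const_add_primitive r w) hr
    · simpa using HasTrace.of_ae_eq measurableSet_Iio (continuous_const_add_primitive l w) hl

end DeltaNLS

/-! ### Bounded potentials, factorisation by a ground state, exponentially bounded kernels -/

namespace DeltaNLS

open scoped InnerProductSpace ENNReal NNReal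

theorem memLp_ofReal_mul {V : ℝ → ℝ} (hV : Measurable V) {B : ℝ} (hB : ∀ x, |V x| ≤ B) (u : H) :
    MemLp (fun x => (V x : ℂ) * u x) 2 := by
  refine MemLp.of_le_mul (c := B) (Lp.memLp u) ?_ (Eventually.of_forall fun x => ?_)
  · exact ((Complex.measurable_ofReal.comp hV).mul (measurable_coe u)).aestronglyMeasurable
  · rw [norm_mul, Complex.norm_real, Real.norm_eq_abs]
    gcongr
    exact hB x

theorem mem_graph_add_mulOp_iff {Z : ℝ} {V : ℝ → ℝ} (hV : Measurable V) {B : ℝ}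
    (hB : ∀ x, |V x| ≤ B) (u f : H) : (u, f) ∈ (pointInteraction Z + mulOp V).graph ↔
      ∃ g : H, (u, g) ∈ graphZ Z ∧ f =ᵐ[volume] fun x => g x + (V x : ℂ) * u x := by
  rw [LinearPMap.mem_graph_iff, ← pointInteraction_graph]
  constructor
  · rintro ⟨⟨y, hy⟩, rfl, rfl⟩
    refine ⟨pointInteraction Z ⟨y, hy.1⟩, LinearPMap.mem_graph _ ⟨y, hy.1⟩, ?_⟩
    rw [LinearPMap.add_apply]
    have h1 : mulOp V ⟨y, hy.2⟩ =ᵐ[volume] fun x => (V x : ℂ) * y x := MemLp.coeFn_toLp (memLp_ofReal_mul hV hB y)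
    filter_upwards [Lp.coeFn_add (pointInteraction Z ⟨y, hy.1⟩) (mulOp V ⟨y, hy.2⟩), h1] with x h2 h3
    rw [h2, Pi.add_apply, h3]
  · rintro ⟨g, hg, hf⟩
    obtain ⟨⟨y, hy⟩, rfl, rfl⟩ := (LinearPMap.mem_graph_iff _).mp hg
    have hy2 : y ∈ (mulOp V).domain := memLp_ofReal_mul hV hB y
    refine ⟨⟨y, hy, hy2⟩, rfl, ?_⟩
    rw [LinearPMap.add_apply]
    have h1 : mulOp V ⟨y, hy2⟩ =ᵐ[volume] fun x => (V x : ℂ) * y x := MemLp.coeFn_toLp (memLp_ofReal_mul hV hB y)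
    refine Lp.ext ?_
    filter_upwards [Lp.coeFn_add (pointInteraction Z ⟨y, hy⟩) (mulOp V ⟨y, hy2⟩), h1, hf] with x h2 h3 h4
    rw [h2, Pi.add_apply, h3, h4]

theorem domain_add_mulOp {Z : ℝ} {V : ℝ → ℝ} (hV : Measurable V) {B : ℝ}
    (hB : ∀ x, |V x| ≤ B) :
    ((pointInteraction Z + mulOp V).domain : Set H) = domainZ Z := by
  rw [← pointInteraction_domain, LinearPMap.add_domain]
  have : (mulOp V).domain = ⊤ := by
    rw [eq_top_iff]
    exact fun u _ => memLp_ofReal_mul hV hB u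
  rw [this, inf_top_eq]

/-- A positive function `φ` on the half-line `s` with logarithmic derivative `h`, where `h` solves
the Riccati equation `h' = V - h²`. -/
structure IsGroundState (s : Set ℝ) (φ h V : ℝ → ℂ) : Prop where
  ordConnected : s.OrdConnected
  ne_zero : ∀ x, φ x ≠ 0
  prim : IsPrim s φ (fun x => h x * φ x)
  prim_inv : IsPrim s (fun x => (φ x)⁻¹) (fun x => -(h x * (φ x)⁻¹))
  prim_log : IsPrim s h (fun x => V x - h x ^ 2)

section

variable {s : Set ℝ} {φ h V : ℝ → ℂ}

/-- Variation of constants for `d/dx - h`. -/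
theorem IsGroundState.isPrim_mul (hs : IsGroundState s φ h V) {Θ v : ℝ → ℂ}
    (hΘ : IsPrim s Θ (fun x => v x * (φ x)⁻¹)) :
    IsPrim s (fun x => φ x * Θ x) (fun x => h x * (φ x * Θ x) + v x) := by
  have := hs.ordConnected
  refine (hs.prim.mul hΘ).congr_on fun x _ => ?_
  have := hs.ne_zero x
  field_simp

/-- Variation of constants for the formal adjoint `-d/dx - h`. -/
theorem IsGroundState.isPrim_div (hs : IsGroundState s φ h V) {Ψ f : ℝ → ℂ}
    (hΨ : IsPrim s Ψ (fun x => -(φ x * f x))) :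
    IsPrim s (fun x => Ψ x * (φ x)⁻¹) (fun x => -(h x * (Ψ x * (φ x)⁻¹)) - f x) := by
  have := hs.ordConnected
  refine (hΨ.mul hs.prim_inv).congr_on fun x _ => ?_
  have := hs.ne_zero x
  field_simp
  ring

/-- The two first-order equations compose to the second-order one, because `h' + h² = V`. -/
theorem IsGroundState.isPrim_second (hs : IsGroundState s φ h V) {U v f : ℝ → ℂ}
    (hU : IsPrim s U (fun x => h x * U x + v x))
    (hv : IsPrim s v (fun x => -(h x * v x) - f x)) :
    IsPrim s (fun x => h x * U x + v x) (fun x => V x * U x - f x) := by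
  have := hs.ordConnected
  refine ((hs.prim_log.mul hU).add hv).congr_on fun x _ => ?_
  ring

/-- The converse direction: with `φ` and `φ⁻¹` as integrating factors, the second-order equation
splits into two successive integrations. -/
theorem IsGroundState.isPrim_factor (hs : IsGroundState s φ h V) {U v w : ℝ → ℂ}
    (hU : IsPrim s U v) (hv : IsPrim s v w) :
    IsPrim s (fun x => φ x * (v x - h x * U x)) (fun x => φ x * (w x - V x * U x)) ∧
    IsPrim s (fun x => U x * (φ x)⁻¹) (fun x => (v x - h x * U x) * (φ x)⁻¹) := by
  have := hs.ordConnected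
  constructor
  · refine ((hs.prim.mul (hv.add ((hs.prim_log.mul hU).neg))).congr_on fun x _ => ?_).congr
      fun x _ => ?_
    · ring
    · ring
  · refine (hU.mul hs.prim_inv).congr_on fun x _ => ?_
    ring

end

/-- The data of a profile `p` on `[0, ∞)`, with logarithmic derivative `q` and `p'' = W p`, which
decays like `exp (-κ x)`. -/
structure IsProfile (κ Z : ℝ) (p q W : ℝ → ℝ) : Prop where
  pos_rate : 0 < κ
  pos : ∀ x, 0 < p x
  hasDerivAt : ∀ x, HasDerivAt p (q x * p x) x
  hasDerivAt_log : ∀ x, HasDerivAt q (W x - q x ^ 2) x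
  continuous_potential : Continuous W
  log_zero : q 0 = -Z / 2
  log_bdd : ∃ C, ∀ x, 0 ≤ x → |q x| ≤ C
  ratio : ∃ C, ∀ x y, 0 ≤ y → y ≤ x → p x / p y ≤ C * Real.exp (-(κ * (x - y)))
  ratio_asymp : ∀ ε > 0, ∃ r, ∀ x y, r ≤ y → y ≤ x →
    p x / p y ≤ (1 + ε) * Real.exp (-(κ * (x - y)))
  potential_tendsto : Tendsto W atTop (𝓝 (κ ^ 2))

namespace IsProfile

variable {κ Z : ℝ} {p q W : ℝ → ℝ}

theorem continuous (h : IsProfile κ Z p q W) : Continuous p :=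
  continuous_iff_continuousAt.mpr fun x => (h.hasDerivAt x).continuousAt

theorem continuous_log (h : IsProfile κ Z p q W) : Continuous q :=
  continuous_iff_continuousAt.mpr fun x => (h.hasDerivAt_log x).continuousAt

theorem continuous_abs (h : IsProfile κ Z p q W) : Continuous fun x => p |x| :=
  h.continuous.comp _root_.continuous_abs

theorem potential_bdd (h : IsProfile κ Z p q W) : ∃ B, ∀ x, |W (|x|)| ≤ B := by
  obtain ⟨a, ha⟩ := eventually_atTop.mp
    (h.potential_tendsto.abs.eventually (eventually_le_nhds (lt_add_one |κ ^ 2|)))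
  obtain ⟨C, hC⟩ := isCompact_Icc.exists_bound_of_continuousOn (s := Icc 0 a)
    h.continuous_potential.continuousOn
  refine ⟨max C (|κ ^ 2| + 1), fun x => ?_⟩
  rcases le_total (|x|) a with hx | hx
  · exact (hC _ ⟨abs_nonneg x, hx⟩).trans (le_max_left _ _)
  · exact (ha _ hx).trans (le_max_right _ _)

theorem groundState_Ici (h : IsProfile κ Z p q W) :
    IsGroundState (Ici 0) (fun x => (p |x| : ℂ)) (fun x => (q x : ℂ)) (fun x => (W |x| : ℂ)) := by
  have hp : ∀ x, (p x : ℂ) ≠ 0 := fun x => by exact_mod_cast (h.pos x).ne'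
  have cp : Continuous fun x => (p x : ℂ) := Complex.continuous_ofReal.comp h.continuous
  have cq : Continuous fun x => (q x : ℂ) := Complex.continuous_ofReal.comp h.continuous_log
  have cW : Continuous fun x => (W x : ℂ) := Complex.continuous_ofReal.comp h.continuous_potential
  have habs : ∀ x ∈ Ici (0 : ℝ), |x| = x := fun x hx => abs_of_nonneg hx
  have d1 : ∀ x, HasDerivAt (fun x => (p x : ℂ)) ((q x : ℂ) * p x) x := fun x => by
    simpa using (h.hasDerivAt x).ofReal_comp
  have d2 : ∀ x, HasDerivAt (fun x => (q x : ℂ)) ((W x : ℂ) - (q x : ℂ) ^ 2) x := fun x => by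
    simpa using (h.hasDerivAt_log x).ofReal_comp
  refine ⟨inferInstance, fun x => hp _, ?_, ?_, ?_⟩
  · refine ((IsPrim.of_hasDerivAt (fun x _ => d1 x) (cq.mul cp)).congr_on fun x hx => ?_).congr
      fun x hx => ?_
    · simp only [habs x hx]
    · simp only [habs x hx]
  · refine ((IsPrim.of_hasDerivAt (F := fun x => (p x : ℂ)⁻¹)
      (f := fun x => -((q x : ℂ) * (p x : ℂ)⁻¹))
      (fun x _ => ?_) (cq.mul (cp.inv₀ hp)).neg).congr_on fun x hx => ?_).congr
      fun x hx => ?_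
    · refine ((d1 x).inv (hp x)).congr_deriv ?_
      have := hp x
      field_simp
    · simp only [habs x hx]
    · simp only [habs x hx]
  · refine (IsPrim.of_hasDerivAt (fun x _ => d2 x) (cW.sub (cq.pow 2))).congr_on fun x hx => ?_
    simp only [habs x hx]

theorem groundState_Iic (h : IsProfile κ Z p q W) :
    IsGroundState (Iic 0) (fun x => (p |x| : ℂ)) (fun x => -(q (-x) : ℂ))
      (fun x => (W |x| : ℂ)) := by
  have hp : ∀ x, (p x : ℂ) ≠ 0 := fun x => by exact_mod_cast (h.pos x).ne'
  have cp : Continuous fun x : ℝ => (p (-x) : ℂ) :=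
    Complex.continuous_ofReal.comp (h.continuous.comp continuous_neg)
  have cq : Continuous fun x : ℝ => (q (-x) : ℂ) :=
    Complex.continuous_ofReal.comp (h.continuous_log.comp continuous_neg)
  have cW : Continuous fun x : ℝ => (W (-x) : ℂ) :=
    Complex.continuous_ofReal.comp (h.continuous_potential.comp continuous_neg)
  have habs : ∀ x ∈ Iic (0 : ℝ), |x| = -x := fun x hx => abs_of_nonpos hx
  have d1 : ∀ x, HasDerivAt (fun x : ℝ => (p (-x) : ℂ)) (-(q (-x) : ℂ) * p (-x)) x := fun x => by
    have := ((h.hasDerivAt (-x)).comp x (hasDerivAt_neg x)).ofReal_comp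
    refine this.congr_deriv ?_
    push_cast
    ring
  have d2 : ∀ x, HasDerivAt (fun x : ℝ => -(q (-x) : ℂ)) ((W (-x) : ℂ) - (-(q (-x) : ℂ)) ^ 2) x :=
    fun x => by
    have := ((h.hasDerivAt_log (-x)).comp x (hasDerivAt_neg x)).ofReal_comp.neg
    refine this.congr_deriv ?_
    push_cast
    ring
  refine ⟨inferInstance, fun x => hp _, ?_, ?_, ?_⟩
  · refine ((IsPrim.of_hasDerivAt (fun x _ => d1 x) (cq.neg.mul cp)).congr_on fun x hx => ?_).congr
      fun x hx => ?_
    · simp only [habs x hx]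
    · simp only [habs x hx]
  · refine ((IsPrim.of_hasDerivAt (F := fun x : ℝ => (p (-x) : ℂ)⁻¹)
      (f := fun x => -(-(q (-x) : ℂ) * (p (-x) : ℂ)⁻¹))
      (fun x _ => ?_) (cq.neg.mul (cp.inv₀ fun x => hp _)).neg).congr_on fun x hx => ?_).congr
      fun x hx => ?_
    · refine ((d1 x).inv (hp (-x))).congr_deriv ?_
      have := hp (-x)
      field_simp
    · simp only [habs x hx]
    · simp only [habs x hx]
  · refine (IsPrim.of_hasDerivAt (fun x _ => d2 x) (cW.sub (cq.neg.pow 2))).congr_on fun x hx => ?_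
    simp only [habs x hx]

end IsProfile

/-- The sign of the kernel of the oriented integral from `0` to `x`. -/
noncomputable def orientation (x y : ℝ) : ℝ :=
  if 0 < y ∧ y < x then 1 else if x < y ∧ y < 0 then -1 else 0

theorem orientation_of_pos {x : ℝ} (hx : 0 ≤ x) (y : ℝ) :
    orientation x y = (Ioo 0 x).indicator 1 y := by
  by_cases h : 0 < y ∧ y < x
  · rw [orientation, if_pos h, indicator_of_mem (show y ∈ Ioo 0 x from h), Pi.one_apply]
  · rw [orientation, if_neg h, if_neg (fun h' => by linarith [h'.1, h'.2]),
      indicator_of_notMem (show y ∉ Ioo 0 x from h)]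

theorem orientation_of_neg {x : ℝ} (hx : x ≤ 0) (y : ℝ) :
    orientation x y = -(Ioo x 0).indicator 1 y := by
  by_cases h : x < y ∧ y < 0
  · rw [orientation, if_neg (fun h' => by linarith [h'.1, h'.2]), if_pos h,
      indicator_of_mem (show y ∈ Ioo x 0 from h), Pi.one_apply]
  · rw [orientation, if_neg (fun h' => by linarith [h'.1, h'.2]), if_neg h,
      indicator_of_notMem (show y ∉ Ioo x 0 from h), neg_zero]

theorem orientation_right_of_pos {y : ℝ} (hy : 0 < y) (x : ℝ) :
    orientation x y = (Ioi y).indicator 1 x := by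
  by_cases h : y < x
  · rw [orientation, if_pos ⟨hy, h⟩, indicator_of_mem (show x ∈ Ioi y from h), Pi.one_apply]
  · rw [orientation, if_neg (fun h' => h h'.2), if_neg (fun h' => by linarith [h'.2]),
      indicator_of_notMem (show x ∉ Ioi y from h)]

theorem orientation_right_of_neg {y : ℝ} (hy : y < 0) (x : ℝ) :
    orientation x y = -(Iio y).indicator 1 x := by
  by_cases h : x < y
  · rw [orientation, if_neg (fun h' => by linarith [h'.1]), if_pos ⟨h, hy⟩,
      indicator_of_mem (show x ∈ Iio y from h), Pi.one_apply]
  · rw [orientation, if_neg (fun h' => by linarith [h'.1]), if_neg (fun h' => h h'.1),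
      indicator_of_notMem (show x ∉ Iio y from h), neg_zero]

theorem orientation_right_zero (x : ℝ) : orientation x 0 = 0 := by
  simp [orientation]

theorem measurable_orientation : Measurable (Function.uncurry orientation) := by
  refine Measurable.ite ?_ measurable_const (Measurable.ite ?_ measurable_const measurable_const)
  · exact (measurableSet_lt measurable_const measurable_snd).inter
      (measurableSet_lt measurable_snd measurable_fst)
  · exact (measurableSet_lt measurable_fst measurable_snd).inter
      (measurableSet_lt measurable_snd measurable_const)

theorem lintegral_exp_Ioi {κ : ℝ} (hκ : 0 < κ) (a : ℝ) :
    ∫⁻ t in Ioi a, ENNReal.ofReal (Real.exp (-(κ * (t - a)))) = ENNReal.ofReal κ⁻¹ := by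
  have e : ∀ t, Real.exp (-(κ * (t - a))) = Real.exp (κ * a) * Real.exp ((-κ) * t) := by
    intro t
    rw [← Real.exp_add]
    ring_nf
  have hi : IntegrableOn (fun t => Real.exp (-(κ * (t - a)))) (Ioi a) := by
    simp only [e]
    exact (integrableOn_exp_mul_Ioi (neg_lt_zero.mpr hκ) a).const_mul _
  rw [← ofReal_integral_eq_lintegral_ofReal hi (Eventually.of_forall fun t => (Real.exp_pos _).le)]
  simp only [e]
  rw [integral_const_mul, integral_exp_mul_Ioi (neg_lt_zero.mpr hκ), neg_div_neg_eq, mul_div_assoc',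
    ← Real.exp_add]
  simp

theorem lintegral_exp_Iio {κ : ℝ} (hκ : 0 < κ) (a : ℝ) :
    ∫⁻ t in Iio a, ENNReal.ofReal (Real.exp (-(κ * (a - t)))) = ENNReal.ofReal κ⁻¹ := by
  have e : ∀ t, Real.exp (-(κ * (a - t))) = Real.exp (-(κ * a)) * Real.exp (κ * t) := by
    intro t
    rw [← Real.exp_add]
    ring_nf
  have hi : IntegrableOn (fun t => Real.exp (-(κ * (a - t)))) (Iic a) := by
    simp only [e]
    exact (integrableOn_exp_mul_Iic hκ a).const_mul _
  rw [← ofReal_integral_eq_lintegral_ofReal (hi.mono_set Iio_subset_Iic_self)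
    (Eventually.of_forall fun t => (Real.exp_pos _).le), ← integral_Iic_eq_integral_Iio]
  simp only [e]
  rw [integral_const_mul, integral_exp_mul_Iic hκ, mul_div_assoc', ← Real.exp_add]
  simp

/-- Kernels dominated by `exp (-κ (|x| - |y|))` between `0` and `x` satisfy the Schur test. -/
theorem IsSchurKernel.of_le {κ : ℝ} (hκ : 0 < κ) {C : ℝ} (hC : 0 ≤ C) {k : ℝ → ℝ → ℝ}
    (hk : Measurable (Function.uncurry k))
    (hle : ∀ x y, |k x y| ≤ |orientation x y| * (C * Real.exp (-(κ * (|x| - |y|))))) :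
    IsSchurKernel k (C * κ⁻¹).toNNReal := by
  -- One estimate serves rows and columns: each is supported in an interval contained in a
  -- half-line, over which the exponential has integral `κ⁻¹`.
  have hfin : ∀ (t : ℝ → ℝ) (S : Set ℝ) (c : ℝ → ℝ), MeasurableSet S → Measurable c →
      (∀ y, |t y| ≤ S.indicator 1 y * (C * Real.exp (c y))) →
      ∫⁻ y in S, ENNReal.ofReal (Real.exp (c y)) ≤ ENNReal.ofReal κ⁻¹ →
      ∫⁻ y, ‖t y‖ₑ ≤ ((C * κ⁻¹).toNNReal : ℝ≥0∞) := by
    intro t S c hS hc h1 h2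
    calc ∫⁻ y, ‖t y‖ₑ ≤ ∫⁻ y, S.indicator
          (fun y => ENNReal.ofReal C * ENNReal.ofReal (Real.exp (c y))) y := by
          refine lintegral_mono fun y => ?_
          rw [← ofReal_norm, Real.norm_eq_abs]
          by_cases hy : y ∈ S
          · rw [indicator_of_mem hy, ← ENNReal.ofReal_mul hC]
            refine ENNReal.ofReal_le_ofReal ?_
            simpa [hy] using h1 y
          · rw [indicator_of_notMem hy]
            have := h1 y
            rw [indicator_of_notMem hy, zero_mul] at this
            rw [ENNReal.ofReal_of_nonpos this]
      _ = ENNReal.ofReal C * ∫⁻ y in S, ENNReal.ofReal (Real.exp (c y)) := by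
          have hm : Measurable fun y => ENNReal.ofReal (Real.exp (c y)) :=
            ENNReal.measurable_ofReal.comp (Real.measurable_exp.comp hc)
          rw [lintegral_indicator hS, lintegral_const_mul _ hm]
      _ ≤ ENNReal.ofReal C * ENNReal.ofReal κ⁻¹ := by gcongr
      _ = ((C * κ⁻¹).toNNReal : ℝ≥0∞) := by
          rw [← ENNReal.ofReal_mul hC]
          rfl
  refine ⟨hk, fun x => ?_, fun y => ?_⟩
  · rcases le_total 0 x with hx | hx
    · refine hfin _ (Ioo 0 x) (fun y => -(κ * (x - y))) measurableSet_Ioo (by fun_prop)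
        (fun y => ?_) ?_
      · refine (hle x y).trans ?_
        rw [orientation_of_pos hx]
        by_cases hy : y ∈ Ioo 0 x
        · simp [hy, abs_of_nonneg hx, abs_of_pos hy.1]
        · simp [hy]
      · rw [← lintegral_exp_Iio hκ x]
        exact lintegral_mono_set fun y hy => hy.2
    · refine hfin _ (Ioo x 0) (fun y => -(κ * (y - x))) measurableSet_Ioo (by fun_prop)
        (fun y => ?_) ?_
      · refine (hle x y).trans ?_
        rw [orientation_of_neg hx]
        by_cases hy : y ∈ Ioo x 0
        · simp only [hy, indicator_of_mem, Pi.one_apply, abs_neg, abs_one, one_mul,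
            abs_of_nonpos hx, abs_of_neg hy.2]
          refine le_of_eq ?_
          ring_nf
        · simp [hy]
      · rw [← lintegral_exp_Ioi hκ x]
        exact lintegral_mono_set fun y hy => hy.1
  · rcases lt_trichotomy y 0 with hy | rfl | hy
    · refine hfin (fun x => k x y) (Iio y) (fun x => -(κ * (y - x))) measurableSet_Iio (by fun_prop)
        (fun x => ?_) (lintegral_exp_Iio hκ y).le
      refine (hle x y).trans ?_
      rw [orientation_right_of_neg hy]
      by_cases hx : x ∈ Iio y
      · simp only [hx, indicator_of_mem, Pi.one_apply, abs_neg, abs_one, one_mul,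
          abs_of_neg (lt_trans (mem_Iio.mp hx) hy), abs_of_neg hy]
        refine le_of_eq ?_
        ring_nf
      · simp [hx]
    · refine hfin (fun x => k x 0) ∅ (fun x => 0) MeasurableSet.empty measurable_const
        (fun x => ?_) (by simp)
      refine (hle x 0).trans ?_
      simp [orientation_right_zero]
    · refine hfin (fun x => k x y) (Ioi y) (fun x => -(κ * (x - y))) measurableSet_Ioi (by fun_prop)
        (fun x => ?_) (lintegral_exp_Ioi hκ y).le
      refine (hle x y).trans ?_
      rw [orientation_right_of_pos hy]
      by_cases hx : x ∈ Ioi y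
      · simp [hx, abs_of_pos (lt_trans hy (mem_Ioi.mp hx)), abs_of_pos hy]
      · simp [hx]

end DeltaNLS

/-! ### The ratio kernel and the reduced inverse -/

namespace DeltaNLS

open scoped InnerProductSpace ENNReal NNReal

/-- The kernel of the right inverse `v ↦ p |x| ∫₀ˣ v / p |t|` of `d/dx - φ' / φ`, `φ x = p |x|`. -/
noncomputable def ratioKernel (p : ℝ → ℝ) (x y : ℝ) : ℝ := p |x| / p |y| * orientation x y

theorem abs_le_abs_of_orientation_ne_zero {x y : ℝ} (h : orientation x y ≠ 0) : |y| ≤ |x| := by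
  rcases le_total 0 x with hx | hx
  · rw [orientation_of_pos hx] at h
    have : y ∈ Ioo 0 x := by
      by_contra h'
      exact h (indicator_of_notMem h' _)
    rw [abs_of_pos this.1, abs_of_nonneg hx]
    exact this.2.le
  · rw [orientation_of_neg hx] at h
    have : y ∈ Ioo x 0 := by
      by_contra h'
      exact h (by rw [indicator_of_notMem h', neg_zero])
    rw [abs_of_neg this.2, abs_of_nonpos hx]
    linarith [this.1]

namespace IsProfile

variable {κ Z : ℝ} {p q W : ℝ → ℝ}

theorem measurable_ratioKernel (h : IsProfile κ Z p q W) :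
    Measurable (Function.uncurry (ratioKernel p)) :=
  ((h.continuous_abs.measurable.comp measurable_fst).div
    (h.continuous_abs.measurable.comp measurable_snd)).mul measurable_orientation

theorem abs_ratioKernel_le (h : IsProfile κ Z p q W) {C x y : ℝ}
    (hC : |y| ≤ |x| → p |x| / p |y| ≤ C * Real.exp (-(κ * (|x| - |y|)))) :
    |ratioKernel p x y| ≤ |orientation x y| * (C * Real.exp (-(κ * (|x| - |y|)))) := by
  rw [ratioKernel, abs_mul, mul_comm]
  by_cases ho : orientation x y = 0
  · simp [ho]
  · gcongr
    rw [abs_of_pos (div_pos (h.pos _) (h.pos _))]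
    exact hC (abs_le_abs_of_orientation_ne_zero ho)

theorem exists_isSchurKernel (h : IsProfile κ Z p q W) : ∃ A, IsSchurKernel (ratioKernel p) A := by
  obtain ⟨C, hC⟩ := h.ratio
  have hC0 : 0 ≤ C := by
    have := hC 0 0 le_rfl le_rfl
    rw [div_self (h.pos 0).ne'] at this
    simp at this
    linarith
  exact ⟨_, IsSchurKernel.of_le h.pos_rate hC0 h.measurable_ratioKernel fun x y =>
    h.abs_ratioKernel_le fun hxy => hC _ _ (abs_nonneg y) hxy⟩

theorem memLp (h : IsProfile κ Z p q W) : MemLp (fun x => (p |x| : ℂ)) 2 := by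
  obtain ⟨C, hC⟩ := h.ratio
  have hκ := h.pos_rate
  have hE : MemLp (fun x : ℝ => Real.exp (-(κ * |x|))) 2 := by
    have hc : Continuous fun x : ℝ => Real.exp (-(κ * |x|)) := by fun_prop
    rw [memLp_two_iff_integrable_sq hc.aestronglyMeasurable]
    have e : ∀ x : ℝ, Real.exp (-(κ * |x|)) ^ 2 = Real.exp (-(2 * κ) * |x|) := by
      intro x
      rw [← Real.exp_nat_mul]
      push_cast
      ring_nf
    simp only [e]
    rw [← integrableOn_univ, ← Iic_union_Ioi (a := (0 : ℝ))]
    refine IntegrableOn.union ?_ ?_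
    · refine (integrableOn_exp_mul_Iic (a := 2 * κ) (by positivity) 0).congr_fun (fun x hx => ?_)
        measurableSet_Iic
      simp only
      rw [abs_of_nonpos hx]
      ring_nf
    · refine (integrableOn_exp_mul_Ioi (a := -(2 * κ)) (by linarith) 0).congr_fun (fun x hx => ?_)
        measurableSet_Ioi
      simp only
      rw [abs_of_pos hx]
  refine MemLp.of_le_mul (c := p 0 * C) hE
    (Complex.continuous_ofReal.comp h.continuous_abs).aestronglyMeasurable
    (Eventually.of_forall fun x => ?_)
  have h1 := hC |x| 0 le_rfl (abs_nonneg x)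
  rw [div_le_iff₀ (h.pos 0), sub_zero] at h1
  rw [Complex.norm_real, Real.norm_of_nonneg (h.pos _).le, Real.norm_of_nonneg (Real.exp_pos _).le]
  linarith

/-- The function `x ↦ p |x|` as an element of `L²`. -/
noncomputable def toH (h : IsProfile κ Z p q W) : H := h.memLp.toLp _

theorem toH_ae (h : IsProfile κ Z p q W) : h.toH =ᵐ[volume] fun x => (p |x| : ℂ) :=
  MemLp.coeFn_toLp _

theorem toH_ne_zero (h : IsProfile κ Z p q W) : h.toH ≠ 0 := by
  intro h0
  have h1 := h.toH_ae
  rw [h0] at h1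
  have h2 : ∀ᵐ x : ℝ, False := by
    filter_upwards [h1, Lp.coeFn_zero ℂ 2 (volume : Measure ℝ)] with x h3 h4
    rw [h4, Pi.zero_apply] at h3
    exact (h.pos |x|).ne (by exact_mod_cast h3)
  rw [eventually_false_iff_eq_bot, ae_eq_bot] at h2
  exact NeZero.ne (volume : Measure ℝ) h2

theorem integrable_mul (h : IsProfile κ Z p q W) (f : H) :
    Integrable fun x => (p |x| : ℂ) * f x :=
  h.memLp.integrable_mul (Lp.memLp f)

theorem inner_toH (h : IsProfile κ Z p q W) (f : H) :
    ⟪h.toH, f⟫_ℂ = ∫ x, (p |x| : ℂ) * f x := by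
  rw [L2.inner_def]
  refine integral_congr_ae ?_
  filter_upwards [h.toH_ae] with x hx
  rw [RCLike.inner_apply, hx, Complex.conj_ofReal, mul_comm]

theorem ofReal_ne_zero (h : IsProfile κ Z p q W) (x : ℝ) : (p x : ℂ) ≠ 0 := by
  exact_mod_cast (h.pos x).ne'

theorem continuous_inv (h : IsProfile κ Z p q W) : Continuous fun x => ((p |x| : ℝ) : ℂ)⁻¹ :=
  (Complex.continuous_ofReal.comp h.continuous_abs).inv₀ fun _ => h.ofReal_ne_zero _

theorem integral_ratioKernel (p : ℝ → ℝ) (v : ℝ → ℂ) (x : ℝ) :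
    ∫ y, (ratioKernel p x y : ℂ) * v y = (p |x| : ℂ) * ∫ t in 0..x, v t * (p |t| : ℂ)⁻¹ := by
  rcases le_total 0 x with hx | hx
  · rw [intervalIntegral.integral_of_le hx, integral_Ioc_eq_integral_Ioo,
      ← integral_indicator measurableSet_Ioo, ← integral_const_mul]
    congr 1
    ext y
    rw [ratioKernel, orientation_of_pos hx]
    by_cases hy : y ∈ Ioo 0 x
    · simp only [hy, indicator_of_mem, Pi.one_apply, mul_one]
      push_cast
      ring
    · simp [hy]
  · rw [intervalIntegral.integral_of_ge hx, integral_Ioc_eq_integral_Ioo,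
      ← integral_indicator measurableSet_Ioo, mul_neg, ← integral_const_mul, ← integral_neg]
    congr 1
    ext y
    rw [ratioKernel, orientation_of_neg hx]
    by_cases hy : y ∈ Ioo x 0
    · simp only [hy, indicator_of_mem, Pi.one_apply]
      push_cast
      ring
    · simp [hy]

theorem integral_ratioKernel_left_of_pos (p : ℝ → ℝ) (f : ℝ → ℂ) {y : ℝ} (hy : 0 < y) :
    ∫ x, (ratioKernel p x y : ℂ) * f x = (∫ x in Ioi y, (p |x| : ℂ) * f x) * (p |y| : ℂ)⁻¹ := by
  rw [← integral_indicator measurableSet_Ioi, ← integral_mul_const]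
  congr 1
  ext x
  rw [ratioKernel, orientation_right_of_pos hy]
  by_cases hx : x ∈ Ioi y
  · simp only [hx, indicator_of_mem, Pi.one_apply]
    push_cast
    ring
  · simp [hx]

theorem integral_ratioKernel_left_of_neg (p : ℝ → ℝ) (f : ℝ → ℂ) {y : ℝ} (hy : y < 0) :
    ∫ x, (ratioKernel p x y : ℂ) * f x = -(∫ x in Iio y, (p |x| : ℂ) * f x) * (p |y| : ℂ)⁻¹ := by
  rw [← integral_indicator measurableSet_Iio, ← integral_neg, ← integral_mul_const]
  congr 1
  ext x
  rw [ratioKernel, orientation_right_of_neg hy]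
  by_cases hx : x ∈ Iio y
  · simp only [hx, indicator_of_mem, Pi.one_apply]
    push_cast
    ring
  · simp [hx]

/-- For negative `y` the adjoint produces minus the integral over the left tail. Orthogonality to
`φ` turns it into the right tail, so one formula, continuous at 0, covers both sides. -/
theorem star_kernelOp_ae (h : IsProfile κ Z p q W) {A : ℝ≥0} (hk : IsSchurKernel (ratioKernel p) A)
    (f : H) (hf : ∫ x, (p |x| : ℂ) * f x = 0) : star (kernelOp hk) f =ᵐ[volume]
      fun y => (∫ x in Ioi y, (p |x| : ℂ) * f x) * (p |y| : ℂ)⁻¹ := by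
  rw [star_kernelOp]
  filter_upwards [kernelOp_ae hk.swap f, Measure.ae_ne volume (0 : ℝ)] with y hy hy0
  rw [hy]
  rcases lt_or_gt_of_ne hy0 with h0 | h0
  · rw [integral_ratioKernel_left_of_neg p _ h0, ← integral_Iic_eq_integral_Iio]
    have := intervalIntegral.integral_Iic_add_Ioi (b := y) (h.integrable_mul f).integrableOn
      (h.integrable_mul f).integrableOn
    rw [hf] at this
    rw [eq_neg_of_add_eq_zero_left this, neg_neg]
  · exact integral_ratioKernel_left_of_pos p _ h0

theorem kernelOp_ratio_ae {A : ℝ≥0} (hk : IsSchurKernel (ratioKernel p) A) (v : H) :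
    kernelOp hk v =ᵐ[volume] fun x => (p |x| : ℂ) * ∫ t in 0..x, v t * (p |t| : ℂ)⁻¹ := by
  filter_upwards [kernelOp_ae hk v] with x hx
  rw [hx, integral_ratioKernel]

/-- With `v = G* f`, the function `u` satisfies `u' = h u + v` and `v' = -h v - f` on each
half-line. Since `v` has a continuous representative at 0, the jump of `u'` is that of `h` times
`u(0)`. -/
theorem mem_graph_of_eq (h : IsProfile κ Z p q W) {A : ℝ≥0} (hk : IsSchurKernel (ratioKernel p) A)
    {f : H} (hf : ⟪h.toH, f⟫_ℂ = 0) (c : ℂ) :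
    (kernelOp hk (star (kernelOp hk) f) + c • h.toH, f) ∈
      (pointInteraction Z + mulOp (fun x => W |x|)).graph := by
  rw [h.inner_toH] at hf
  set vH : H := star (kernelOp hk) f with hvH
  set u : H := kernelOp hk vH + c • h.toH with hu
  have hφf := h.integrable_mul f
  have hφfi : ∀ a b, IntervalIntegrable (fun x => (p |x| : ℂ) * f x) volume a b := fun a b =>
    hφf.intervalIntegrable
  set Ψ : ℝ → ℂ := fun y => ∫ x in Ioi y, (p |x| : ℂ) * f x with hΨ
  have pΨ : IsPrim univ Ψ (fun x => -((p |x| : ℂ) * f x)) := by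
    refine ((IsPrim.primitive hφfi 0).neg.const_add (Ψ 0)).congr fun y _ => ?_
    rw [hΨ]
    simp only
    rw [← sub_eq_add_neg, sub_eq_iff_eq_add, add_comm,
      intervalIntegral.integral_interval_add_Ioi hφf.integrableOn hφf.integrableOn]
  set V : ℝ → ℂ := fun y => Ψ y * (p |y| : ℂ)⁻¹ with hV
  have aV : vH =ᵐ[volume] V := h.star_kernelOp_ae hk f hf
  set U : ℝ → ℂ := fun x => (p |x| : ℂ) * (c + ∫ t in 0..x, vH t * (p |t| : ℂ)⁻¹) with hU
  have aU : u =ᵐ[volume] U := by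
    filter_upwards [Lp.coeFn_add (kernelOp hk vH) (c • h.toH), Lp.coeFn_smul c h.toH, h.toH_ae,
      kernelOp_ratio_ae hk vH] with x h1 h2 h3 h4
    rw [hu, h1, Pi.add_apply, h2, Pi.smul_apply, h3, h4, smul_eq_mul, hU]
    ring
  have pΘ : IsPrim univ (fun x => c + ∫ t in 0..x, vH t * (p |t| : ℂ)⁻¹)
      (fun x => vH x * (p |x| : ℂ)⁻¹) :=
    (IsPrim.primitive (fun a b => (intervalIntegrable_coe vH a b).mul_continuousOn
      h.continuous_inv.continuousOn) 0).const_add c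
  have half : ∀ (s : Set ℝ) (l : ℝ → ℂ), s.OrdConnected →
      IsGroundState s (fun x => (p |x| : ℂ)) l (fun x => (W |x| : ℂ)) →
      IsPrim s U (fun x => l x * U x + V x) ∧
        IsPrim s (fun x => l x * U x + V x) (fun x => (W |x| : ℂ) * U x - f x) := by
    intro s l hs hl
    have h1 : IsPrim s U (fun x => l x * U x + V x) := by
      refine (hl.isPrim_mul (pΘ.mono (subset_univ s))).congr_ae ?_
      filter_upwards [aV] with x hx _
      rw [hx]
    exact ⟨h1, hl.isPrim_second h1 (hl.isPrim_div (pΨ.mono (subset_univ s)))⟩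
  obtain ⟨a1, a2⟩ := half _ _ inferInstance h.groundState_Ici
  obtain ⟨b1, b2⟩ := half _ _ inferInstance h.groundState_Iic
  -- The two-sided logarithmic derivative; its value at 0 is immaterial.
  set l : ℝ → ℝ := fun x => if 0 ≤ x then q x else -q (-x) with hl
  have hlm : Measurable l := Measurable.ite measurableSet_Ici h.continuous_log.measurable
    (h.continuous_log.comp continuous_neg).neg.measurable
  obtain ⟨Cq, hCq⟩ := h.log_bdd
  have hlb : ∀ x, |l x| ≤ Cq := by
    intro x
    by_cases hx : 0 ≤ x
    · simp only [hl, if_pos hx]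
      exact hCq x hx
    · simp only [hl, if_neg hx, abs_neg]
      exact hCq _ (by linarith)
  have pU : IsPrim univ U (fun x => (l x : ℂ) * U x + V x) := by
    refine IsPrim.union (b1.congr_ae ?_) (a1.congr_on fun x hx => ?_)
    · filter_upwards [Measure.ae_ne volume (0 : ℝ)] with x hx hx'
      have : ¬ 0 ≤ x := not_le.mpr (lt_of_le_of_ne hx' hx)
      simp only [hl, if_neg this]
      push_cast
      ring
    · simp only [hl, if_pos (mem_Ici.mp hx)]
  -- The weak derivative of `u` is in `L²`: a bounded function times `u`, plus `G* f`.
  set v : H := (memLp_ofReal_mul hlm hlb u).toLp _ + vH with hv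
  have av : v =ᵐ[volume] fun x => (l x : ℂ) * U x + V x := by
    filter_upwards [Lp.coeFn_add ((memLp_ofReal_mul hlm hlb u).toLp _) vH,
      MemLp.coeFn_toLp (memLp_ofReal_mul hlm hlb u), aU, aV] with x h1 h2 h3 h4
    rw [hv, h1, Pi.add_apply, h2, h3, h4]
  obtain ⟨B, hB⟩ := h.potential_bdd
  have hWm : Measurable fun x => W |x| :=
    (h.continuous_potential.comp _root_.continuous_abs).measurable
  set w : H := (memLp_ofReal_mul hWm hB u).toLp _ - f with hw
  have aw : w =ᵐ[volume] fun x => (W |x| : ℂ) * U x - f x := by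
    filter_upwards [Lp.coeFn_sub ((memLp_ofReal_mul hWm hB u).toLp _) f,
      MemLp.coeFn_toLp (memLp_ofReal_mul hWm hB u), aU] with x h1 h2 h3
    rw [hw, h1, Pi.sub_apply, h2, h3]
  rw [mem_graph_add_mulOp_iff hWm hB]
  refine ⟨-w, (mem_graphZ_iff Z u (-w)).mpr ⟨v, w, U 0, (q 0 : ℂ) * U 0 + V 0,
    -(q (-0) : ℂ) * U 0 + V 0, ?_, ?_, ?_, ?_, rfl⟩, ?_⟩
  · have pU' : IsPrim univ U v := pU.congr_ae (by filter_upwards [av] with x hx _ using hx.symm)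
    filter_upwards [aU] with x hx
    rw [hx]
    exact pU'.eq_add trivial trivial
  · have a3 := a2.congr_ae (g := w) (by filter_upwards [aw] with x hx _ using hx.symm)
    filter_upwards [av] with x hx hx0
    rw [hx]
    simp only [hl, if_pos hx0.le]
    exact a3.eq_add (mem_Ici.mpr le_rfl) hx0.le
  · have b3 := b2.congr_ae (g := w) (by filter_upwards [aw] with x hx _ using hx.symm)
    filter_upwards [av] with x hx hx0
    rw [hx]
    simp only [hl, if_neg (not_le.mpr hx0)]
    rw [Complex.ofReal_neg]
    exact b3.eq_add (mem_Iic.mpr le_rfl) hx0.le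
  -- The terms `V 0` cancel and `2 q(0) = -Z` remains.
  · rw [neg_zero, h.log_zero]
    push_cast
    ring
  · filter_upwards [Lp.coeFn_neg w, aw, aU] with x h1 h2 h3
    rw [h1, Pi.neg_apply, h2, h3]
    ring

/-- Here `D = u' - h u`. The product `φ D` is a primitive of `-φ f` and both are integrable, so the
integral of `φ f` vanishes and `D = G* f`. Then `u / φ` is recovered by integrating `D / φ` from 0,
with constant `u(0) / φ(0)`. -/
theorem exists_eq_of_mem_graph (h : IsProfile κ Z p q W) {A : ℝ≥0}
    (hk : IsSchurKernel (ratioKernel p) A) {u f : H}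
    (huf : (u, f) ∈ (pointInteraction Z + mulOp (fun x => W |x|)).graph) :
    ⟪h.toH, f⟫_ℂ = 0 ∧ ∃ c : ℂ, u = kernelOp hk (star (kernelOp hk) f) + c • h.toH := by
  obtain ⟨B, hB⟩ := h.potential_bdd
  have hWm : Measurable fun x => W |x| :=
    (h.continuous_potential.comp _root_.continuous_abs).measurable
  obtain ⟨g, hg, hfg⟩ := (mem_graph_add_mulOp_iff hWm hB u f).mp huf
  obtain ⟨v, w, c, r, l, hc, hr, hl, hj, rfl⟩ := (mem_graphZ_iff Z u g).mp hg
  set U : ℝ → ℂ := fun x => c + ∫ t in 0..x, v t with hU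
  set F₁ : ℝ → ℂ := fun x => r + ∫ t in 0..x, w t with hF₁
  set F₂ : ℝ → ℂ := fun x => l + ∫ t in 0..x, w t with hF₂
  have pU : IsPrim univ U v := (IsPrim.primitive (intervalIntegrable_coe v) 0).const_add c
  have pF₁ : IsPrim univ F₁ w := (IsPrim.primitive (intervalIntegrable_coe w) 0).const_add r
  have pF₂ : IsPrim univ F₂ w := (IsPrim.primitive (intervalIntegrable_coe w) 0).const_add l
  have pU₁ : IsPrim (Ici 0) U F₁ := (pU.mono (subset_univ _)).congr_ae (by
    filter_upwards [hr, Measure.ae_ne volume (0 : ℝ)] with x hx hne hx0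
    exact hx (lt_of_le_of_ne hx0 (Ne.symm hne)))
  have pU₂ : IsPrim (Iic 0) U F₂ := (pU.mono (subset_univ _)).congr_ae (by
    filter_upwards [hl, Measure.ae_ne volume (0 : ℝ)] with x hx hne hx0
    exact hx (lt_of_le_of_ne hx0 hne))
  obtain ⟨a1, a2⟩ := h.groundState_Ici.isPrim_factor pU₁ (pF₁.mono (subset_univ _))
  obtain ⟨b1, b2⟩ := h.groundState_Iic.isPrim_factor pU₂ (pF₂.mono (subset_univ _))
  set m : ℝ → ℝ := fun x => if 0 ≤ x then q x else -q (-x) with hm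
  set D : ℝ → ℂ := fun x => if 0 ≤ x then F₁ x - (q x : ℂ) * U x
    else F₂ x - -(q (-x) : ℂ) * U x with hD
  have hD₁ : ∀ x ∈ Ici (0 : ℝ), F₁ x - (q x : ℂ) * U x = D x := fun x hx => by
    rw [hD]
    exact (if_pos (mem_Ici.mp hx)).symm
  -- At 0 the left formula must match the right one, which defines `D 0`; this is the jump
  -- condition.
  have hD₂ : ∀ x ∈ Iic (0 : ℝ), F₂ x - -(q (-x) : ℂ) * U x = D x := fun x hx => by
    rcases (mem_Iic.mp hx).lt_or_eq with hx0 | rfl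
    · rw [hD]
      exact (if_neg (not_le.mpr hx0)).symm
    · rw [← hD₁ 0 (mem_Ici.mpr le_rfl)]
      simp only [hF₁, hF₂, hU, intervalIntegral.integral_same, add_zero, neg_zero]
      rw [h.log_zero]
      push_cast
      linear_combination -hj
  have pΨ : IsPrim univ (fun x => (p |x| : ℂ) * D x) (fun x => -((p |x| : ℂ) * f x)) := by
    have e : ∀ᵐ x, (p |x| : ℂ) * (w x - (W |x| : ℂ) * U x) = -((p |x| : ℂ) * f x) := by
      filter_upwards [hfg, hc, Lp.coeFn_neg w] with x h1 h2 h3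
      rw [h1, h3, h2, Pi.neg_apply]
      ring
    refine IsPrim.union ((b1.congr_ae (e.mono fun x hx _ => hx)).congr fun x hx => ?_)
      ((a1.congr_ae (e.mono fun x hx _ => hx)).congr fun x hx => ?_)
    · simp only [hD₂ x hx]
    · simp only [hD₁ x hx]
  have hmm : Measurable m := Measurable.ite measurableSet_Ici h.continuous_log.measurable
    (h.continuous_log.comp continuous_neg).neg.measurable
  obtain ⟨Cq, hCq⟩ := h.log_bdd
  have hmb : ∀ x, |m x| ≤ Cq := by
    intro x
    by_cases hx : 0 ≤ x
    · simp only [hm, if_pos hx]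
      exact hCq x hx
    · simp only [hm, if_neg hx, abs_neg]
      exact hCq _ (by linarith)
  have hint : Integrable fun x => (p |x| : ℂ) * D x := by
    have h1 := h.integrable_mul (v - (memLp_ofReal_mul hmm hmb u).toLp _)
    refine h1.congr ?_
    filter_upwards [Lp.coeFn_sub v ((memLp_ofReal_mul hmm hmb u).toLp _),
      MemLp.coeFn_toLp (memLp_ofReal_mul hmm hmb u), hc, hr, hl,
      Measure.ae_ne volume (0 : ℝ)] with x h1 h2 h3 h4 h5 h6
    rw [h1, Pi.sub_apply, h2, h3]
    rcases lt_or_gt_of_ne h6 with h0 | h0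
    · rw [← hD₂ x h0.le, h5 h0]
      simp only [hm, if_neg (not_le.mpr h0)]
      push_cast
      ring
    · rw [← hD₁ x h0.le, h4 h0]
      simp only [hm, if_pos h0.le]
      ring
  have hφf := h.integrable_mul f
  have h0 : ∫ x, (p |x| : ℂ) * f x = 0 := by
    have := pΨ.integral_eq_zero hint hφf.neg
    rw [integral_neg] at this
    exact neg_eq_zero.mp this
  refine ⟨by rw [h.inner_toH, h0], U 0 * (p |0| : ℂ)⁻¹, ?_⟩
  have aD : star (kernelOp hk) f =ᵐ[volume] D := by
    filter_upwards [h.star_kernelOp_ae hk f h0] with y hy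
    have h1 := pΨ.eq_neg_integral_Ioi hint hφf.neg y
    rw [integral_neg, neg_neg] at h1
    rw [hy, ← h1]
    have := h.ofReal_ne_zero |y|
    field_simp
  have pUφ : IsPrim univ (fun x => U x * (p |x| : ℂ)⁻¹)
      (fun x => star (kernelOp hk) f x * (p |x| : ℂ)⁻¹) := by
    refine IsPrim.union (b2.congr_ae ?_) (a2.congr_ae ?_)
    · filter_upwards [aD] with x hx hx0
      rw [hx, hD₂ x hx0]
    · filter_upwards [aD] with x hx hx0
      rw [hx, hD₁ x hx0]
  refine Lp.ext ?_
  filter_upwards [hc, Lp.coeFn_add (kernelOp hk (star (kernelOp hk) f))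
    ((U 0 * (p |0| : ℂ)⁻¹) • h.toH), Lp.coeFn_smul (U 0 * (p |0| : ℂ)⁻¹) h.toH, h.toH_ae,
    kernelOp_ratio_ae hk (star (kernelOp hk) f)] with x h1 h2 h3 h4 h5
  rw [h2, Pi.add_apply, h3, Pi.smul_apply, h4, h5, h1, smul_eq_mul]
  have h6 := pUφ.eq_add (a := 0) (b := x) trivial trivial
  have h7 := h.ofReal_ne_zero |x|
  change U x = _
  rw [eq_sub_of_add_eq' h6.symm]
  field_simp
  ring

theorem hasReducedInverse (h : IsProfile κ Z p q W) {A : ℝ≥0}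
    (hk : IsSchurKernel (ratioKernel p) A) :
    HasReducedInverse (pointInteraction Z + mulOp (fun x => W |x|)) (kernelOp hk) h.toH := by
  refine fun u f => ⟨fun huf => h.exists_eq_of_mem_graph hk huf, ?_⟩
  rintro ⟨hf, c, rfl⟩
  exact h.mem_graph_of_eq hk hf c

end IsProfile

end DeltaNLS

/-! ### Properness below the threshold `κ²` -/

namespace DeltaNLS

open scoped InnerProductSpace ENNReal NNReal

/-- Integral operators with rows bounded in `L²` and vanishing outside a bounded interval map weakly
null sequences to null sequences. -/
theorem tendsto_kernelOp_zero {k : ℝ → ℝ → ℝ} {A : ℝ≥0} (hk : IsSchurKernel k A) {g : ℝ → ℂ}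
    (hg : MemLp g 2) (hle : ∀ x y, |k x y| ≤ ‖g y‖) {r : ℝ} (h0 : ∀ x, x ∉ Icc (-r) r → ∀ y, k x y = 0)
    {w : ℕ → H} (hw1 : ∀ n, ‖w n‖ ≤ 1) (hw : ∀ y, Tendsto (fun n => ⟪y, w n⟫_ℂ) atTop (𝓝 0)) :
    Tendsto (fun n => kernelOp hk (w n)) atTop (𝓝 0) := by
  have hrow : ∀ x, MemLp (fun y => (k x y : ℂ)) 2 := by
    intro x
    refine hg.of_le ?_ (Eventually.of_forall fun y => ?_)
    · exact (Complex.measurable_ofReal.comp hk.measurable.of_uncurry_left).aestronglyMeasurable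
    · rw [Complex.norm_real]
      exact hle x y
  have hin : ∀ x (f : H), ∫ y, (k x y : ℂ) * f y = ⟪(hrow x).toLp _, f⟫_ℂ := by
    intro x f
    rw [L2.inner_def]
    refine integral_congr_ae ?_
    filter_upwards [MemLp.coeFn_toLp (hrow x)] with y hy
    rw [RCLike.inner_apply, hy, Complex.conj_ofReal, mul_comm]
  have hbd : ∀ n x, ‖∫ y, (k x y : ℂ) * w n y‖ ≤ ‖hg.toLp g‖ := by
    intro n x
    rw [hin]
    refine (norm_inner_le_norm _ _).trans ?_
    refine (mul_le_of_le_one_right (norm_nonneg _) (hw1 n)).trans ?_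
    refine Lp.norm_le_norm_of_ae_le ?_
    filter_upwards [MemLp.coeFn_toLp (hrow x), MemLp.coeFn_toLp hg] with y h1 h2
    rw [h1, h2, Complex.norm_real]
    exact hle x y
  -- Dominated convergence: each row lies in `L²`, so weak convergence gives pointwise convergence,
  -- and the rows are uniformly bounded in `L²` and vanish for `x` outside a bounded interval.
  have hlim : Tendsto (fun n => ∫⁻ x, ‖kernelOp hk (w n) x‖ₑ ^ 2) atTop (𝓝 (∫⁻ _ : ℝ, 0)) := by
    refine tendsto_lintegral_of_dominated_convergence
      ((Icc (-r) r).indicator fun _ => ‖hg.toLp g‖ₑ ^ 2)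
      (fun n => (measurable_coe _).enorm.pow_const 2) (fun n => ?_) ?_ ?_
    · filter_upwards [kernelOp_ae hk (w n)] with x hx
      rw [hx]
      by_cases hxr : x ∈ Icc (-r) r
      · rw [indicator_of_mem hxr]
        gcongr
        exact enorm_le_iff_norm_le.mpr (hbd n x |>.trans (le_of_eq (by simp)))
      · simp [h0 x hxr]
    · rw [lintegral_indicator measurableSet_Icc, setLIntegral_const, Real.volume_Icc]
      exact ENNReal.mul_ne_top (ENNReal.pow_ne_top enorm_ne_top) ENNReal.ofReal_ne_top
    · have hall : ∀ᵐ x, ∀ n, kernelOp hk (w n) x = ∫ y, (k x y : ℂ) * w n y :=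
        ae_all_iff.mpr fun n => kernelOp_ae hk (w n)
      filter_upwards [hall] with x hx
      have h1 : Tendsto (fun n => kernelOp hk (w n) x) atTop (𝓝 0) := by
        simp only [hx, hin]
        exact hw _
      have h2 := (ENNReal.continuous_pow 2).tendsto _ |>.comp h1.enorm
      rw [enorm_zero, zero_pow two_ne_zero] at h2
      exact h2
  rw [lintegral_zero] at hlim
  simp only [lintegral_enorm_sq] at hlim
  rw [tendsto_zero_iff_norm_tendsto_zero]
  have h3 := (ENNReal.continuousAt_toReal ENNReal.zero_ne_top).tendsto.comp hlim
  have h4 : Tendsto (fun n => ‖kernelOp hk (w n)‖ ^ 2) atTop (𝓝 0) := by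
    refine h3.congr fun n => ?_
    simp
  have h5 := (Real.continuous_sqrt.tendsto 0).comp h4
  rw [Real.sqrt_zero] at h5
  refine h5.congr fun n => ?_
  simp

theorem exists_kernelOp_add {k k₁ k₂ : ℝ → ℝ → ℝ} {A A₁ A₂ : ℝ≥0} (hk : IsSchurKernel k A)
    (hk₁ : IsSchurKernel k₁ A₁) (hk₂ : IsSchurKernel k₂ A₂) (h : ∀ x y, k x y = k₁ x y + k₂ x y) :
    kernelOp hk = kernelOp hk₁ + kernelOp hk₂ := by
  ext1 f
  refine Lp.ext ?_
  rw [_root_.add_apply]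
  filter_upwards [kernelOp_ae hk f, kernelOp_ae hk₁ f, kernelOp_ae hk₂ f, hk₁.ae_integrable f,
    hk₂.ae_integrable f, Lp.coeFn_add (kernelOp hk₁ f) (kernelOp hk₂ f)] with x h1 h2 h3 h4 h5 h6
  rw [h6, Pi.add_apply, h1, h2, h3, ← integral_add h4 h5]
  congr 1
  ext y
  rw [h]
  push_cast
  ring

namespace IsProfile

variable {κ Z : ℝ} {p q W : ℝ → ℝ}

/-- Up to an operator mapping weakly null sequences to null sequences, the norm of the adjoint of
the ratio operator is at most `1 / κ`. -/
theorem exists_star_kernelOp_eq (h : IsProfile κ Z p q W) {A : ℝ≥0}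
    (hk : IsSchurKernel (ratioKernel p) A) {ε : ℝ} (hε : 0 < ε) :
    ∃ S₁ S₂ : H →L[ℂ] H, star (kernelOp hk) = S₁ + S₂ ∧ ‖S₁‖ ≤ (1 + ε) * κ⁻¹ ∧
      ∀ w : ℕ → H, (∀ n, ‖w n‖ ≤ 1) → (∀ y, Tendsto (fun n => ⟪y, w n⟫_ℂ) atTop (𝓝 0)) →
        Tendsto (fun n => S₂ (w n)) atTop (𝓝 0) := by
  obtain ⟨r, hr⟩ := h.ratio_asymp ε hε
  obtain ⟨C, hC⟩ := h.ratio
  have hC0 : 0 ≤ C := by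
    have := hC 0 0 le_rfl le_rfl
    rw [div_self (h.pos 0).ne'] at this
    simp at this
    linarith
  -- The cut is in `y`, the variable where the sharp ratio bound needs `|y| ≥ r`. After
  -- transposition the second kernel vanishes for first variable outside `[-r, r]`.
  set k₁ : ℝ → ℝ → ℝ := fun x y => if r ≤ |y| then ratioKernel p x y else 0 with hk₁
  set k₂ : ℝ → ℝ → ℝ := fun x y => if r ≤ |y| then 0 else ratioKernel p x y with hk₂
  have hset : MeasurableSet {z : ℝ × ℝ | r ≤ |z.2|} :=
    measurableSet_le measurable_const (_root_.continuous_abs.measurable.comp measurable_snd)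
  have m₁ : Measurable (Function.uncurry k₁) :=
    Measurable.ite hset h.measurable_ratioKernel measurable_const
  have m₂ : Measurable (Function.uncurry k₂) :=
    Measurable.ite hset measurable_const h.measurable_ratioKernel
  have s₁ : IsSchurKernel k₁ _ := IsSchurKernel.of_le h.pos_rate (C := 1 + ε) (by positivity) m₁
    fun x y => by
      by_cases hy : r ≤ |y|
      · simp only [hk₁, if_pos hy]
        exact h.abs_ratioKernel_le fun hxy => hr _ _ hy hxy
      · simp only [hk₁, if_neg hy, abs_zero]
        positivity
  have s₂ : IsSchurKernel k₂ _ := IsSchurKernel.of_le h.pos_rate hC0 m₂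
    fun x y => by
      by_cases hy : r ≤ |y|
      · simp only [hk₂, if_pos hy, abs_zero]
        positivity
      · simp only [hk₂, if_neg hy]
        exact h.abs_ratioKernel_le fun hxy => hC _ _ (abs_nonneg y) hxy
  refine ⟨kernelOp s₁.swap, kernelOp s₂.swap, ?_, ?_, ?_⟩
  · rw [star_kernelOp]
    refine exists_kernelOp_add _ _ _ fun x y => ?_
    by_cases hx : r ≤ |x| <;> simp [hk₁, hk₂, hx]
  · refine (norm_kernelOp_le _).trans (le_of_eq ?_)
    have := h.pos_rate
    exact Real.coe_toNNReal _ (by positivity)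
  · intro w hw1 hw
    obtain ⟨M, hM⟩ := isCompact_Icc.exists_bound_of_continuousOn (s := Icc (-r) r)
      (f := fun y => (p |y|)⁻¹) (h.continuous_abs.inv₀ fun y => (h.pos _).ne').continuousOn
    have hM' : ∀ y, y ∈ Icc (-r) r → (p |y|)⁻¹ ≤ |M| := fun y hy =>
      (le_abs_self _).trans ((hM y hy).trans (le_abs_self _))
    have hmem : ∀ y, ¬ r ≤ |y| → y ∈ Icc (-r) r := fun y hy => abs_le.mp (not_le.mp hy).le
    -- Since `φ⁻¹` is at most `|M|` on `[-r, r]`, all rows are dominated by `|M| φ`.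
    refine tendsto_kernelOp_zero s₂.swap (h.memLp.const_mul ((|M| : ℝ) : ℂ)) (r := r) ?_ ?_ hw1 hw
    · intro y x
      rw [norm_mul, Complex.norm_real, Complex.norm_real, Real.norm_of_nonneg (h.pos _).le,
        Real.norm_of_nonneg (abs_nonneg M)]
      by_cases hy : r ≤ |y|
      · simp only [hk₂, if_pos hy, abs_zero]
        have := h.pos |x|
        positivity
      · simp only [hk₂, if_neg hy]
        rw [ratioKernel, abs_mul, abs_of_pos (div_pos (h.pos _) (h.pos _)), div_eq_mul_inv]
        have h1 : |orientation x y| ≤ 1 := by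
          rw [orientation]
          split_ifs <;> simp
        have h2 := hM' y (hmem y hy)
        have h3 := h.pos |x|
        have h4 := h.pos |y|
        calc p |x| * (p |y|)⁻¹ * |orientation x y| ≤ p |x| * (p |y|)⁻¹ * 1 := by gcongr
          _ ≤ |M| * p |x| := by
            rw [mul_one, mul_comm]
            gcongr
    · intro y hy x
      have : r ≤ |y| := by
        by_contra h'
        exact hy (hmem y h')
      simp only [hk₂, if_pos this]

/-- Pairing `K u` with `u` gives `‖G* Q u‖²`, at most `(a ‖u‖ + o(1))²` with `a² < t⁻¹`. Pairing `(K
- t⁻¹) u` with `u` gives a quantity tending to 0, so `(t⁻¹ - a²) ‖u‖²` tends to 0. -/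
theorem weaklyProper (h : IsProfile κ Z p q W) {A : ℝ≥0} (hk : IsSchurKernel (ratioKernel p) A)
    {t : ℝ} (ht : 0 < t) (htκ : t < κ ^ 2) :
    WeaklyProper (reducedResolvent (kernelOp hk) h.toH - ((t⁻¹ : ℝ) : ℂ) • (1 : H →L[ℂ] H)) := by
  intro u hu1 hu hAu
  have hκ := h.pos_rate
  -- Possible because `κ⁻² < t⁻¹` is strict; this is where `t < κ²` enters.
  obtain ⟨ε, hε, hεt⟩ : ∃ ε : ℝ, 0 < ε ∧ ((1 + ε) * κ⁻¹) ^ 2 < t⁻¹ := by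
    have hc : ContinuousAt (fun ε : ℝ => ((1 + ε) * κ⁻¹) ^ 2) 0 := by fun_prop
    have h1 : ((1 + 0) * κ⁻¹) ^ 2 < t⁻¹ := by
      rw [add_zero, one_mul, inv_pow]
      gcongr
    have h2 := hc.eventually_lt continuousAt_const h1
    obtain ⟨δ, hδ, hball⟩ := Metric.eventually_nhds_iff.mp h2
    refine ⟨δ / 2, by positivity, hball ?_⟩
    rw [Real.dist_eq, sub_zero, abs_of_pos (by positivity)]
    linarith
  obtain ⟨S₁, S₂, hS, hS₁, hS₂⟩ := h.exists_star_kernelOp_eq hk hε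
  set K := reducedResolvent (kernelOp hk) h.toH with hK
  set Q : H →L[ℂ] H := (ℂ ∙ h.toH)ᗮ.starProjection with hQ
  have hQn : ∀ x, ‖Q x‖ ≤ ‖x‖ := fun x => Submodule.norm_starProjection_apply_le _ x
  have hQs : ∀ x y, ⟪Q x, y⟫_ℂ = ⟪x, Q y⟫_ℂ := fun x y =>
    Submodule.inner_starProjection_left_eq_right _ x y
  have hs0 : Tendsto (fun n => ‖S₂ (Q (u n))‖) atTop (𝓝 0) := by
    rw [← tendsto_zero_iff_norm_tendsto_zero]
    refine hS₂ _ (fun n => (hQn _).trans (hu1 n)) fun y => ?_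
    have h1 := ((Complex.continuous_conj.tendsto 0).comp (hu (Q y)))
    rw [map_zero] at h1
    refine h1.congr fun n => ?_
    simp only [Function.comp_apply]
    rw [← hQs, inner_conj_symm]
  have hd0 : Tendsto (fun n => ‖(K - ((t⁻¹ : ℝ) : ℂ) • (1 : H →L[ℂ] H)) (u n)‖) atTop (𝓝 0) :=
    tendsto_zero_iff_norm_tendsto_zero.mp hAu
  set a : ℝ := (1 + ε) * κ⁻¹ with ha
  have ha0 : 0 ≤ a := by positivity
  have key : ∀ n, (t⁻¹ - a ^ 2) * ‖u n‖ ^ 2 ≤ 2 * a * ‖S₂ (Q (u n))‖ + ‖S₂ (Q (u n))‖ ^ 2 +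
      ‖(K - ((t⁻¹ : ℝ) : ℂ) • (1 : H →L[ℂ] H)) (u n)‖ := by
    intro n
    have e1 : ⟪u n, K (u n)⟫_ℂ = ((‖star (kernelOp hk) (Q (u n))‖ ^ 2 : ℝ) : ℂ) := by
      have : K (u n) = Q (kernelOp hk (star (kernelOp hk) (Q (u n)))) := by
        simp [hK, reducedResolvent, hQ]
      rw [this, ← hQs, ← inner_star_apply, inner_self_eq_norm_sq_to_K]
      push_cast
      rfl
    have e2 : ⟪u n, (K - ((t⁻¹ : ℝ) : ℂ) • (1 : H →L[ℂ] H)) (u n)⟫_ℂ =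
        ((‖star (kernelOp hk) (Q (u n))‖ ^ 2 - t⁻¹ * ‖u n‖ ^ 2 : ℝ) : ℂ) := by
      rw [_root_.sub_apply, _root_.smul_apply, one_apply_eq_self, inner_sub_right,
        inner_smul_right, e1, inner_self_eq_norm_sq_to_K]
      push_cast
      rfl
    have e3 : t⁻¹ * ‖u n‖ ^ 2 - ‖star (kernelOp hk) (Q (u n))‖ ^ 2 ≤
        ‖(K - ((t⁻¹ : ℝ) : ℂ) • (1 : H →L[ℂ] H)) (u n)‖ := by
      have h1 := norm_inner_le_norm (𝕜 := ℂ) (u n)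
        ((K - ((t⁻¹ : ℝ) : ℂ) • (1 : H →L[ℂ] H)) (u n))
      rw [e2, Complex.norm_real, Real.norm_eq_abs] at h1
      have h2 := h1.trans (mul_le_of_le_one_left (norm_nonneg _) (hu1 n))
      have h3 := (neg_le_abs _).trans h2
      linarith
    have e4 : ‖star (kernelOp hk) (Q (u n))‖ ≤ a * ‖u n‖ + ‖S₂ (Q (u n))‖ := by
      rw [hS, _root_.add_apply]
      refine (norm_add_le _ _).trans ?_
      gcongr
      exact (S₁.le_opNorm _).trans (mul_le_mul hS₁ (hQn _) (norm_nonneg _) ha0)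
    have e5 : ‖star (kernelOp hk) (Q (u n))‖ ^ 2 ≤ (a * ‖u n‖ + ‖S₂ (Q (u n))‖) ^ 2 := by
      gcongr
    have e6 : a * ‖S₂ (Q (u n))‖ * ‖u n‖ ≤ a * ‖S₂ (Q (u n))‖ :=
      mul_le_of_le_one_right (by positivity) (hu1 n)
    nlinarith
  have hlim : Tendsto (fun n => (t⁻¹ - a ^ 2)⁻¹ * (2 * a * ‖S₂ (Q (u n))‖ + ‖S₂ (Q (u n))‖ ^ 2 +
      ‖(K - ((t⁻¹ : ℝ) : ℂ) • (1 : H →L[ℂ] H)) (u n)‖)) atTop (𝓝 0) := by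
    have := (((hs0.const_mul (2 * a)).add (hs0.pow 2)).add hd0).const_mul (t⁻¹ - a ^ 2)⁻¹
    simpa using this
  have hpos : 0 < t⁻¹ - a ^ 2 := sub_pos.mpr hεt
  have hsq : Tendsto (fun n => ‖u n‖ ^ 2) atTop (𝓝 0) := by
    refine squeeze_zero (fun n => by positivity) (fun n => ?_) hlim
    rw [le_inv_mul_iff₀ hpos]
    exact key n
  rw [tendsto_zero_iff_norm_tendsto_zero]
  have h5 := (Real.continuous_sqrt.tendsto 0).comp hsq
  rw [Real.sqrt_zero] at h5
  refine h5.congr fun n => ?_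
  simp

end IsProfile

end DeltaNLS

/-! ### Approximate eigenfunctions above the threshold -/

namespace DeltaNLS

open scoped InnerProductSpace ENNReal NNReal ContDiff

theorem norm_sq_le_of_ae_le {f : H} {F : ℝ → ℂ} (hf : f =ᵐ[volume] F) {a b c : ℝ} (hab : a ≤ b)
    (hF : ∀ x, ‖F x‖ ≤ c) (h0 : ∀ x, x ∉ Icc a b → F x = 0) :
    ‖f‖ ^ 2 ≤ c ^ 2 * (b - a) := by
  have h1 : ‖f‖ₑ ^ 2 ≤ ENNReal.ofReal (c ^ 2 * (b - a)) := by
    rw [← lintegral_enorm_sq]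
    calc ∫⁻ x, ‖f x‖ₑ ^ 2 ≤ ∫⁻ x, (Icc a b).indicator (fun _ => ENNReal.ofReal (c ^ 2)) x := by
          refine lintegral_mono_ae ?_
          filter_upwards [hf] with x hx
          rw [hx]
          by_cases hxab : x ∈ Icc a b
          · rw [indicator_of_mem hxab, ← ofReal_norm, ← ENNReal.ofReal_pow (norm_nonneg _)]
            exact ENNReal.ofReal_le_ofReal (pow_le_pow_left₀ (norm_nonneg _) (hF x) 2)
          · simp [h0 x hxab]
      _ = ENNReal.ofReal (c ^ 2 * (b - a)) := by
          rw [lintegral_indicator measurableSet_Icc, setLIntegral_const, Real.volume_Icc,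
            ← ENNReal.ofReal_mul (by positivity)]
  rw [← ofReal_norm, ← ENNReal.ofReal_pow (norm_nonneg _)] at h1
  exact (ENNReal.ofReal_le_ofReal_iff (mul_nonneg (sq_nonneg c) (sub_nonneg.mpr hab))).mp h1

theorem le_norm_sq_of_ae_le {f : H} {F : ℝ → ℂ} (hf : f =ᵐ[volume] F) {a b : ℝ}
    (hF : ∀ x, x ∈ Icc a b → 1 ≤ ‖F x‖) : b - a ≤ ‖f‖ ^ 2 := by
  have h1 : ENNReal.ofReal (b - a) ≤ ‖f‖ₑ ^ 2 := by
    rw [← lintegral_enorm_sq]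
    calc ENNReal.ofReal (b - a) = ∫⁻ x, (Icc a b).indicator (fun _ => 1) x := by
          rw [lintegral_indicator measurableSet_Icc, setLIntegral_const, Real.volume_Icc, one_mul]
      _ ≤ ∫⁻ x, ‖f x‖ₑ ^ 2 := by
          refine lintegral_mono_ae ?_
          filter_upwards [hf] with x hx
          rw [hx]
          by_cases hxab : x ∈ Icc a b
          · rw [indicator_of_mem hxab, ← ofReal_norm, ← ENNReal.ofReal_pow (norm_nonneg _),
              ← ENNReal.ofReal_one]
            exact ENNReal.ofReal_le_ofReal (one_le_pow₀ (hF x hxab))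
          · simp [hxab]
  rw [← ofReal_norm, ← ENNReal.ofReal_pow (norm_nonneg _)] at h1
  exact (ENNReal.ofReal_le_ofReal_iff (by positivity)).mp h1

/-- A compactly supported `C²` function vanishing at zero belongs to the domain. -/
theorem mem_graph_of_contDiff {Z : ℝ} {V : ℝ → ℝ} (hV : Measurable V) {B : ℝ}
    (hB : ∀ x, |V x| ≤ B) {F F' F'' : ℝ → ℂ} (h1 : ∀ x, HasDerivAt F (F' x) x)
    (h2 : ∀ x, HasDerivAt F' (F'' x) x) (h3 : Continuous F'') (h0 : F 0 = 0)
    {a b : ℝ} (hs : ∀ x, x ∉ Icc a b → F x = 0 ∧ F' x = 0 ∧ F'' x = 0) :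
    ∃ u f : H, (u, f) ∈ (pointInteraction Z + mulOp V).graph ∧ u =ᵐ[volume] F ∧
      f =ᵐ[volume] fun x => -F'' x + (V x : ℂ) * F x := by
  have c0 : Continuous F := continuous_iff_continuousAt.mpr fun x => (h1 x).continuousAt
  have c1 : Continuous F' := continuous_iff_continuousAt.mpr fun x => (h2 x).continuousAt
  have m0 : MemLp F 2 := c0.memLp_of_hasCompactSupport
    (HasCompactSupport.intro isCompact_Icc fun x hx => (hs x hx).1)
  have m1 : MemLp F' 2 := c1.memLp_of_hasCompactSupport
    (HasCompactSupport.intro isCompact_Icc fun x hx => (hs x hx).2.1)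
  have m2 : MemLp F'' 2 := h3.memLp_of_hasCompactSupport
    (HasCompactSupport.intro isCompact_Icc fun x hx => (hs x hx).2.2)
  have p0 : IsPrim univ F (m1.toLp F') := (IsPrim.of_hasDerivAt (fun x _ => h1 x) c1).congr_ae
    (m1.coeFn_toLp.mono fun x hx _ => hx.symm)
  have p1 : IsPrim univ F' (m2.toLp F'') := (IsPrim.of_hasDerivAt (fun x _ => h2 x) h3).congr_ae
    (m2.coeFn_toLp.mono fun x hx _ => hx.symm)
  refine ⟨m0.toLp F, -m2.toLp F'' + (memLp_ofReal_mul hV hB (m0.toLp F)).toLp _, ?_,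
    m0.coeFn_toLp, ?_⟩
  · rw [mem_graph_add_mulOp_iff hV hB]
    refine ⟨-m2.toLp F'', (mem_graphZ_iff _ _ _).mpr ⟨m1.toLp F', m2.toLp F'', F 0, F' 0, F' 0,
      ?_, ?_, ?_, by simp [h0], rfl⟩, ?_⟩
    · filter_upwards [m0.coeFn_toLp] with x hx
      rw [hx]
      exact p0.eq_add trivial trivial
    · filter_upwards [m1.coeFn_toLp] with x hx _
      rw [hx]
      exact p1.eq_add trivial trivial
    · filter_upwards [m1.coeFn_toLp] with x hx _
      rw [hx]
      exact p1.eq_add trivial trivial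
    · filter_upwards [Lp.coeFn_add (-m2.toLp F'') ((memLp_ofReal_mul hV hB (m0.toLp F)).toLp _),
        MemLp.coeFn_toLp (memLp_ofReal_mul hV hB (m0.toLp F))] with x e1 e2
      rw [e1, Pi.add_apply, e2]
  · filter_upwards [Lp.coeFn_add (-m2.toLp F'') ((memLp_ofReal_mul hV hB (m0.toLp F)).toLp _),
      MemLp.coeFn_toLp (memLp_ofReal_mul hV hB (m0.toLp F)), Lp.coeFn_neg (m2.toLp F''),
      m2.coeFn_toLp, m0.coeFn_toLp] with x e1 e2 e3 e4 e5
    rw [e1, Pi.add_apply, e2, e3, Pi.neg_apply, e4, e5]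

/-- A real point is in the spectrum if there are almost eigenvectors. -/
theorem mem_spec_of_forall_exists {T : H →ₗ.[ℂ] H} {z : ℂ}
    (h : ∀ ε > 0, ∃ u f : H, (u, f) ∈ T.graph ∧ ‖f - z • u‖ < ε * ‖u‖) : z ∈ spec T := by
  rintro ⟨S, -, hS⟩
  obtain ⟨u, f, huf, hlt⟩ := h (‖S‖ + 1)⁻¹ (by positivity)
  obtain ⟨y, rfl, rfl⟩ := (LinearPMap.mem_graph_iff _).mp huf
  have h1 : ‖(y : H)‖ ≤ ‖S‖ * ‖T y - z • (y : H)‖ := by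
    nth_rewrite 1 [← hS y]
    exact S.le_opNorm _
  rw [inv_mul_eq_div, lt_div_iff₀ (by positivity)] at hlt
  nlinarith [norm_nonneg (T y - z • (y : H))]

namespace IsProfile

variable {κ Z : ℝ} {p q W : ℝ → ℝ}

/-- A plane wave of frequency `k` is cut off at scale `n`, far to the right. The error is of size `C
/ n` on an interval of length `4n`, while the squared norm of the packet is at least `2n`. -/
theorem mem_spec (h : IsProfile κ Z p q W) {t : ℝ} (ht : κ ^ 2 ≤ t) :
    (t : ℂ) ∈ spec (pointInteraction Z + mulOp (fun x => W |x|)) := by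
  obtain ⟨B, hB⟩ := h.potential_bdd
  have hWm : Measurable fun x => W |x| :=
    (h.continuous_potential.comp _root_.continuous_abs).measurable
  set k : ℝ := Real.sqrt (t - κ ^ 2) with hk
  have hk2 : k ^ 2 = t - κ ^ 2 := Real.sq_sqrt (sub_nonneg.mpr ht)
  have hk0 : 0 ≤ k := Real.sqrt_nonneg _
  let χ : ContDiffBump (0 : ℝ) := ⟨1, 2, one_pos, one_lt_two⟩
  have hχ : ContDiff ℝ ∞ χ := χ.contDiff
  have hχ1 : ContDiff ℝ ∞ (deriv χ) := (contDiff_infty_iff_deriv.mp hχ).2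
  have hχ2 : ContDiff ℝ ∞ (deriv (deriv χ)) := (contDiff_infty_iff_deriv.mp hχ1).2
  have hd1 : ∀ x, HasDerivAt χ (deriv χ x) x := fun x =>
    ((contDiff_infty_iff_deriv.mp hχ).1 x).hasDerivAt
  have hd2 : ∀ x, HasDerivAt (deriv χ) (deriv (deriv χ) x) x := fun x =>
    ((contDiff_infty_iff_deriv.mp hχ1).1 x).hasDerivAt
  obtain ⟨C₁, hC₁⟩ := χ.hasCompactSupport.deriv.exists_bound_of_continuous hχ1.continuous
  obtain ⟨C₂, hC₂⟩ := χ.hasCompactSupport.deriv.deriv.exists_bound_of_continuous hχ2.continuous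
  have hC₁0 : 0 ≤ C₁ := (norm_nonneg _).trans (hC₁ 0)
  have hC₂0 : 0 ≤ C₂ := (norm_nonneg _).trans (hC₂ 0)
  have hsupp : ∀ y, 2 < |y| → χ y = 0 ∧ deriv χ y = 0 ∧ deriv (deriv χ) y = 0 := by
    intro y hy
    have h1 : y ∉ tsupport χ := by
      rw [χ.tsupport_eq, Metric.mem_closedBall, dist_zero_right, Real.norm_eq_abs, not_le]
      exact hy
    have h2 : y ∉ tsupport (deriv χ) := fun h' => h1 (tsupport_deriv_subset h')
    have h3 : y ∉ tsupport (deriv (deriv χ)) := fun h' => h2 (tsupport_deriv_subset h')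
    exact ⟨image_eq_zero_of_notMem_tsupport h1, image_eq_zero_of_notMem_tsupport h2,
      image_eq_zero_of_notMem_tsupport h3⟩
  refine mem_spec_of_forall_exists fun ε hε => ?_
  -- The summands bound the second derivative of the cutoff, the cross term, and the deviation of
  -- the potential from `κ²`.
  set C : ℝ := C₂ + 2 * k * C₁ + 1 with hC
  have hCpos : 0 < C := by positivity
  -- The inequality is what makes `(C / n)² · 4n < ε² · 2n`.
  obtain ⟨n, hn1, hnC⟩ : ∃ n : ℝ, 1 ≤ n ∧ 2 * C ^ 2 < ε ^ 2 * n ^ 2 := by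
    refine ⟨max 1 (2 * C / ε), le_max_left _ _, ?_⟩
    have h1 : 2 * C / ε ≤ max 1 (2 * C / ε) := le_max_right _ _
    rw [div_le_iff₀ hε] at h1
    have h2 : (2 * C) ^ 2 ≤ (max 1 (2 * C / ε) * ε) ^ 2 := by gcongr
    nlinarith [sq_nonneg C]
  have hn0 : 0 < n := by linarith
  obtain ⟨b, hb⟩ := eventually_atTop.mp (Metric.tendsto_nhds.mp h.potential_tendsto n⁻¹
    (by positivity))
  -- The support, within `2n` of `a`, lies to the right of `b`, where the potential is close to its
  -- limit, and of 0, where the jump condition becomes trivial.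
  set a : ℝ := max b 0 + 2 * n + 1 with ha
  have hab : ∀ x, x ∈ Icc (a - 2 * n) (a + 2 * n) → |W |x| - κ ^ 2| ≤ n⁻¹ := by
    intro x hx
    have h1 : max b 0 ≤ x := by linarith [hx.1]
    rw [abs_of_nonneg ((le_max_right b 0).trans h1)]
    exact (hb x ((le_max_left _ _).trans h1)).le
  set s : ℝ → ℝ := fun x => (x - a) / n with hs
  have hsd : ∀ x, HasDerivAt s n⁻¹ x := fun x => by
    have := ((hasDerivAt_id x).sub_const a).div_const n
    simpa [hs] using this
  have hsc : Continuous s := by fun_prop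
  have hout : ∀ x, x ∉ Icc (a - 2 * n) (a + 2 * n) → 2 < |s x| := by
    intro x hx
    rw [hs]
    simp only
    rw [abs_div, abs_of_pos hn0, lt_div_iff₀ hn0]
    by_contra h'
    rw [not_lt, abs_le] at h'
    exact hx ⟨by linarith, by linarith⟩
  set e : ℝ → ℂ := fun x => Complex.exp (Complex.I * k * x) with he
  have hed : ∀ x, HasDerivAt e (Complex.I * k * e x) x := fun x => by
    have h1 : HasDerivAt (fun x : ℝ => Complex.I * k * (x : ℂ)) (Complex.I * k) x := by
      simpa using (Complex.ofRealCLM.hasDerivAt (x := x)).const_mul (Complex.I * k)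
    exact h1.cexp.congr_deriv (mul_comm _ _)
  have hec : Continuous e := continuous_iff_continuousAt.mpr fun x => (hed x).continuousAt
  have hen : ∀ x, ‖e x‖ = 1 := fun x => by
    rw [he]
    simp only
    rw [show Complex.I * k * x = ((k * x : ℝ) : ℂ) * Complex.I by push_cast; ring]
    exact Complex.norm_exp_ofReal_mul_I _
  have hcomp : ∀ (g g' : ℝ → ℝ), (∀ x, HasDerivAt g (g' x) x) → ∀ x,
      HasDerivAt (fun x => (g (s x) : ℂ)) ((g' (s x) * n⁻¹ : ℝ) : ℂ) x := fun g g' hg x =>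
    ((hg (s x)).comp x (hsd x)).ofReal_comp
  set F : ℝ → ℂ := fun x => (χ (s x) : ℂ) * e x with hF
  set F' : ℝ → ℂ := fun x => ((deriv χ (s x) * n⁻¹ : ℝ) : ℂ) * e x +
    (χ (s x) : ℂ) * (Complex.I * k * e x) with hF'
  set F'' : ℝ → ℂ := fun x => ((deriv (deriv χ) (s x) * n⁻¹ * n⁻¹ : ℝ) : ℂ) * e x +
    2 * ((deriv χ (s x) * n⁻¹ : ℝ) : ℂ) * (Complex.I * k * e x) - (k : ℂ) ^ 2 * (χ (s x) : ℂ) * e x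
    with hF''
  have hFd : ∀ x, HasDerivAt F (F' x) x := fun x => (hcomp _ _ hd1 x).mul (hed x)
  have hFd' : ∀ x, HasDerivAt F' (F'' x) x := fun x => by
    have h1 : HasDerivAt (fun x => ((deriv χ (s x) * n⁻¹ : ℝ) : ℂ))
        ((deriv (deriv χ) (s x) * n⁻¹ * n⁻¹ : ℝ) : ℂ) x := by
      have := (hcomp _ _ hd2 x).mul_const ((n⁻¹ : ℝ) : ℂ)
      simpa only [← Complex.ofReal_mul] using this
    refine ((h1.mul (hed x)).add ((hcomp _ _ hd1 x).mul ((hed x).const_mul _))).congr_deriv ?_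
    rw [hF'']
    simp only
    linear_combination (k : ℂ) ^ 2 * (χ (s x) : ℂ) * e x * Complex.I_sq
  have hFc : Continuous F'' := by
    have i1 : Continuous fun x => ((deriv (deriv χ) (s x) * n⁻¹ * n⁻¹ : ℝ) : ℂ) :=
      Complex.continuous_ofReal.comp (((hχ2.continuous.comp hsc).mul_const _).mul_const _)
    have i2 : Continuous fun x => ((deriv χ (s x) * n⁻¹ : ℝ) : ℂ) :=
      Complex.continuous_ofReal.comp ((hχ1.continuous.comp hsc).mul_const _)
    have i3 : Continuous fun x => ((χ (s x) : ℝ) : ℂ) :=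
      Complex.continuous_ofReal.comp (hχ.continuous.comp hsc)
    exact ((i1.mul hec).add ((i2.const_mul 2).mul (hec.const_mul _))).sub
      ((i3.const_mul _).mul hec)
  have hzero : ∀ x, x ∉ Icc (a - 2 * n) (a + 2 * n) → F x = 0 ∧ F' x = 0 ∧ F'' x = 0 := by
    intro x hx
    obtain ⟨z0, z1, z2⟩ := hsupp _ (hout x hx)
    simp [hF, hF', hF'', z0, z1, z2]
  have hF0 : F 0 = 0 := by
    refine (hzero 0 fun h' => ?_).1
    have := h'.1
    have h3 := le_max_right b 0
    linarith
  obtain ⟨u, f, huf, hu, hf⟩ := mem_graph_of_contDiff (Z := Z) hWm hB hFd hFd' hFc hF0 hzero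
  refine ⟨u, f, huf, ?_⟩
  have hfu : (f - (t : ℂ) • u : H) =ᵐ[volume] fun x => -F'' x + (W |x| : ℂ) * F x - t * F x := by
    filter_upwards [Lp.coeFn_sub f ((t : ℂ) • u), Lp.coeFn_smul (t : ℂ) u, hu, hf] with x e1 e2 e3 e4
    rw [e1, Pi.sub_apply, e2, Pi.smul_apply, e3, e4, smul_eq_mul]
  have hbound : ∀ x, ‖-F'' x + (W |x| : ℂ) * F x - t * F x‖ ≤ C * n⁻¹ := by
    intro x
    by_cases hx : x ∈ Icc (a - 2 * n) (a + 2 * n)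
    · have e1 : -F'' x + (W |x| : ℂ) * F x - t * F x =
          -((deriv (deriv χ) (s x) * n⁻¹ * n⁻¹ : ℝ) : ℂ) * e x +
          (-(2 * ((deriv χ (s x) * n⁻¹ : ℝ) : ℂ) * (Complex.I * k * e x)) +
          ((W |x| - κ ^ 2 : ℝ) : ℂ) * (χ (s x) : ℂ) * e x) := by
        have hk2' : (k : ℂ) ^ 2 = t - (κ : ℂ) ^ 2 := by exact_mod_cast hk2
        simp only [hF'', hF]
        rw [hk2']
        push_cast
        ring
      rw [e1]
      have hni : n⁻¹ ≤ 1 := inv_le_one_of_one_le₀ hn1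
      have hni0 : 0 < n⁻¹ := inv_pos.mpr hn0
      have b1 : ‖-((deriv (deriv χ) (s x) * n⁻¹ * n⁻¹ : ℝ) : ℂ) * e x‖ ≤ C₂ * n⁻¹ := by
        rw [norm_mul, hen, mul_one, norm_neg, Complex.norm_real, norm_mul, norm_mul,
          Real.norm_of_nonneg hni0.le]
        calc ‖deriv (deriv χ) (s x)‖ * n⁻¹ * n⁻¹ ≤ C₂ * n⁻¹ * 1 := by
              gcongr
              exact hC₂ _
          _ = C₂ * n⁻¹ := mul_one _
      have b2 : ‖-(2 * ((deriv χ (s x) * n⁻¹ : ℝ) : ℂ) * (Complex.I * k * e x))‖ ≤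
          2 * k * C₁ * n⁻¹ := by
        rw [norm_neg, norm_mul, norm_mul, norm_mul, norm_mul, hen, mul_one, Complex.norm_I, one_mul,
          Complex.norm_real, Complex.norm_real, norm_mul, Real.norm_of_nonneg hni0.le,
          Real.norm_of_nonneg hk0, Complex.norm_ofNat]
        calc 2 * (‖deriv χ (s x)‖ * n⁻¹) * k ≤ 2 * (C₁ * n⁻¹) * k := by
              gcongr
              exact hC₁ _
          _ = 2 * k * C₁ * n⁻¹ := by ring
      have b3 : ‖((W |x| - κ ^ 2 : ℝ) : ℂ) * (χ (s x) : ℂ) * e x‖ ≤ n⁻¹ := by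
        rw [norm_mul, hen, mul_one, norm_mul, Complex.norm_real, Complex.norm_real,
          Real.norm_eq_abs, Real.norm_of_nonneg χ.nonneg]
        exact (mul_le_of_le_one_right (abs_nonneg _) χ.le_one).trans (hab x hx)
      refine (norm_add_le _ _).trans ((add_le_add b1 ((norm_add_le _ _).trans
        (add_le_add b2 b3))).trans (le_of_eq ?_))
      rw [hC]
      ring
    · obtain ⟨z0, -, z2⟩ := hzero x hx
      rw [z0, z2]
      simp only [neg_zero, mul_zero, add_zero, sub_zero, norm_zero]
      positivity
  have hup := norm_sq_le_of_ae_le hfu (a := a - 2 * n) (b := a + 2 * n) (by linarith)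
    hbound (fun x hx => by
      obtain ⟨z0, -, z2⟩ := hzero x hx
      simp [z0, z2])
  have hlow := le_norm_sq_of_ae_le hu (a := a - n) (b := a + n) (fun x hx => by
    rw [hF]
    simp only
    rw [norm_mul, hen, mul_one, χ.one_of_mem_closedBall]
    · simp
    · rw [Metric.mem_closedBall, dist_zero_right, Real.norm_eq_abs, hs]
      simp only
      change |(x - a) / n| ≤ 1
      rw [abs_div, abs_of_pos hn0, div_le_one hn0, abs_le]
      exact ⟨by linarith [hx.1], by linarith [hx.2]⟩)
  have hup' : ‖f - (t : ℂ) • u‖ ^ 2 * n ≤ 4 * C ^ 2 := by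
    have e1 : (C * n⁻¹) ^ 2 * (a + 2 * n - (a - 2 * n)) * n = 4 * C ^ 2 := by
      field_simp
      ring
    calc _ ≤ (C * n⁻¹) ^ 2 * (a + 2 * n - (a - 2 * n)) * n := by gcongr
      _ = _ := e1
  refine lt_of_pow_lt_pow_left₀ 2 (by positivity) ?_
  rw [mul_pow]
  have h7 : ε ^ 2 * (2 * n) ≤ ε ^ 2 * ‖u‖ ^ 2 := by
    gcongr
    linarith
  have h8 : ‖f - (t : ℂ) • u‖ ^ 2 * n < ε ^ 2 * (2 * n) * n := by nlinarith
  exact (lt_of_mul_lt_mul_right h8 hn0.le).trans_le h7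

end IsProfile

end DeltaNLS

/-! ### The explicit profile -/

namespace DeltaNLS

open scoped InnerProductSpace ENNReal NNReal

section Profile

variable {l₁ l₂ ω Z : ℝ}

theorem amp_sq_pos (hl₂ : 0 < l₂ ∨ (l₂ < 0 ∧ -ω < -(3 * l₁ ^ 2) / (16 * l₂))) (hω : ω < 0) :
    0 < (l₁ / 4) ^ 2 - l₂ / 3 * ω := by
  rcases hl₂ with h | ⟨h, h'⟩
  · nlinarith [sq_nonneg (l₁ / 4)]
  · rw [lt_div_iff_of_neg (by linarith)] at h'
    nlinarith

theorem amp_pos (h : 0 < (l₁ / 4) ^ 2 - l₂ / 3 * ω) : 0 < amp l₁ l₂ ω := Real.sqrt_pos.mpr h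

theorem exists_le_R (hl₁ : 0 < l₁) (hω : ω < 0) (hA : 0 < amp l₁ l₂ ω) {ρ : ℝ} (hρ : ρ < 1) :
    ∃ s, ρ ≤ R l₁ l₂ ω s := by
  set A := amp l₁ l₂ ω with hAdef
  have hκ : 0 < Real.sqrt (-ω) := Real.sqrt_pos.mpr (by linarith)
  -- With `cosh(2c) ≥ c` and `sinh = cosh - exp(-·)`, the required inequality reduces to `A(1 - ρ)c
  -- ≥ A + ρ l₁/4`, and `ρ < 1`.
  set c : ℝ := (A + l₁ / 4) / (A * (1 - ρ)) with hc
  have hA1 : 0 < A * (1 - ρ) := mul_pos hA (by linarith)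
  have hc0 : 0 < c := by positivity
  refine ⟨2 * c / (2 * Real.sqrt (-ω)), ?_⟩
  have e : 2 * Real.sqrt (-ω) * (2 * c / (2 * Real.sqrt (-ω))) = 2 * c := by field_simp
  rw [R, e, ← hAdef, le_div_iff₀ (by have := Real.cosh_pos (2 * c); positivity)]
  have h1 : c ≤ Real.cosh (2 * c) := by
    rw [Real.cosh_eq]
    have := Real.add_one_le_exp (2 * c)
    have := Real.exp_pos (-(2 * c))
    linarith
  have h2 : Real.sinh (2 * c) = Real.cosh (2 * c) - Real.exp (-(2 * c)) := by
    rw [Real.cosh_eq, Real.sinh_eq]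
    ring
  have h3 : Real.exp (-(2 * c)) ≤ 1 := Real.exp_le_one_iff.mpr (by linarith)
  have h4 : A * (1 - ρ) * c = A + l₁ / 4 := by
    rw [hc, mul_div_cancel₀ _ hA1.ne']
  rw [h2]
  nlinarith [mul_le_mul_of_nonneg_left h1 hA1.le, mul_le_mul_of_nonneg_left h3 hA.le]

theorem R_neg (s : ℝ) : R l₁ l₂ ω (-s) = -R l₁ l₂ ω s := by
  rw [R, R, mul_neg, Real.sinh_neg, Real.cosh_neg]
  ring

theorem continuous_R (hl₁ : 0 < l₁) (hA : 0 < amp l₁ l₂ ω) : Continuous (R l₁ l₂ ω) := by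
  unfold R
  refine Continuous.div (by fun_prop) (by fun_prop) fun s => ?_
  have := Real.cosh_pos (2 * Real.sqrt (-ω) * s)
  positivity

/-- The hypothesis on `Z` places the target in `(-1, 1)`, and the intermediate value theorem
provides a preimage, so `Function.invFun` does not return its default value. Injectivity of `R`
plays no role. -/
theorem R_shift (hl₁ : 0 < l₁) (hω : ω < 0) (hA : 0 < amp l₁ l₂ ω) (hZ : ω + Z ^ 2 / 4 < 0) :
    R l₁ l₂ ω (shift l₁ l₂ ω Z) = Z / (2 * Real.sqrt (-ω)) := by
  have hκ : 0 < Real.sqrt (-ω) := Real.sqrt_pos.mpr (by linarith)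
  have hκ2 : Real.sqrt (-ω) ^ 2 = -ω := Real.sq_sqrt (by linarith)
  have h1 : |Z / (2 * Real.sqrt (-ω))| < 1 := by
    rw [← sq_lt_one_iff_abs_lt_one, div_pow, mul_pow, hκ2, div_lt_one (by linarith)]
    linarith
  rw [abs_lt] at h1
  refine Function.invFun_eq ?_
  obtain ⟨b, hb⟩ := exists_le_R hl₁ hω hA h1.2
  obtain ⟨a, ha⟩ := exists_le_R (ρ := -(Z / (2 * Real.sqrt (-ω)))) hl₁ hω hA (by linarith)
  exact mem_range_of_exists_le_of_exists_ge (continuous_R hl₁ hA)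
    ⟨-a, by rw [R_neg]; linarith⟩ ⟨b, hb⟩

/-- `φ⁻²` on `[0, ∞)`. -/
noncomputable def invSqProfile (l₁ l₂ ω Z y : ℝ) : ℝ :=
  l₁ / 4 / (-ω) + amp l₁ l₂ ω / (-ω) * Real.cosh (2 * Real.sqrt (-ω) * (y + shift l₁ l₂ ω Z))

/-- The profile on `[0, ∞)`, extended by its formula. -/
noncomputable def halfProfile (l₁ l₂ ω Z y : ℝ) : ℝ := invSqProfile l₁ l₂ ω Z y ^ (-(1 / 2) : ℝ)

/-- The derivative of `invSqProfile`. -/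
noncomputable def invSqProfileDeriv (l₁ l₂ ω Z y : ℝ) : ℝ :=
  amp l₁ l₂ ω / (-ω) * (2 * Real.sqrt (-ω)) *
    Real.sinh (2 * Real.sqrt (-ω) * (y + shift l₁ l₂ ω Z))

theorem invSqProfile_pos (hl₁ : 0 < l₁) (hω : ω < 0) (hA : 0 < amp l₁ l₂ ω) (y : ℝ) :
    0 < invSqProfile l₁ l₂ ω Z y := by
  have h1 := Real.cosh_pos (2 * Real.sqrt (-ω) * (y + shift l₁ l₂ ω Z))
  have h2 : 0 < -ω := by linarith
  unfold invSqProfile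
  positivity

theorem hasDerivAt_invSqProfile (y : ℝ) :
    HasDerivAt (invSqProfile l₁ l₂ ω Z) (invSqProfileDeriv l₁ l₂ ω Z y) y := by
  have h1 : HasDerivAt (fun y => 2 * Real.sqrt (-ω) * (y + shift l₁ l₂ ω Z))
      (2 * Real.sqrt (-ω)) y := by
    simpa using ((hasDerivAt_id y).add_const (shift l₁ l₂ ω Z)).const_mul (2 * Real.sqrt (-ω))
  refine ((h1.cosh.const_mul (amp l₁ l₂ ω / (-ω))).const_add (l₁ / 4 / (-ω))).congr_deriv ?_
  rw [invSqProfileDeriv]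
  ring

theorem hasDerivAt_invSqProfileDeriv (hω : ω < 0) (y : ℝ) :
    HasDerivAt (invSqProfileDeriv l₁ l₂ ω Z)
      (4 * (-ω) * (invSqProfile l₁ l₂ ω Z y - l₁ / 4 / (-ω))) y := by
  have h1 : HasDerivAt (fun y => 2 * Real.sqrt (-ω) * (y + shift l₁ l₂ ω Z))
      (2 * Real.sqrt (-ω)) y := by
    simpa using ((hasDerivAt_id y).add_const (shift l₁ l₂ ω Z)).const_mul (2 * Real.sqrt (-ω))
  refine (h1.sinh.const_mul (amp l₁ l₂ ω / (-ω) * (2 * Real.sqrt (-ω)))).congr_deriv ?_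
  have hκ2 : Real.sqrt (-ω) ^ 2 = -ω := Real.sq_sqrt (by linarith)
  rw [invSqProfile, add_sub_cancel_left]
  linear_combination 4 * (amp l₁ l₂ ω / (-ω)) *
    Real.cosh (2 * Real.sqrt (-ω) * (y + shift l₁ l₂ ω Z)) * hκ2

theorem invSqProfileDeriv_sq (hω : ω < 0) (y : ℝ) :
    invSqProfileDeriv l₁ l₂ ω Z y ^ 2 = 4 * (-ω) *
      ((invSqProfile l₁ l₂ ω Z y - l₁ / 4 / (-ω)) ^ 2 - (amp l₁ l₂ ω / (-ω)) ^ 2) := by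
  have hκ2 : Real.sqrt (-ω) ^ 2 = -ω := Real.sq_sqrt (by linarith)
  rw [invSqProfile, add_sub_cancel_left, invSqProfileDeriv, mul_pow, mul_pow, mul_pow,
    Real.sinh_sq, hκ2]
  ring

theorem halfProfile_pos (hl₁ : 0 < l₁) (hω : ω < 0) (hA : 0 < amp l₁ l₂ ω) (y : ℝ) :
    0 < halfProfile l₁ l₂ ω Z y :=
  Real.rpow_pos_of_pos (invSqProfile_pos hl₁ hω hA y) _

theorem halfProfile_sq (hl₁ : 0 < l₁) (hω : ω < 0) (hA : 0 < amp l₁ l₂ ω) (y : ℝ) :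
    halfProfile l₁ l₂ ω Z y ^ 2 = (invSqProfile l₁ l₂ ω Z y)⁻¹ := by
  have h := invSqProfile_pos (Z := Z) hl₁ hω hA y
  rw [halfProfile, ← Real.rpow_natCast, ← Real.rpow_mul h.le, ← Real.rpow_neg_one]
  norm_num

/-- The logarithmic derivative of `halfProfile`. -/
noncomputable def logDerivProfile (l₁ l₂ ω Z y : ℝ) : ℝ :=
  -(invSqProfileDeriv l₁ l₂ ω Z y / (2 * invSqProfile l₁ l₂ ω Z y))

theorem hasDerivAt_halfProfile (hl₁ : 0 < l₁) (hω : ω < 0) (hA : 0 < amp l₁ l₂ ω) (y : ℝ) :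
    HasDerivAt (halfProfile l₁ l₂ ω Z)
      (logDerivProfile l₁ l₂ ω Z y * halfProfile l₁ l₂ ω Z y) y := by
  have h := invSqProfile_pos (Z := Z) hl₁ hω hA y
  refine ((hasDerivAt_invSqProfile y).rpow_const (p := -(1 / 2)) (Or.inl h.ne')).congr_deriv ?_
  rw [Real.rpow_sub_one h.ne', logDerivProfile, halfProfile]
  field_simp

/-- For `N = φ⁻²` the logarithmic derivative is `-N'/(2N)`. Both `N''` and `(N')²` are polynomials
in `N`, so the Riccati equation becomes a rational identity in `N`, which holds because `amp² = α² -
βω`. -/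
theorem hasDerivAt_logDerivProfile (hl₁ : 0 < l₁) (hω : ω < 0)
    (hA2 : 0 < (l₁ / 4) ^ 2 - l₂ / 3 * ω) (y : ℝ) :
    HasDerivAt (logDerivProfile l₁ l₂ ω Z) (-ω - l₁ * halfProfile l₁ l₂ ω Z y ^ 2 -
      l₂ * halfProfile l₁ l₂ ω Z y ^ 4 - logDerivProfile l₁ l₂ ω Z y ^ 2) y := by
  have hA := amp_pos hA2
  have h := invSqProfile_pos (Z := Z) hl₁ hω hA y
  refine ((hasDerivAt_invSqProfileDeriv hω y).div ((hasDerivAt_invSqProfile y).const_mul 2)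
    (by positivity)).neg.congr_deriv ?_
  have e4 : halfProfile l₁ l₂ ω Z y ^ 4 = (invSqProfile l₁ l₂ ω Z y)⁻¹ ^ 2 := by
    rw [← halfProfile_sq hl₁ hω hA]
    ring
  have eA : amp l₁ l₂ ω ^ 2 = (l₁ / 4) ^ 2 - l₂ / 3 * ω := Real.sq_sqrt hA2.le
  have eD := invSqProfileDeriv_sq (l₁ := l₁) (l₂ := l₂) (Z := Z) hω y
  rw [e4, halfProfile_sq hl₁ hω hA, logDerivProfile, neg_sq, div_pow]
  set N := invSqProfile l₁ l₂ ω Z y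
  set D := invSqProfileDeriv l₁ l₂ ω Z y
  have hω0 : ω ≠ 0 := hω.ne
  have eD' : D ^ 2 = 4 * (-ω) * (N - l₁ / 4 / (-ω)) ^ 2 -
      4 * ((l₁ / 4) ^ 2 - l₂ / 3 * ω) / (-ω) := by
    rw [eD, div_pow, eA]
    field_simp
    ring
  have e5 : -((4 * -ω * (N - l₁ / 4 / -ω) * (2 * N) - D * (2 * D)) / (2 * N) ^ 2) =
      -(4 * -ω * (N - l₁ / 4 / -ω) * (2 * N)) / (2 * N) ^ 2 + 2 * D ^ 2 / (2 * N) ^ 2 := by ring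
  rw [e5, eD']
  field_simp
  ring

/-- At 0 the logarithmic derivative is `-√(-ω) R(shift)`; `R` and the shift are designed to make
this `-Z/2`. -/
theorem logDerivProfile_zero (hl₁ : 0 < l₁) (hω : ω < 0) (hA : 0 < amp l₁ l₂ ω)
    (hZ : ω + Z ^ 2 / 4 < 0) : logDerivProfile l₁ l₂ ω Z 0 = -Z / 2 := by
  have h1 := R_shift hl₁ hω hA hZ
  have hκ : 0 < Real.sqrt (-ω) := Real.sqrt_pos.mpr (by linarith)
  have h2 : logDerivProfile l₁ l₂ ω Z 0 = -(Real.sqrt (-ω) * R l₁ l₂ ω (shift l₁ l₂ ω Z)) := by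
    rw [logDerivProfile, invSqProfileDeriv, invSqProfile, R, zero_add]
    have := Real.cosh_pos (2 * Real.sqrt (-ω) * shift l₁ l₂ ω Z)
    have h3 : 0 < -ω := by linarith
    set c := Real.cosh (2 * Real.sqrt (-ω) * shift l₁ l₂ ω Z)
    have h5 : l₁ / 4 / -ω + amp l₁ l₂ ω / -ω * c = (l₁ / 4 + amp l₁ l₂ ω * c) / -ω := by ring
    have h4 : 0 < l₁ / 4 + amp l₁ l₂ ω * c := by positivity
    have hω0 : ω ≠ 0 := hω.ne
    rw [h5]
    field_simp
  rw [h2, h1]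
  field_simp

theorem abs_logDerivProfile_le (hl₁ : 0 < l₁) (hω : ω < 0) (hA : 0 < amp l₁ l₂ ω) (y : ℝ) :
    |logDerivProfile l₁ l₂ ω Z y| ≤ Real.sqrt (-ω) := by
  have h := invSqProfile_pos (Z := Z) hl₁ hω hA y
  have hω' : 0 < -ω := by linarith
  rw [logDerivProfile, abs_neg, abs_div, abs_of_pos (by positivity : 0 < 2 * invSqProfile l₁ l₂ ω Z y),
    div_le_iff₀ (by positivity), invSqProfileDeriv, invSqProfile, abs_mul,
    abs_of_nonneg (by positivity)]
  set θ := 2 * Real.sqrt (-ω) * (y + shift l₁ l₂ ω Z)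
  have h1 : |Real.sinh θ| ≤ Real.cosh θ := by
    rw [Real.abs_sinh, ← Real.cosh_abs θ]
    exact (Real.sinh_lt_cosh _).le
  have h2 : 0 ≤ l₁ / 4 / -ω := by positivity
  calc amp l₁ l₂ ω / -ω * (2 * Real.sqrt (-ω)) * |Real.sinh θ|
      ≤ amp l₁ l₂ ω / -ω * (2 * Real.sqrt (-ω)) * Real.cosh θ := by gcongr
    _ = Real.sqrt (-ω) * (2 * (0 + amp l₁ l₂ ω / -ω * Real.cosh θ)) := by ring
    _ ≤ _ := by gcongr

/-- `exp (-2 κ y) φ⁻²`, a decreasing function with positive limit. -/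
noncomputable def scaledProfile (l₁ l₂ ω Z y : ℝ) : ℝ :=
  l₁ / 4 / (-ω) * Real.exp (-(2 * Real.sqrt (-ω) * y)) + amp l₁ l₂ ω / (-ω) / 2 *
    (Real.exp (2 * Real.sqrt (-ω) * shift l₁ l₂ ω Z) +
      Real.exp (-(4 * Real.sqrt (-ω) * y) - 2 * Real.sqrt (-ω) * shift l₁ l₂ ω Z))

theorem invSqProfile_eq (y : ℝ) : invSqProfile l₁ l₂ ω Z y =
    Real.exp (2 * Real.sqrt (-ω) * y) * scaledProfile l₁ l₂ ω Z y := by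
  rw [invSqProfile, scaledProfile, Real.cosh_eq]
  set κ := Real.sqrt (-ω)
  set s := shift l₁ l₂ ω Z
  have e1 : Real.exp (2 * κ * (y + s)) = Real.exp (2 * κ * y) * Real.exp (2 * κ * s) := by
    rw [← Real.exp_add]
    ring_nf
  have e2 : Real.exp (-(2 * κ * (y + s))) =
      Real.exp (2 * κ * y) * Real.exp (-(4 * κ * y) - 2 * κ * s) := by
    rw [← Real.exp_add]
    ring_nf
  have e3 : Real.exp (2 * κ * y) * Real.exp (-(2 * κ * y)) = 1 := by
    rw [← Real.exp_add, add_neg_cancel, Real.exp_zero]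
  rw [e1, e2]
  linear_combination -(l₁ / 4 / (-ω)) * e3

theorem antitone_scaledProfile (hl₁ : 0 < l₁) (hω : ω < 0) (hA : 0 < amp l₁ l₂ ω) :
    Antitone (scaledProfile l₁ l₂ ω Z) := by
  intro y x hyx
  have hω' : 0 < -ω := by linarith
  have hκ : 0 ≤ Real.sqrt (-ω) := Real.sqrt_nonneg _
  unfold scaledProfile
  gcongr

/-- The limit of `scaledProfile` at infinity. -/
noncomputable def scaledProfileLimit (l₁ l₂ ω Z : ℝ) : ℝ :=
  amp l₁ l₂ ω / (-ω) / 2 * Real.exp (2 * Real.sqrt (-ω) * shift l₁ l₂ ω Z)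

theorem scaledProfileLimit_pos (hω : ω < 0) (hA : 0 < amp l₁ l₂ ω) :
    0 < scaledProfileLimit l₁ l₂ ω Z := by
  have hω' : 0 < -ω := by linarith
  unfold scaledProfileLimit
  positivity

theorem scaledProfileLimit_le (hl₁ : 0 < l₁) (hω : ω < 0) (hA : 0 < amp l₁ l₂ ω) (y : ℝ) :
    scaledProfileLimit l₁ l₂ ω Z ≤ scaledProfile l₁ l₂ ω Z y := by
  have hω' : 0 < -ω := by linarith
  unfold scaledProfileLimit scaledProfile
  have h1 : 0 ≤ l₁ / 4 / (-ω) * Real.exp (-(2 * Real.sqrt (-ω) * y)) := by positivity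
  have h2 : 0 ≤ amp l₁ l₂ ω / (-ω) / 2 *
      Real.exp (-(4 * Real.sqrt (-ω) * y) - 2 * Real.sqrt (-ω) * shift l₁ l₂ ω Z) := by positivity
  linarith

theorem tendsto_scaledProfile (hω : ω < 0) :
    Tendsto (scaledProfile l₁ l₂ ω Z) atTop (𝓝 (scaledProfileLimit l₁ l₂ ω Z)) := by
  have hκ : 0 < Real.sqrt (-ω) := Real.sqrt_pos.mpr (by linarith)
  have h1 : Tendsto (fun y => Real.exp (-(2 * Real.sqrt (-ω) * y))) atTop (𝓝 0) :=
    Real.tendsto_exp_neg_atTop_nhds_zero.comp (tendsto_id.const_mul_atTop (by positivity))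
  have h2 : Tendsto (fun y => Real.exp (-(4 * Real.sqrt (-ω) * y) -
      2 * Real.sqrt (-ω) * shift l₁ l₂ ω Z)) atTop (𝓝 0) := by
    refine Real.tendsto_exp_atBot.comp (tendsto_atBot_add_const_right _ _ ?_)
    exact tendsto_neg_atTop_atBot.comp (tendsto_id.const_mul_atTop (by positivity))
  have h3 := (h1.const_mul (l₁ / 4 / (-ω))).add ((h2.const_add
    (Real.exp (2 * Real.sqrt (-ω) * shift l₁ l₂ ω Z))).const_mul (amp l₁ l₂ ω / (-ω) / 2))
  simp only [mul_zero, zero_add, add_zero] at h3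
  exact h3

/-- After squaring, the ratio is the exponential factor times a quotient of scaled profiles, whose
denominator is at least the limit. -/
theorem halfProfile_div_le (hl₁ : 0 < l₁) (hω : ω < 0) (hA : 0 < amp l₁ l₂ ω) (x y : ℝ) :
    halfProfile l₁ l₂ ω Z x / halfProfile l₁ l₂ ω Z y ≤
      Real.sqrt (scaledProfile l₁ l₂ ω Z y / scaledProfileLimit l₁ l₂ ω Z) *
        Real.exp (-(Real.sqrt (-ω) * (x - y))) := by
  have hx := halfProfile_pos (Z := Z) hl₁ hω hA x
  have hy := halfProfile_pos (Z := Z) hl₁ hω hA y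
  have hL := scaledProfileLimit_pos (l₁ := l₁) (l₂ := l₂) (Z := Z) hω hA
  have hM := scaledProfileLimit_le (Z := Z) hl₁ hω hA x
  have hMy := hL.trans_le (scaledProfileLimit_le (Z := Z) hl₁ hω hA y)
  refine le_of_sq_le_sq ?_ (by positivity)
  rw [div_pow, mul_pow, Real.sq_sqrt (by positivity), halfProfile_sq hl₁ hω hA,
    halfProfile_sq hl₁ hω hA, inv_div_inv, invSqProfile_eq, invSqProfile_eq, ← Real.exp_nat_mul]
  have e : Real.exp (((2 : ℕ) : ℝ) * -(Real.sqrt (-ω) * (x - y))) =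
      Real.exp (2 * Real.sqrt (-ω) * y) / Real.exp (2 * Real.sqrt (-ω) * x) := by
    rw [← Real.exp_sub]
    push_cast
    ring_nf
  rw [e, mul_div_mul_comm, mul_comm]
  gcongr

/-- By monotonicity of the scaled profile, `√(scaledProfile r / limit)` is a valid ratio constant
for all `y ≥ r`. Taking `r = 0` gives the uniform bound; letting `r` grow brings the constant to 1.
-/
theorem isProfile (hl₁ : 0 < l₁)
    (hl₂ : 0 < l₂ ∨ (l₂ < 0 ∧ -ω < -(3 * l₁ ^ 2) / (16 * l₂)))
    (hω : ω < 0) (hZ : ω + Z ^ 2 / 4 < 0) :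
    IsProfile (Real.sqrt (-ω)) Z (halfProfile l₁ l₂ ω Z) (logDerivProfile l₁ l₂ ω Z)
      (fun y => -ω - l₁ * halfProfile l₁ l₂ ω Z y ^ 2 - l₂ * halfProfile l₁ l₂ ω Z y ^ 4) := by
  have hA2 := amp_sq_pos hl₂ hω
  have hA := amp_pos hA2
  have hκ : 0 < Real.sqrt (-ω) := Real.sqrt_pos.mpr (by linarith)
  have hL := scaledProfileLimit_pos (l₁ := l₁) (l₂ := l₂) (Z := Z) hω hA
  have hcont : Continuous (halfProfile l₁ l₂ ω Z) := continuous_iff_continuousAt.mpr fun x =>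
    (hasDerivAt_halfProfile hl₁ hω hA x).continuousAt
  have hratio : ∀ r y x, r ≤ y → halfProfile l₁ l₂ ω Z x / halfProfile l₁ l₂ ω Z y ≤
      Real.sqrt (scaledProfile l₁ l₂ ω Z r / scaledProfileLimit l₁ l₂ ω Z) *
        Real.exp (-(Real.sqrt (-ω) * (x - y))) := by
    intro r y x hry
    refine (halfProfile_div_le hl₁ hω hA x y).trans ?_
    gcongr
    exact antitone_scaledProfile hl₁ hω hA hry
  refine ⟨hκ, halfProfile_pos hl₁ hω hA, hasDerivAt_halfProfile hl₁ hω hA,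
    hasDerivAt_logDerivProfile hl₁ hω hA2, by fun_prop, logDerivProfile_zero hl₁ hω hA hZ,
    ⟨_, fun x _ => abs_logDerivProfile_le hl₁ hω hA x⟩, ⟨_, fun x y hy _ => hratio 0 y x hy⟩, ?_, ?_⟩
  · intro ε hε
    have h1 : Tendsto (fun r => Real.sqrt (scaledProfile l₁ l₂ ω Z r /
        scaledProfileLimit l₁ l₂ ω Z)) atTop (𝓝 1) := by
      have := ((tendsto_scaledProfile (l₁ := l₁) (l₂ := l₂) (Z := Z) hω).div_const
        (scaledProfileLimit l₁ l₂ ω Z)).sqrt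
      rwa [div_self hL.ne', Real.sqrt_one] at this
    obtain ⟨r, hr⟩ := (h1.eventually (eventually_le_nhds (by linarith : 1 < 1 + ε))).exists
    refine ⟨r, fun x y hy _ => (hratio r y x hy).trans ?_⟩
    gcongr
  · have h0 : Tendsto (halfProfile l₁ l₂ ω Z) atTop (𝓝 0) := by
      have h1 : Tendsto (fun x => halfProfile l₁ l₂ ω Z 0 * (Real.sqrt (scaledProfile l₁ l₂ ω Z 0 /
          scaledProfileLimit l₁ l₂ ω Z) * Real.exp (-(Real.sqrt (-ω) * x)))) atTop (𝓝 0) := by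
        have h2 : Tendsto (fun x => Real.exp (-(Real.sqrt (-ω) * x))) atTop (𝓝 0) :=
          Real.tendsto_exp_neg_atTop_nhds_zero.comp (tendsto_id.const_mul_atTop hκ)
        have h3 := (h2.const_mul (Real.sqrt (scaledProfile l₁ l₂ ω Z 0 /
          scaledProfileLimit l₁ l₂ ω Z))).const_mul (halfProfile l₁ l₂ ω Z 0)
        simpa only [mul_zero] using h3
      refine squeeze_zero (fun x => (halfProfile_pos hl₁ hω hA x).le) (fun x => ?_) h1
      have h4 := hratio 0 0 x le_rfl
      rw [div_le_iff₀ (halfProfile_pos hl₁ hω hA 0), sub_zero] at h4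
      linarith
    have h5 := (((h0.pow 2).const_mul l₁).const_sub (-ω)).sub ((h0.pow 4).const_mul l₂)
    rw [Real.sq_sqrt (by linarith)]
    simpa using h5

end Profile

end DeltaNLS
-- The main theorem
theorem theorem4p1 (l₁ l₂ ω Z : ℝ) (hl₁ : 0 < l₁)
    (hl₂ : 0 < l₂ ∨ (l₂ < 0 ∧ -ω < -(3 * l₁ ^ 2) / (16 * l₂)))
    (hω : ω < 0) (hZ : ω + Z ^ 2 / 4 < 0) :
    -- the operator is self-adjoint, with domain `D_Z`
    ((DeltaNLS.L2Z l₁ l₂ ω Z).domain : Set DeltaNLS.H) = DeltaNLS.domainZ Z ∧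
    Dense ((DeltaNLS.L2Z l₁ l₂ ω Z).domain : Set DeltaNLS.H) ∧
    IsSelfAdjoint (DeltaNLS.L2Z l₁ l₂ ω Z) ∧
    -- zero is a simple eigenvalue, with the positive eigenfunction `φ_{ω,Z}`
    Module.finrank ℂ (DeltaNLS.eigenspace (DeltaNLS.L2Z l₁ l₂ ω Z) 0) = 1 ∧
    (∀ x, 0 < DeltaNLS.profile l₁ l₂ ω Z x) ∧
    (∃ hφ : MemLp (fun x => (DeltaNLS.profile l₁ l₂ ω Z x : ℂ)) 2 volume,
      MemLp.toLp _ hφ ∈ DeltaNLS.eigenspace (DeltaNLS.L2Z l₁ l₂ ω Z) 0) ∧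
    -- the rest of the spectrum is positive and bounded away from zero
    (∃ δ : ℝ, 0 < δ ∧
      DeltaNLS.spec (DeltaNLS.L2Z l₁ l₂ ω Z) \ {0} ⊆ Complex.ofReal '' Set.Ici δ) ∧
    -- the essential spectrum
    DeltaNLS.essSpec (DeltaNLS.L2Z l₁ l₂ ω Z) = Complex.ofReal '' Set.Ici (-ω) := by
  have h := DeltaNLS.isProfile hl₁ hl₂ hω hZ
  have hsq : Real.sqrt (-ω) ^ 2 = -ω := Real.sq_sqrt (by linarith)
  obtain ⟨A, hk⟩ := h.exists_isSchurKernel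
  obtain ⟨B, hB⟩ := h.potential_bdd
  -- By definition `profile` at `x` is `halfProfile` at `|x|`, so `L2Z` unfolds to the factorised
  -- operator.
  have hT : DeltaNLS.HasReducedInverse (DeltaNLS.L2Z l₁ l₂ ω Z) (DeltaNLS.kernelOp hk) h.toH :=
    h.hasReducedInverse hk
  have hspec : ∀ t : ℝ, -ω ≤ t → (t : ℂ) ∈ DeltaNLS.spec (DeltaNLS.L2Z l₁ l₂ ω Z) := fun t ht =>
    h.mem_spec (hsq.trans_le ht)
  refine ⟨DeltaNLS.domain_add_mulOp
    (h.continuous_potential.comp continuous_abs).measurable hB, hT.dense,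
    hT.isSelfAdjoint h.toH_ne_zero, ?_, fun x => h.pos |x|, ⟨h.memLp, ?_⟩, hT.spec_subset, ?_⟩
  · rw [hT.eigenspace_zero]
    exact finrank_span_singleton h.toH_ne_zero
  · rw [hT.eigenspace_zero]
    exact Submodule.mem_span_singleton_self _
  · ext z
    constructor
    · rintro ⟨hz, hzd⟩
      obtain ⟨δ, hδ, hsub⟩ := hT.spec_subset
      have hz0 : z ≠ 0 := by
        rintro rfl
        exact hzd (hT.zero_mem_discreteSpec h.toH_ne_zero)
      obtain ⟨t, ht, rfl⟩ := hsub ⟨hz, hz0⟩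
      have ht0 : 0 < t := hδ.trans_le ht
      refine ⟨t, ?_, rfl⟩
      by_contra hlt
      rw [Set.mem_Ici, not_le] at hlt
      exact hzd (hT.mem_discreteSpec ht0 hz (h.weaklyProper hk ht0 (hlt.trans_eq hsq.symm)))
    · rintro ⟨t, ht, rfl⟩
      refine ⟨hspec t ht, ?_⟩
      -- The whole half-line lies in the spectrum, so `t + ε / 2` shows that `t` is not isolated.
      rintro ⟨-, ⟨ε, hε, hiso⟩, -⟩
      have h1 := hiso ((t + ε / 2 : ℝ) : ℂ) (hspec _ (by linarith [Set.mem_Ici.mp ht])) (by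
        rw [Complex.dist_eq, ← Complex.ofReal_sub, Complex.norm_real, add_sub_cancel_left,
          Real.norm_of_nonneg (by positivity)]
        linarith)
      have h2 : t + ε / 2 = t := by exact_mod_cast h1
      linarith
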